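/- **Setting.** Let $Q$ and $Q'$ be finite sets of qubits (original and dual lattice), placed in a common (pseudo)metric space. A generalized Ising (GI) model on $Q$ is given by finitely many products $\mathcal O^Z_\alpha$ of Pauli-$Z$ operators and $\mathcal O^X_i$ of Pauli-$X$ operators, with Hamiltonian $-\sum_\alpha J_\alpha\mathcal O^Z_\alpha-\sum_i h_i\mathcal O^X_i$. A dual of it consists of $Z$-products $\Delta^Z_\alpha$ and $X$-products $\Delta^X_i$ on $Q'$ such that $\Delta^Z_\alpha,\Delta^X_i$ commute if and only if $\mathcal O^Z_\alpha,\mathcal O^X_i$ commute; a product of $\mathcal O$'s and the product of the $\Delta$'s with the same indices are called dual to each other. The $Z$-type symmetries of the model are all $Z$-products commuting with all $\mathcal O^X_i$; its $X$-type symmetries are the $X$-products commuting with all $\mathcal O^Z_\alpha$ and with all $Z$-type symmetries. For the dual, the $X$-type symmetries are all $X$-products commuting with all $\Delta^Z_\alpha$, and the $Z$-type symmetries are the $Z$-products commuting with all $\Delta^X_i$ and all $X$-type symmetries. Let $G^Z_r,G^X_s$ (for the model) and $\Gamma^X_\rho,\Gamma^Z_\sigma$ (for the dual) be finite families of such symmetries,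 and let $U^Z_1,\dots,U^Z_{n_Z}$; $U^X_1,\dots,U^X_{n_X}$; $\Omega^X_1,\dots,\Omega^X_{m_X}$; $\Omega^Z_1,\dots,\Omega^Z_{m_Z}$ be maximal families of symmetries of the respective type that are independent modulo the groups generated by $G^Z$, $G^X$, $\Gamma^X$, $\Gamma^Z$. **Locality assumptions.** There are constants $\ell,c\ge 0$ and a scale $R\ge 3\ell+c$ such that: each $G^Z_r,G^X_s,\Gamma^X_\rho,\Gamma^Z_\sigma$ has support of diameter $\le\ell$, and so has each union $\operatorname{supp}\mathcal O^Z_\alpha\cup\operatorname{supp}\Delta^Z_\alpha$ and $\operatorname{supp}\mathcal O^X_i\cup\operatorname{supp}\Delta^X_i$. Call a Pauli product local if its support has diameter $\le R$, and locally generated by a family if, up to a phase, it is a product of members supported in a region that contains its support and whose diameter exceeds that of the support by at most $c$. Every local Pauli product commuting with all $\mathcal O^X_i,G^Z_r$ is locally generated by $\{\mathcal O^X_i\}\cup\{G^Z_r\}$; every local Pauli product on $Q'$ commuting with all $\Delta^Z_\alpha,\Gamma^X_\rho$ is locally generated by $\{\Delta^Z_\alpha\}\cup\{\Gamma^X_\rho\}$;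 every local $X$-type symmetry of the model is locally generated by $\{G^X_s\}$; every local $Z$-type symmetry of the dual is locally generated by $\{\Gamma^Z_\sigma\}$. **Layered system.** Let $L\ge 3$ be odd, put a copy of $Q$ on each odd layer and a copy of $Q'$ on each even layer of $1,\dots,L$, and let $H_{\rm bulk}$ be minus the sum of all operators $\Delta^Z_{\alpha,2j}\mathcal O^Z_{\alpha,2j+1}\Delta^Z_{\alpha,2j+2}$ and $\mathcal O^X_{i,2j-1}\Delta^X_{i,2j}\mathcal O^X_{i,2j+1}$ that lie inside the system, all $G^Z_r,G^X_s$ on all odd layers, and all $\Gamma^X_\rho,\Gamma^Z_\sigma$ on all even layers (the second index is the layer). Let $\mathcal L_{\rm bdry}$ be the ground subspace of $H_{\rm bulk}$. The boundary terms acting on it are $\mathcal O^X_{i,1}$, $\mathcal O^X_{i,L}$, $\mathcal O^Z_{\alpha,1}\Delta^Z_{\alpha,2}$, $\Delta^Z_{\alpha,L-1}\mathcal O^Z_{\alpha,L}$. Let $\mathcal L$ be the Hilbert space of $Q$, and $\mathcal L_G\subset\mathcal L$ the subspace where all $G^Z_r=G^X_s=1$. For a subspace $\mathcal F\subset\mathcal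 L_G\otimes\mathcal L_G$, say that a subspace $W\subset\mathcal L_{\rm bdry}$ is *isomorphic to $\mathcal F$ with signs* $\varepsilon_i,\varepsilon'_i,\eta_\alpha,\eta'_\alpha\in\{\pm1\}$ if the boundary terms preserve $W$ and some unitary $W\cong\mathcal F$ carries them, in the above order, to $\varepsilon_i\,\mathcal O^X_i\otimes 1$, $\varepsilon'_i\,1\otimes\mathcal O^X_i$, $\eta_\alpha\,\mathcal O^Z_\alpha\otimes1$, $\eta'_\alpha\,1\otimes\mathcal O^Z_\alpha$. The boundary theory is *nonanomalous* if $\mathcal L_{\rm bdry}$ is an orthogonal direct sum of subspaces each isomorphic to all of $\mathcal L_G\otimes\mathcal L_G$ with all signs $+1$, and *anomalous* otherwise. **Claim.** The boundary theory is anomalous if and only if at least one of the following holds. 1. For some nonempty $\mathcal N\subset\{1,\dots,n_X\}$, $U^X_{\mathcal N}=\prod_{k\in\mathcal N}U^X_k$ can be written as a product $\prod_{i\in J}\mathcal O^X_i$ whose dual $\prod_{i\in J}\Delta^X_i$ is a product of operators $\Gamma^X_\rho$. 2. For some nonempty $\mathcal M\subset\{1,\dots,m_Z\}$, $\Omega^Z_{\mathcal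 M}=\prod_{k\in\mathcal M}\Omega^Z_k$ can be written as a product $\prod_{\alpha\in S}\Delta^Z_\alpha$ whose dual $\prod_{\alpha\in S}\mathcal O^Z_\alpha$ is a product of operators $G^Z_r$. Moreover, fix an even layer $2l_0$, and for every choice of signs let the corresponding *sector* be the joint eigenspace in $\mathcal L_{\rm bdry}$ of all $\Omega^Z_{k,2l_0}$, of the $U^Z_k$ on all internal odd layers $3,\dots,L-2$, and of the $\Omega^X_k$ on all even layers, with these signs as eigenvalues. Let $\mathcal L_{\rm fic}\subset\mathcal L_G\otimes\mathcal L_G$ be the subspace where $U^X_k\otimes U^X_k=1$ for $k=1,\dots,n_X$. Then: * $\mathcal L_{\rm bdry}$ is the orthogonal direct sum of the sectors. The sector with all eigenvalues $+1$ is nonzero and isomorphic to $\mathcal L_{\rm fic}$ with all signs $+1$. Every other nonzero sector is isomorphic to $\mathcal L_{\rm fic}$ with some signs satisfying $\varepsilon'_i=1$ and $\eta'_\alpha=\eta_\alpha$. * (Locked symmetry charges.) If $\mathcal N$ is as in 1, then $U^X_{\mathcal N,1}=U^X_{\mathcal N,L}$ on all of $\mathcal L_{\rm bdry}$, and in each nonzero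 sector both common values $\pm1$ occur. * (Locked boundary conditions.) If $\mathcal M,S$ are as in 2, then for every isomorphism of a nonzero sector to $\mathcal L_{\rm fic}$ with signs, $\prod_{\alpha\in S}\eta_\alpha=\prod_{\alpha\in S}\eta'_\alpha$ equals the eigenvalue of $\Omega^Z_{\mathcal M,2l_0}$ in that sector, and both values $\pm1$ of it occur among the nonzero sectors. -/

import Mathlib

open scoped TensorProduct Matrix

noncomputable section

namespace GI

/-! ### Qubits and Pauli operators

A product of Pauli `Z` (or Pauli `X`) operators over a set of qubits is encoded by the indicator
vector of that set over `ZMod 2`; the product of two such operators is the sum of the vectors. -/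

/-- Exponent vectors of `Z`-type (or `X`-type) Pauli products on the qubits `Q`. -/
abbrev Bits (Q : Type*) : Type _ := Q → ZMod 2

/-- The Hilbert space of the qubits `Q`, written in the computational basis. -/
abbrev Hilb (Q : Type*) [Fintype Q] [DecidableEq Q] : Type _ := EuclideanSpace ℂ (Q → ZMod 2)

/-- The sign `±1` as a complex number. -/
def sgn (s : ℤˣ) : ℂ := ((s : ℤ) : ℂ)

section Pauli

variable {Q : Type*} [Fintype Q] [DecidableEq Q]

/-- `∏_{q : a q = 1} X_q`: it flips the qubits in the support of `a`. -/
def pauliX (a : Bits Q) : Hilb Q →ₗ[ℂ] Hilb Q where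
  toFun ψ := WithLp.toLp 2 fun x => ψ (x + a)
  map_add' _ _ := rfl
  map_smul' _ _ := rfl

/-- `∏_{q : b q = 1} Z_q`: it multiplies the basis state `x` by `(-1) ^ (b ⬝ x)`. -/
def pauliZ (b : Bits Q) : Hilb Q →ₗ[ℂ] Hilb Q where
  toFun ψ := WithLp.toLp 2 fun x => (-1 : ℂ) ^ (b ⬝ᵥ x).val * ψ x
  map_add' φ ψ := by ext x; simp [mul_add]
  map_smul' c ψ := by ext x; simp [mul_left_comm]

theorem pauliX_apply (a : Bits Q) (ψ : Hilb Q) (x : Bits Q) : pauliX a ψ x = ψ (x + a) := rfl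

theorem pauliZ_apply (b : Bits Q) (ψ : Hilb Q) (x : Bits Q) :
    pauliZ b ψ x = (-1 : ℂ) ^ (b ⬝ᵥ x).val * ψ x := rfl

theorem neg_one_pow_val_add (u v : ZMod 2) :
    (-1 : ℂ) ^ (u + v).val = (-1) ^ u.val * (-1) ^ v.val := by
  have h : (u + v).val % 2 = (u.val + v.val) % 2 := by
    revert u v; decide
  rw [← pow_add, neg_one_pow_eq_pow_mod_two, h, ← neg_one_pow_eq_pow_mod_two]

theorem pauliX_add (a b : Bits Q) : pauliX (a + b) = pauliX a ∘ₗ pauliX b := by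
  refine LinearMap.ext fun ψ => ?_
  ext x
  simp only [LinearMap.comp_apply, pauliX_apply, add_assoc]

theorem pauliZ_add (a b : Bits Q) : pauliZ (a + b) = pauliZ a ∘ₗ pauliZ b := by
  refine LinearMap.ext fun ψ => ?_
  ext x
  simp only [LinearMap.comp_apply, pauliZ_apply, add_dotProduct, neg_one_pow_val_add, mul_assoc]

/-- The two operators commute if `b ⬝ᵥ a = 0` and anticommute if `b ⬝ᵥ a = 1`. -/
theorem pauliX_comp_pauliZ (a b : Bits Q) :
    pauliX a ∘ₗ pauliZ b = (-1 : ℂ) ^ (b ⬝ᵥ a).val • (pauliZ b ∘ₗ pauliX a) := by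
  refine LinearMap.ext fun ψ => ?_
  ext x
  simp only [LinearMap.comp_apply, LinearMap.smul_apply, PiLp.smul_apply, smul_eq_mul,
    pauliX_apply, pauliZ_apply, dotProduct_add, neg_one_pow_val_add]
  ring

end Pauli

/-! ### Locality -/

section Locality

variable {M : Type*} [PseudoMetricSpace M] {Q : Type*} [Fintype Q]

/-- The support of a `Z`-type or `X`-type Pauli product. -/
def supp (a : Bits Q) : Set Q := {q | a q ≠ 0}

/-- A general Pauli product, up to a phase: the pair `(a, b)` stands for `X^a Z^b`. -/
abbrev PauliVec (Q : Type*) : Type _ := Bits Q × Bits Q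

/-- The support of a Pauli product. -/
def PauliVec.supp (P : PauliVec Q) : Set Q := GI.supp P.1 ∪ GI.supp P.2

/-- Two Pauli products commute. -/
def PauliVec.Commutes (P P' : PauliVec Q) : Prop := P.2 ⬝ᵥ P'.1 + P'.2 ⬝ᵥ P.1 = 0

/-- `P` is, up to a phase, a product of members of the family `F` that lie inside a region
containing the support of `P`, whose diameter exceeds that of the support by at most `c`. -/
def LocallyGenerated (pos : Q → M) (c : ℝ) {ι : Type*} (F : ι → PauliVec Q) (P : PauliVec Q) :
    Prop :=
  ∃ U : Set Q, P.supp ⊆ U ∧ Metric.diam (pos '' U) ≤ Metric.diam (pos '' P.supp) + c ∧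
    P ∈ Submodule.span (ZMod 2) (F '' {i | (F i).supp ⊆ U})

/-- The family `F` is a complete set of local observables: each Pauli product of diameter at most
`R` that commutes with all members of `F` is locally generated by `F`. -/
def IsCSLO (pos : Q → M) (R c : ℝ) {ι : Type*} (F : ι → PauliVec Q) : Prop :=
  ∀ P : PauliVec Q, Metric.diam (pos '' P.supp) ≤ R → (∀ i, P.Commutes (F i)) →
    LocallyGenerated pos c F P

end Locality

/-! ### Symmetries -/

section Symmetries

variable {Q : Type*} [Fintype Q]

/-- The Pauli products of one type that commute with all the terms `T` of the other type. -/
def symmetries {ι : Type*} (T : ι → Bits Q) : Submodule (ZMod 2) (Bits Q) where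
  carrier := {b | ∀ i, b ⬝ᵥ T i = 0}
  zero_mem' := by intro i; simp
  add_mem' := by intro a b ha hb i; simp [add_dotProduct, ha i, hb i]
  smul_mem' := by intro t a ha i; simp [smul_dotProduct, ha i]

/-- The Pauli products of one type that commute with the Hamiltonian terms `T` of the other type
and with all the symmetries in `S`, which are of the other type too. -/
def compatibleSymmetries {ι : Type*} (T : ι → Bits Q) (S : Submodule (ZMod 2) (Bits Q)) :
    Submodule (ZMod 2) (Bits Q) :=
  symmetries T ⊓ symmetries (fun s : S => (s : Bits Q))

/-- `U` is a maximal family of elements of the symmetry group `S` that is independent modulo the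
group generated by the local symmetries `G`. -/
structure IsNonlocalGenerators {ι : Type*} (S : Submodule (ZMod 2) (Bits Q)) (G : ι → Bits Q)
    {n : ℕ} (U : Fin n → Bits Q) : Prop where
  mem : ∀ k, U k ∈ S
  indep : ∀ N : Finset (Fin n),
    ∑ k ∈ N, U k ∈ Submodule.span (ZMod 2) (Set.range G) → N = ∅
  maximal : S ≤ Submodule.span (ZMod 2) (Set.range G) ⊔ Submodule.span (ZMod 2) (Set.range U)

end Symmetries

/-! ### Generalized Ising models with a dual -/

/-- A generalized Ising model on the qubits `Q` with Ising terms `OZ` and transverse-field terms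
`OX`, a Kramers–Wannier dual of it on the qubits `Q'` with terms `DZ` and `DX`, and the chosen
generators of the local symmetries of both. -/
structure DualPair (Q Q' A I ιr ιs ιρ ισ : Type*) [Fintype Q] [Fintype Q'] where
  /-- The Ising terms. -/
  OZ : A → Bits Q
  /-- The transverse-field terms. -/
  OX : I → Bits Q
  /-- The duals of the Ising terms. -/
  DZ : A → Bits Q'
  /-- The duals of the transverse-field terms. -/
  DX : I → Bits Q'
  /-- The duality preserves commutation and anticommutation. -/
  dual : ∀ α i, OZ α ⬝ᵥ OX i = DZ α ⬝ᵥ DX i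
  /-- Local `Z`-type symmetries of the model. -/
  GZ : ιr → Bits Q
  /-- Local compatible `X`-type symmetries of the model. -/
  GX : ιs → Bits Q
  /-- Local `X`-type symmetries of the dual. -/
  ΓX : ιρ → Bits Q'
  /-- Local compatible `Z`-type symmetries of the dual. -/
  ΓZ : ισ → Bits Q'
  GZ_mem : ∀ r, GZ r ∈ symmetries OX
  GX_mem : ∀ s, GX s ∈ compatibleSymmetries OZ (symmetries OX)
  ΓX_mem : ∀ ρ, ΓX ρ ∈ symmetries DZ
  ΓZ_mem : ∀ σ, ΓZ σ ∈ compatibleSymmetries DX (symmetries DZ)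

namespace DualPair

variable {Q Q' A I ιr ιs ιρ ισ : Type*} [Fintype Q] [Fintype Q']
variable (P : DualPair Q Q' A I ιr ιs ιρ ισ)

/-- All `Z`-type symmetries of the model. -/
def symZ : Submodule (ZMod 2) (Bits Q) := symmetries P.OX

/-- The compatible `X`-type symmetries of the model. -/
def symX : Submodule (ZMod 2) (Bits Q) := compatibleSymmetries P.OZ P.symZ

/-- All `X`-type symmetries of the dual. -/
def dualSymX : Submodule (ZMod 2) (Bits Q') := symmetries P.DZ

/-- The compatible `Z`-type symmetries of the dual. -/
def dualSymZ : Submodule (ZMod 2) (Bits Q') := compatibleSymmetries P.DX P.dualSymX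

/-- The locality assumptions, for qubits placed in a common space `M` by `pos` and `pos'`. All
given operators have diameter at most `ℓ`, also jointly with their duals; operators of diameter at
most `R` count as local; local generation enlarges diameters by at most `c`; and the scale `R` is
large compared with `ℓ` and `c`. -/
structure IsLocal {M : Type*} [PseudoMetricSpace M] (pos : Q → M) (pos' : Q' → M)
    (ℓ c R : ℝ) : Prop where
  nonneg_ℓ : 0 ≤ ℓ
  nonneg_c : 0 ≤ c
  scale : 3 * ℓ + c ≤ R
  diam_Z : ∀ α, Metric.diam (pos '' supp (P.OZ α) ∪ pos' '' supp (P.DZ α)) ≤ ℓ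
  diam_X : ∀ i, Metric.diam (pos '' supp (P.OX i) ∪ pos' '' supp (P.DX i)) ≤ ℓ
  diam_GZ : ∀ r, Metric.diam (pos '' supp (P.GZ r)) ≤ ℓ
  diam_GX : ∀ s, Metric.diam (pos '' supp (P.GX s)) ≤ ℓ
  diam_ΓX : ∀ ρ, Metric.diam (pos' '' supp (P.ΓX ρ)) ≤ ℓ
  diam_ΓZ : ∀ σ, Metric.diam (pos' '' supp (P.ΓZ σ)) ≤ ℓ
  cslo : IsCSLO pos R c (Sum.elim (fun i => (P.OX i, 0)) (fun r => (0, P.GZ r)))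
  local_symX : ∀ a ∈ P.symX, Metric.diam (pos '' supp a) ≤ R →
    LocallyGenerated pos c (fun s => (P.GX s, 0)) (a, 0)
  dual_cslo : IsCSLO pos' R c (Sum.elim (fun α => (0, P.DZ α)) (fun ρ => (P.ΓX ρ, 0)))
  local_dualSymZ : ∀ b ∈ P.dualSymZ, Metric.diam (pos' '' supp b) ≤ R →
    LocallyGenerated pos' c (fun σ => (0, P.ΓZ σ)) (0, b)

/-! ### The two conditions -/

/-- The product of the `U_k`, `k ∈ N`, is the product of the `OX i`, `i ∈ J`, and the dual product
of the `DX i` is the identity modulo the local symmetries `ΓX`. -/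
def ChargeRelation {n : ℕ} (U : Fin n → Bits Q) (N : Finset (Fin n)) (J : Finset I) : Prop :=
  ∑ k ∈ N, U k = ∑ i ∈ J, P.OX i ∧
    ∑ i ∈ J, P.DX i ∈ Submodule.span (ZMod 2) (Set.range P.ΓX)

/-- The product of the `Ω_k`, `k ∈ N`, is the product of the `DZ α`, `α ∈ S`, and the dual product
of the `OZ α` is the identity modulo the local symmetries `GZ`. -/
def BoundaryRelation {n : ℕ} (Ω : Fin n → Bits Q') (N : Finset (Fin n)) (S : Finset A) : Prop :=
  ∑ k ∈ N, Ω k = ∑ α ∈ S, P.DZ α ∧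
    ∑ α ∈ S, P.OZ α ∈ Submodule.span (ZMod 2) (Set.range P.GZ)

end DualPair

/-! ### The layered system

For `K : ℕ` there are `L = 2 * K + 3` layers. The odd layers `1, 3, …, L` carry the qubits `Q` and
are indexed by `Fin (K + 2)`; the even layers `2, 4, …, L - 1` carry the qubits `Q'` and are indexed
by `Fin (K + 1)`. The even layer `j` lies between the odd layers `j.castSucc` and `j.succ`; the
internal odd layer `j.succ.castSucc`, `j : Fin K`, lies between the even layers `j.castSucc` and
`j.succ`. -/

/-- The qubits of the layered system. -/
abbrev Stack (Q Q' : Type*) (K : ℕ) : Type _ := (Fin (K + 2) × Q) ⊕ (Fin (K + 1) × Q')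

/-- A Pauli product of the original lattice, placed on an odd layer. -/
def onOdd {Q Q' : Type*} {K : ℕ} (j : Fin (K + 2)) (a : Bits Q) : Bits (Stack Q Q' K) :=
  Sum.elim (fun p => if p.1 = j then a p.2 else 0) 0

/-- A Pauli product of the dual lattice, placed on an even layer. -/
def onEven {Q Q' : Type*} {K : ℕ} (j : Fin (K + 1)) (a : Bits Q') : Bits (Stack Q Q' K) :=
  Sum.elim 0 (fun p => if p.1 = j then a p.2 else 0)

/-- The least eigenvalue of a self-adjoint operator on a finite-dimensional space. -/
def groundEnergy {E : Type*} [AddCommGroup E] [Module ℂ E] (H : E →ₗ[ℂ] E) : ℝ :=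
  sInf {e : ℝ | Module.End.HasEigenvalue H (e : ℂ)}

/-- The ground subspace of a self-adjoint operator on a finite-dimensional space. -/
def groundSpace {E : Type*} [AddCommGroup E] [Module ℂ E] (H : E →ₗ[ℂ] E) : Submodule ℂ E :=
  Module.End.eigenspace H (groundEnergy H : ℂ)

/-- The unitary `e` between the subspaces `W` and `F` carries the operator `T`, which preserves
`W`, to the operator `T'`. -/
def Carries {E E' : Type*} [NormedAddCommGroup E] [InnerProductSpace ℂ E]
    [NormedAddCommGroup E'] [InnerProductSpace ℂ E'] {W : Submodule ℂ E} {F : Submodule ℂ E'}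
    (e : W ≃ₗᵢ[ℂ] F) (T : E →ₗ[ℂ] E) (T' : E' →ₗ[ℂ] E') : Prop :=
  ∀ ψ : W, ∃ h : T ψ ∈ W, ((e ⟨T ψ, h⟩ : F) : E') = T' (e ψ : E')

/-- `W` is the orthogonal direct sum of the family `V` of subspaces. -/
def IsOrthogonalSum {E ι : Type*} [NormedAddCommGroup E] [InnerProductSpace ℂ E]
    (W : Submodule ℂ E) (V : ι → Submodule ℂ E) : Prop :=
  OrthogonalFamily ℂ (fun a => V a) (fun a => (V a).subtypeₗᵢ) ∧ ⨆ a, V a = W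

/-- Eigenvalues of the nonlocal operators that label the sectors. -/
structure SectorLabel (K nZ mX mZ : ℕ) where
  /-- Eigenvalues of the `ΩZ` on one even layer. -/
  dualZ : Fin mZ → ℤˣ
  /-- Eigenvalues of the `UZ` on the internal odd layers. -/
  origZ : Fin K → Fin nZ → ℤˣ
  /-- Eigenvalues of the `ΩX` on all even layers. -/
  dualX : Fin (K + 1) → Fin mX → ℤˣ

/-- The label with all eigenvalues `+1`. -/
def SectorLabel.trivial (K nZ mX mZ : ℕ) : SectorLabel K nZ mX mZ := ⟨1, 1, 1⟩

namespace DualPair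

variable {Q Q' A I ιr ιs ιρ ισ : Type*} [Fintype Q] [DecidableEq Q] [Fintype Q'] [DecidableEq Q']
variable (P : DualPair Q Q' A I ιr ιs ιρ ισ)

/-- The suspension `OX ΔX OX` centered at an even layer. -/
def suspX (K : ℕ) (i : I) (j : Fin (K + 1)) : Bits (Stack Q Q' K) :=
  onOdd j.castSucc (P.OX i) + onEven j (P.DX i) + onOdd j.succ (P.OX i)

/-- The suspension `ΔZ OZ ΔZ` centered at an internal odd layer. -/
def suspZ (K : ℕ) (α : A) (j : Fin K) : Bits (Stack Q Q' K) :=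
  onEven j.castSucc (P.DZ α) + onOdd j.succ.castSucc (P.OZ α) + onEven j.succ (P.DZ α)

/-- The bulk Hamiltonian with open boundary condition in the stacking direction. -/
def bulkHamiltonian [Fintype A] [Fintype I] [Fintype ιr] [Fintype ιs] [Fintype ιρ] [Fintype ισ]
    (K : ℕ) : Hilb (Stack Q Q' K) →ₗ[ℂ] Hilb (Stack Q Q' K) :=
  - (∑ α, ∑ j, pauliZ (P.suspZ K α j)) - (∑ i, ∑ j, pauliX (P.suspX K i j))
    - (∑ r, ∑ j, pauliZ (onOdd j (P.GZ r))) - (∑ s, ∑ j, pauliX (onOdd j (P.GX s)))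
    - (∑ ρ, ∑ j, pauliX (onEven j (P.ΓX ρ))) - (∑ σ, ∑ j, pauliZ (onEven j (P.ΓZ σ)))

/-- The boundary Hilbert space: the ground subspace of the bulk Hamiltonian. -/
def bdrySpace [Fintype A] [Fintype I] [Fintype ιr] [Fintype ιs] [Fintype ιρ] [Fintype ισ]
    (K : ℕ) : Submodule ℂ (Hilb (Stack Q Q' K)) :=
  groundSpace (P.bulkHamiltonian K)

/-- The boundary term `OX` on the first layer. -/
def firstX (K : ℕ) (i : I) : Hilb (Stack Q Q' K) →ₗ[ℂ] Hilb (Stack Q Q' K) :=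
  pauliX (onOdd 0 (P.OX i))

/-- The boundary term `OX` on the last layer. -/
def lastX (K : ℕ) (i : I) : Hilb (Stack Q Q' K) →ₗ[ℂ] Hilb (Stack Q Q' K) :=
  pauliX (onOdd (Fin.last (K + 1)) (P.OX i))

/-- The boundary term `OZ ΔZ` on the first two layers. -/
def firstZ (K : ℕ) (α : A) : Hilb (Stack Q Q' K) →ₗ[ℂ] Hilb (Stack Q Q' K) :=
  pauliZ (onOdd 0 (P.OZ α) + onEven 0 (P.DZ α))

/-- The boundary term `ΔZ OZ` on the last two layers. -/
def lastZ (K : ℕ) (α : A) : Hilb (Stack Q Q' K) →ₗ[ℂ] Hilb (Stack Q Q' K) :=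
  pauliZ (onEven (Fin.last K) (P.DZ α) + onOdd (Fin.last (K + 1)) (P.OZ α))

/-- The gauge-invariant space of the model: all local symmetries equal `1`. -/
def gaugeSpace : Submodule ℂ (Hilb Q) :=
  (⨅ r, Module.End.eigenspace (pauliZ (P.GZ r)) 1) ⊓
    ⨅ s, Module.End.eigenspace (pauliX (P.GX s)) 1

/-- The tensor square of the gauge-invariant space, inside the tensor square of the full space. -/
def twoCopies : Submodule ℂ (Hilb Q ⊗[ℂ] Hilb Q) :=
  LinearMap.range (TensorProduct.mapIncl P.gaugeSpace P.gaugeSpace)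

/-- The part of `twoCopies` on which all `U_k ⊗ U_k` equal `1`. -/
def ficSpace {n : ℕ} (U : Fin n → Bits Q) : Submodule ℂ (Hilb Q ⊗[ℂ] Hilb Q) :=
  P.twoCopies ⊓ ⨅ k, Module.End.eigenspace (TensorProduct.map (pauliX (U k)) (pauliX (U k))) 1

/-- The subspace `W` of the layered system is unitarily equivalent to the space `F` of two copies
of the model in such a way that the boundary terms on the two sides become, up to the given signs,
the terms of the first and of the second copy. The boundary Hamiltonian with coefficients `J, h` and
`J', h'` on the two sides then becomes the sum of the Hamiltonians of the two copies with
coefficients `η J, ε h` and `η' J', ε' h'`. -/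
def IsTwoCopies (K : ℕ) (W : Submodule ℂ (Hilb (Stack Q Q' K)))
    (F : Submodule ℂ (Hilb Q ⊗[ℂ] Hilb Q)) (ε ε' : I → ℤˣ) (η η' : A → ℤˣ) : Prop :=
  ∃ e : W ≃ₗᵢ[ℂ] F,
    (∀ i, Carries e (P.firstX K i)
      (sgn (ε i) • TensorProduct.map (pauliX (P.OX i)) LinearMap.id)) ∧
    (∀ i, Carries e (P.lastX K i)
      (sgn (ε' i) • TensorProduct.map LinearMap.id (pauliX (P.OX i)))) ∧
    (∀ α, Carries e (P.firstZ K α)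
      (sgn (η α) • TensorProduct.map (pauliZ (P.OZ α)) LinearMap.id)) ∧
    (∀ α, Carries e (P.lastZ K α)
      (sgn (η' α) • TensorProduct.map LinearMap.id (pauliZ (P.OZ α))))

/-- The boundary theory with `2 * K + 3` layers is anomalous: the boundary space is not an
orthogonal direct sum of sectors each of which is an unconstrained pair of copies of the model, with
the same action of the boundary terms in all sectors. -/
def Anomalous [Fintype A] [Fintype I] [Fintype ιr] [Fintype ιs] [Fintype ιρ] [Fintype ισ]
    (K : ℕ) : Prop :=
  ¬ ∃ (D : ℕ) (W : Fin D → Submodule ℂ (Hilb (Stack Q Q' K))),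
    IsOrthogonalSum (P.bdrySpace K) W ∧ ∀ a, P.IsTwoCopies K (W a) P.twoCopies 1 1 1 1

/-- The sector of the boundary space with given eigenvalues of the nonlocal operators `ΩZ` on the
even layer `l`, `UZ` on all internal odd layers, and `ΩX` on all even layers. -/
def sector [Fintype A] [Fintype I] [Fintype ιr] [Fintype ιs] [Fintype ιρ] [Fintype ισ]
    {nZ mX mZ : ℕ} (UZ : Fin nZ → Bits Q) (ΩX : Fin mX → Bits Q') (ΩZ : Fin mZ → Bits Q')
    (K : ℕ) (l : Fin (K + 1)) (t : SectorLabel K nZ mX mZ) :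
    Submodule ℂ (Hilb (Stack Q Q' K)) :=
  P.bdrySpace K ⊓
    (⨅ k, Module.End.eigenspace (pauliZ (onEven l (ΩZ k))) (sgn (t.dualZ k))) ⊓
    (⨅ j : Fin K, ⨅ k,
      Module.End.eigenspace (pauliZ (onOdd j.succ.castSucc (UZ k))) (sgn (t.origZ j k))) ⊓
    (⨅ j, ⨅ k, Module.End.eigenspace (pauliX (onEven j (ΩX k))) (sgn (t.dualX j k)))

end DualPair

end GI

end

noncomputable section

namespace GI

/-! ### Linear algebra over `ZMod 2` -/

section LinearAlgebra

variable {Q : Type*} [Fintype Q]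

/-! The problem reduces to linear algebra over `ZMod 2`. In the computational basis, a `Z`-type
eigenvalue condition restricts the support of a function on bit strings, and an `X`-type condition
fixes its behaviour under a translation. With all eigenvalues `+1`, a joint eigenspace is thus a
`codeSpace`: functions supported on a subspace `D`, the annihilator of the `Z`-type operators, and
invariant under the span `E` of the `X`-type ones. The bulk terms commute, hence have a common `+1`
eigenvector, and `bdrySpace` is such a space; so are `twoCopies` and `ficSpace` after the
identification `tensorFun`.

The main tool is `exists_codeSpace_equiv`: if `D = T(Y) + E`, restriction along `T` identifies the
code space of `(D, E)` unitarily with that of `(Y, Y ∩ T⁻¹ E)`. Here `T = onEnds` puts two strings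
on the first and last layer, and `Y = gaugePairs`. For the sector with all labels `+1`,
`symmetries_sectorZ` supplies `D = T(Y) + E` with `E = suspGroup K dualSymX`. An element of `E`
supported on the two end layers is read off layer by layer: even layers require the duals of the
products of transverse-field terms to be dual symmetries, and internal odd layers require
consecutive products to agree modulo `GX`. Hence `Y ∩ T⁻¹ E` consists of pairs of symmetries that
agree modulo `GX`, which is the constraint `U ⊗ U = 1`. Any other nonzero sector is mapped to this
one by some `X^a Z^b`, at the price of signs; `a` and `b` can be chosen so that `ε' = 1` and `η =
η'`.

Relation 1 makes `U_N` on the first layer times `U_N` on the last a product of bulk terms, so the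
two charges agree; an unconstrained pair of copies has tensor products with opposite charges.
Relation 2 makes the product over `S` of boundary Ising terms act as `Ω_M` on any even layer, which
takes both signs, whereas it is the identity on every unconstrained pair with signs `+1`.

Conversely, locality yields that each generator `GX` is a product of transverse-field terms whose
dual is in the span of `ΓX`, and likewise for `ΓZ`. If both relations fail, then dual-trivial
products of transverse-field terms are themselves locally trivial, and locally trivial products of
Ising terms have locally trivial duals. The first fact reduces `Y ∩ T⁻¹ E`, now with the bulk group
as `E`, to pairs from the span of `GX`. The second provides coset representatives that commute with
all boundary Ising terms. Cutting `bdrySpace` along these cosets gives unconstrained pairs of copies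
without signs. -/

theorem exists_dotProduct_eq_apply [DecidableEq Q] (f : Module.Dual (ZMod 2) (Bits Q)) :
    ∃ a : Bits Q, ∀ v, f v = v ⬝ᵥ a := by
  refine ⟨fun q => f (Pi.single q 1), fun v => ?_⟩
  rw [LinearMap.pi_apply_eq_sum_univ f v]
  refine Finset.sum_congr rfl fun q _ => ?_
  have : (fun j => if q = j then (1 : ZMod 2) else 0) = Pi.single q 1 := by
    ext j; simp [Pi.single_apply, eq_comm]
  rw [this, smul_eq_mul]

/-- A system of linear equations is solvable if its right-hand side satisfies all the linear
relations between the left-hand sides. -/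
theorem exists_dotProduct_eq {κ : Type*} [Fintype κ] (v : κ → Bits Q) (c : κ → ZMod 2)
    (h : ∀ w : κ → ZMod 2, ∑ k, w k • v k = 0 → ∑ k, w k * c k = 0) :
    ∃ a : Bits Q, ∀ k, v k ⬝ᵥ a = c k := by
  classical
  let φ : (κ → ZMod 2) →ₗ[ZMod 2] Bits Q := Fintype.linearCombination (ZMod 2) v
  let f : Module.Dual (ZMod 2) (κ → ZMod 2) := Fintype.linearCombination (ZMod 2) c
  have hf : f ∈ (LinearMap.ker φ).dualAnnihilator := by
    rw [Submodule.mem_dualAnnihilator]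
    intro w hw
    simpa [f, Fintype.linearCombination_apply] using
      h w (by simpa [φ, Fintype.linearCombination_apply] using hw)
  -- A functional that vanishes on the kernel of `φ` factors through `φ`; the factor is the dot
  -- product with the solution.
  rw [← LinearMap.range_dualMap_eq_dualAnnihilator_ker] at hf
  obtain ⟨g, hg⟩ := hf
  obtain ⟨a, ha⟩ := exists_dotProduct_eq_apply g
  refine ⟨a, fun k => ?_⟩
  have := LinearMap.congr_fun hg (Pi.single k 1)
  simpa [φ, f, ha] using this

/-- The double annihilator of a span is the span: a vector outside it is separated from it by a
functional, which is a dot product. -/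
theorem mem_span_of_forall_dotProduct_eq_zero {κ : Type*} (v : κ → Bits Q) (x : Bits Q)
    (h : ∀ a, (∀ k, v k ⬝ᵥ a = 0) → x ⬝ᵥ a = 0) :
    x ∈ Submodule.span (ZMod 2) (Set.range v) := by
  classical
  by_contra hx
  obtain ⟨f, hfx, hf⟩ := Submodule.exists_le_ker_of_notMem hx
  obtain ⟨a, ha⟩ := exists_dotProduct_eq_apply f
  refine hfx ?_
  rw [ha]
  refine h a fun k => ?_
  rw [← ha]
  exact hf (Submodule.subset_span ⟨k, rfl⟩)

theorem dotProduct_eq_zero_of_mem_span {S : Set (Bits Q)} {a x : Bits Q}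
    (hx : x ∈ Submodule.span (ZMod 2) S) (h : ∀ v ∈ S, v ⬝ᵥ a = 0) : x ⬝ᵥ a = 0 := by
  induction hx using Submodule.span_induction with
  | mem v hv => exact h v hv
  | zero => simp
  | add u v _ _ hu hv => rw [add_dotProduct, hu, hv, add_zero]
  | smul t v _ hv => rw [smul_dotProduct, hv, smul_zero]

theorem dotProduct_eq_zero_of_mem_span_right {S : Set (Bits Q)} {a x : Bits Q}
    (hx : x ∈ Submodule.span (ZMod 2) S) (h : ∀ v ∈ S, a ⬝ᵥ v = 0) : a ⬝ᵥ x = 0 := by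
  rw [dotProduct_comm]
  exact dotProduct_eq_zero_of_mem_span hx fun v hv => by rw [dotProduct_comm]; exact h v hv

/-- Two prescriptions that are compatible on the intersection of two subspaces. -/
theorem exists_dotProduct_eq_of_inf {E L : Submodule (ZMod 2) (Bits Q)} (w : Bits Q)
    (h : ∀ x ∈ E ⊓ L, w ⬝ᵥ x = 0) :
    ∃ w' : Bits Q, (∀ x ∈ E, w' ⬝ᵥ x = w ⬝ᵥ x) ∧ ∀ x ∈ L, w' ⬝ᵥ x = 0 := by
  classical
  have := Fintype.ofFinite E
  have := Fintype.ofFinite L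
  obtain ⟨a, ha⟩ := exists_dotProduct_eq (κ := E ⊕ L)
    (Sum.elim (fun x => (x : Bits Q)) (fun x => (x : Bits Q)))
    (Sum.elim (fun x => w ⬝ᵥ (x : Bits Q)) (fun _ => 0)) (fun c hc => by
      simp only [Fintype.sum_sum_type, Sum.elim_inl, Sum.elim_inr, mul_zero,
        Finset.sum_const_zero, add_zero] at hc ⊢
      -- In a linear relation the part from `E` is minus the part from `L`, so it lies in `E ⊓ L`,
      -- where both prescriptions vanish.
      have h1 : ∑ x : E, c (Sum.inl x) • (x : Bits Q) ∈ E :=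
        Submodule.sum_mem _ fun x _ => Submodule.smul_mem _ _ x.2
      have h2 : ∑ x : E, c (Sum.inl x) • (x : Bits Q) ∈ L := by
        rw [eq_neg_of_add_eq_zero_left hc]
        exact Submodule.neg_mem _ (Submodule.sum_mem _ fun x _ => Submodule.smul_mem _ _ x.2)
      have h3 := h _ ⟨h1, h2⟩
      rw [dotProduct_sum] at h3
      simpa [dotProduct_smul] using h3)
  refine ⟨a, fun x hx => ?_, fun x hx => ?_⟩
  · simpa [dotProduct_comm] using ha (Sum.inl ⟨x, hx⟩)
  · simpa [dotProduct_comm] using ha (Sum.inr ⟨x, hx⟩)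

theorem add_self_eq_zero_of_zmod_two {V : Type*} [AddCommGroup V] [Module (ZMod 2) V] (x : V) :
    x + x = 0 := by
  rw [← two_smul (ZMod 2) x, show (2 : ZMod 2) = 0 from rfl, zero_smul]

theorem add_add_cancel_of_zmod_two {V : Type*} [AddCommGroup V] [Module (ZMod 2) V] (x y : V) :
    x + y + y = x := by
  rw [add_assoc, add_self_eq_zero_of_zmod_two, add_zero]

theorem sub_eq_add_of_zmod_two {V : Type*} [AddCommGroup V] [Module (ZMod 2) V] (x y : V) :
    x - y = x + y := by
  rw [sub_eq_iff_eq_add, add_add_cancel_of_zmod_two]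

theorem eq_of_add_eq_zero_of_zmod_two {V : Type*} [AddCommGroup V] [Module (ZMod 2) V] {x y : V}
    (h : x + y = 0) : x = y := by
  rw [← add_add_cancel_of_zmod_two x y, h, zero_add]

theorem zmod_two_eq_zero_or_one (u : ZMod 2) : u = 0 ∨ u = 1 := by
  revert u; decide

end LinearAlgebra

/-! ### Signs -/

/-- The sign `(-1) ^ v`. -/
def bitSign (v : ZMod 2) : ℤˣ := (-1) ^ v.val

theorem sgn_bitSign (v : ZMod 2) : sgn (bitSign v) = (-1 : ℂ) ^ v.val := by
  simp [sgn, bitSign]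

@[simp] theorem bitSign_zero : bitSign 0 = 1 := rfl

@[simp] theorem bitSign_one : bitSign 1 = -1 := rfl

theorem bitSign_add (u v : ZMod 2) : bitSign (u + v) = bitSign u * bitSign v := by
  revert u v; decide

theorem bitSign_sum {ι : Type*} (S : Finset ι) (f : ι → ZMod 2) :
    bitSign (∑ i ∈ S, f i) = ∏ i ∈ S, bitSign (f i) := by
  classical
  induction S using Finset.induction_on with
  | empty => simp
  | insert i S hi ih => rw [Finset.sum_insert hi, Finset.prod_insert hi, bitSign_add, ih]

theorem bitSign_injective : Function.Injective bitSign := by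
  intro u v; revert u v; decide

@[simp] theorem sgn_one : sgn 1 = 1 := by simp [sgn]

@[simp] theorem sgn_neg_one : sgn (-1) = -1 := by simp [sgn]

theorem sgn_mul (s t : ℤˣ) : sgn (s * t) = sgn s * sgn t := by simp [sgn]

theorem sgn_mul_self (s : ℤˣ) : sgn s * sgn s = 1 := by
  rw [← sgn_mul, Int.units_mul_self, sgn_one]

theorem sgn_injective : Function.Injective sgn := by
  intro s t h
  exact Units.ext (by simpa [sgn] using h)

theorem sgn_ne_zero (s : ℤˣ) : sgn s ≠ 0 := by
  intro h
  simpa [h] using sgn_mul_self s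

@[simp] theorem norm_sgn (s : ℤˣ) : ‖sgn s‖ = 1 := by
  rcases Int.units_eq_one_or s with rfl | rfl <;> simp

/-! ### Pauli operators -/

section PauliOperators

variable {Q : Type*} [Fintype Q] [DecidableEq Q]

theorem pauliZ_apply_eq_sgn (b : Bits Q) (ψ : Hilb Q) (x : Bits Q) :
    pauliZ b ψ x = sgn (bitSign (b ⬝ᵥ x)) * ψ x := by
  rw [pauliZ_apply, sgn_bitSign]

@[simp] theorem pauliX_zero : pauliX (0 : Bits Q) = LinearMap.id := by
  refine LinearMap.ext fun ψ => ?_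
  ext x
  simp [pauliX_apply]

@[simp] theorem pauliZ_zero : pauliZ (0 : Bits Q) = LinearMap.id := by
  refine LinearMap.ext fun ψ => ?_
  ext x
  simp [pauliZ_apply]

theorem pauliX_pauliX (a : Bits Q) (ψ : Hilb Q) : pauliX a (pauliX a ψ) = ψ := by
  rw [← LinearMap.comp_apply, ← pauliX_add, add_self_eq_zero_of_zmod_two]; simp

theorem pauliZ_pauliZ (a : Bits Q) (ψ : Hilb Q) : pauliZ a (pauliZ a ψ) = ψ := by
  rw [← LinearMap.comp_apply, ← pauliZ_add, add_self_eq_zero_of_zmod_two]; simp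

theorem pauliX_comm (a b : Bits Q) (ψ : Hilb Q) :
    pauliX a (pauliX b ψ) = pauliX b (pauliX a ψ) := by
  rw [← LinearMap.comp_apply, ← LinearMap.comp_apply, ← pauliX_add, ← pauliX_add, add_comm]

theorem pauliZ_comm (a b : Bits Q) (ψ : Hilb Q) :
    pauliZ a (pauliZ b ψ) = pauliZ b (pauliZ a ψ) := by
  rw [← LinearMap.comp_apply, ← LinearMap.comp_apply, ← pauliZ_add, ← pauliZ_add, add_comm]

theorem pauliX_pauliZ (a b : Bits Q) (ψ : Hilb Q) :
    pauliX a (pauliZ b ψ) = sgn (bitSign (b ⬝ᵥ a)) • pauliZ b (pauliX a ψ) := by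
  rw [sgn_bitSign]
  exact LinearMap.congr_fun (pauliX_comp_pauliZ a b) ψ

theorem pauliZ_pauliX (a b : Bits Q) (ψ : Hilb Q) :
    pauliZ b (pauliX a ψ) = sgn (bitSign (b ⬝ᵥ a)) • pauliX a (pauliZ b ψ) := by
  rw [pauliX_pauliZ, smul_smul, sgn_mul_self, one_smul]

theorem norm_pauliX (a : Bits Q) (ψ : Hilb Q) : ‖pauliX a ψ‖ = ‖ψ‖ := by
  rw [EuclideanSpace.norm_eq, EuclideanSpace.norm_eq]
  congr 1
  exact Fintype.sum_equiv (Equiv.addRight a) _ _ fun x => by simp [pauliX_apply]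

theorem norm_pauliZ (b : Bits Q) (ψ : Hilb Q) : ‖pauliZ b ψ‖ = ‖ψ‖ := by
  rw [EuclideanSpace.norm_eq, EuclideanSpace.norm_eq]
  simp [pauliZ_apply_eq_sgn]

/-- The unitary `X^a Z^b`. -/
def pauliXZ (a b : Bits Q) : Hilb Q ≃ₗᵢ[ℂ] Hilb Q where
  toLinearEquiv := LinearEquiv.ofLinearMap (pauliX a ∘ₗ pauliZ b) (pauliZ b ∘ₗ pauliX a)
    (LinearMap.ext fun ψ => by simp [pauliZ_pauliZ, pauliX_pauliX])
    (LinearMap.ext fun ψ => by simp [pauliZ_pauliZ, pauliX_pauliX])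
  norm_map' ψ := by simp [norm_pauliX, norm_pauliZ]

theorem pauliXZ_apply (a b : Bits Q) (ψ : Hilb Q) : pauliXZ a b ψ = pauliX a (pauliZ b ψ) := rfl

theorem pauliX_pauliXZ (a b v : Bits Q) (ψ : Hilb Q) :
    pauliX v (pauliXZ a b ψ) = sgn (bitSign (b ⬝ᵥ v)) • pauliXZ a b (pauliX v ψ) := by
  rw [pauliXZ_apply, pauliX_comm, pauliX_pauliZ, map_smul, pauliXZ_apply]

theorem pauliZ_pauliXZ (a b v : Bits Q) (ψ : Hilb Q) :
    pauliZ v (pauliXZ a b ψ) = sgn (bitSign (v ⬝ᵥ a)) • pauliXZ a b (pauliZ v ψ) := by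
  rw [pauliXZ_apply, pauliZ_pauliX, pauliZ_comm, pauliXZ_apply]

/-- Preservation of inner products gives `⟪φ, ψ⟫ = s t ⟪φ, ψ⟫`, and `s t = -1` for distinct signs.
-/
theorem inner_eq_zero_of_involution {E : Type*} [NormedAddCommGroup E] [InnerProductSpace ℂ E]
    {T : E →ₗ[ℂ] E} (hT : ∀ ψ, ‖T ψ‖ = ‖ψ‖) {s t : ℤˣ} (hst : s ≠ t) {φ ψ : E}
    (hφ : T φ = sgn s • φ) (hψ : T ψ = sgn t • ψ) : inner ℂ φ ψ = 0 := by
  have h := (LinearMap.norm_map_iff_inner_map_map T).1 hT φ ψ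
  rw [hφ, hψ, inner_smul_left, inner_smul_right, ← mul_assoc] at h
  have h1 : (starRingEnd ℂ) (sgn s) * sgn t = -1 := by
    rcases Int.units_eq_one_or s with rfl | rfl <;> rcases Int.units_eq_one_or t with rfl | rfl <;>
      simp at hst ⊢
  rw [h1] at h
  have h2 : (2 : ℂ) * inner ℂ φ ψ = 0 := by linear_combination -h
  simpa using h2

end PauliOperators

/-! ### Joint eigenspaces -/

section StabSpace

variable {Q κ κ' : Type*} [Fintype Q] [DecidableEq Q]

/-- The joint eigenspace of the `Z`-type operators `z` and of the `X`-type operators `x`. -/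
def stabSpace (z : κ → Bits Q) (s : κ → ℤˣ) (x : κ' → Bits Q) (s' : κ' → ℤˣ) :
    Submodule ℂ (Hilb Q) :=
  (⨅ k, Module.End.eigenspace (pauliZ (z k)) (sgn (s k))) ⊓
    ⨅ k, Module.End.eigenspace (pauliX (x k)) (sgn (s' k))

variable {z : κ → Bits Q} {s : κ → ℤˣ} {x : κ' → Bits Q} {s' : κ' → ℤˣ}

theorem mem_stabSpace {ψ : Hilb Q} : ψ ∈ stabSpace z s x s' ↔
    (∀ k, pauliZ (z k) ψ = sgn (s k) • ψ) ∧ ∀ k, pauliX (x k) ψ = sgn (s' k) • ψ := by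
  simp [stabSpace, Submodule.mem_iInf]

theorem pauliZ_eq_smul_iff {b : Bits Q} {t : ℤˣ} {ψ : Hilb Q} :
    pauliZ b ψ = sgn t • ψ ↔ ∀ y, ψ y ≠ 0 → bitSign (b ⬝ᵥ y) = t := by
  constructor
  · intro h y hy
    have := congrArg (fun φ : Hilb Q => φ y) h
    simp only [pauliZ_apply_eq_sgn, PiLp.smul_apply, smul_eq_mul] at this
    exact sgn_injective (mul_right_cancel₀ hy this)
  · intro h
    ext y
    simp only [pauliZ_apply_eq_sgn, PiLp.smul_apply, smul_eq_mul]
    by_cases hy : ψ y = 0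
    · simp [hy]
    · rw [h y hy]

theorem pauliX_eq_smul_iff {a : Bits Q} {t : ℤˣ} {ψ : Hilb Q} :
    pauliX a ψ = sgn t • ψ ↔ ∀ y, ψ (y + a) = sgn t * ψ y := by
  constructor
  · intro h y
    have := congrArg (fun φ : Hilb Q => φ y) h
    simpa [pauliX_apply] using this
  · intro h
    ext y
    simpa [pauliX_apply] using h y

theorem pauliXZ_mem_stabSpace (a b : Bits Q) {ψ : Hilb Q} (hψ : ψ ∈ stabSpace z s x s') :
    pauliXZ a b ψ ∈ stabSpace z (fun k => bitSign (z k ⬝ᵥ a) * s k) x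
      (fun k => bitSign (b ⬝ᵥ x k) * s' k) := by
  rw [mem_stabSpace] at hψ ⊢
  refine ⟨fun k => ?_, fun k => ?_⟩
  · rw [pauliZ_pauliXZ, hψ.1, map_smul, smul_smul, sgn_mul]
  · rw [pauliX_pauliXZ, hψ.2, map_smul, smul_smul, sgn_mul]

/-- A function on bit strings with vanishing Fourier transform vanishes. -/
theorem exists_sum_sgn_mul_ne_zero {ψ : Hilb Q} (hψ : ψ ≠ 0) :
    ∃ w : Bits Q, ∑ y, sgn (bitSign (w ⬝ᵥ y)) * ψ y ≠ 0 := by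
  by_contra! h
  refine hψ ?_
  ext y₀
  have h1 : ∀ y, y ≠ y₀ → ∑ w : Bits Q, sgn (bitSign (w ⬝ᵥ y)) * sgn (bitSign (w ⬝ᵥ y₀)) = 0 := by
    intro y hy
    obtain ⟨q, hq⟩ := Function.ne_iff.1 hy
    have hq' : y q + y₀ q = 1 := by
      rcases zmod_two_eq_zero_or_one (y q + y₀ q) with h0 | h0
      · exact absurd (eq_of_add_eq_zero_of_zmod_two h0) hq
      · exact h0
    -- Orthogonality of characters: flipping `w` at a coordinate `q` where `y` and `y₀` differ
    -- changes the sign of each summand.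
    have h2 : ∑ w : Bits Q, sgn (bitSign (w ⬝ᵥ y)) * sgn (bitSign (w ⬝ᵥ y₀)) =
        ∑ w : Bits Q, -(sgn (bitSign (w ⬝ᵥ y)) * sgn (bitSign (w ⬝ᵥ y₀))) := by
      refine Fintype.sum_equiv (Equiv.addRight (Pi.single q 1)) _ _ fun w => ?_
      rw [Equiv.coe_addRight, add_dotProduct, add_dotProduct, ← sgn_mul, ← sgn_mul, ← bitSign_add,
        ← bitSign_add, add_add_add_comm, bitSign_add _ (_ + _), single_dotProduct,
        single_dotProduct, one_mul, one_mul, hq', sgn_mul]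
      simp
    rw [Finset.sum_neg_distrib] at h2
    exact self_eq_neg.1 h2
  -- Fourier inversion at `y₀`: only the term `y = y₀` survives, with a nonzero factor.
  have h3 : ∑ w : Bits Q, sgn (bitSign (w ⬝ᵥ y₀)) * ∑ y, sgn (bitSign (w ⬝ᵥ y)) * ψ y = 0 := by
    simp [h]
  simp only [Finset.mul_sum] at h3
  rw [Finset.sum_comm, Finset.sum_eq_single y₀] at h3
  · simp only [← mul_assoc, sgn_mul_self, one_mul, Finset.sum_const, nsmul_eq_mul] at h3
    simpa using h3
  · intro y _ hy
    rw [← zero_mul (ψ y), ← h1 y hy, Finset.sum_mul]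
    exact Finset.sum_congr rfl fun w _ => by ring
  · simp

/-- For a nonzero vector of the eigenspace, `a` is a point of its support and `b` a point where its
Fourier transform is nonzero. The second choice works because translation by `x k` multiplies that
Fourier coefficient by a sign. -/
theorem exists_signs_of_stabSpace_ne_bot (h : stabSpace z s x s' ≠ ⊥) :
    (∃ a, ∀ k, bitSign (z k ⬝ᵥ a) = s k) ∧ ∃ b, ∀ k, bitSign (b ⬝ᵥ x k) = s' k := by
  obtain ⟨ψ, hψ, h0⟩ := Submodule.exists_mem_ne_zero_of_ne_bot h
  rw [mem_stabSpace] at hψ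
  constructor
  · obtain ⟨a, ha⟩ : ∃ a, ψ a ≠ 0 := by
      by_contra! h
      exact h0 (by ext y; simpa using h y)
    exact ⟨a, fun k => pauliZ_eq_smul_iff.1 (hψ.1 k) a ha⟩
  · obtain ⟨b, hb⟩ := exists_sum_sgn_mul_ne_zero h0
    refine ⟨b, fun k => sgn_injective (mul_right_cancel₀ hb ?_)⟩
    have h1 : ∑ y, sgn (bitSign (b ⬝ᵥ y)) * ψ y =
        ∑ y, sgn (bitSign (b ⬝ᵥ (y + x k))) * ψ (y + x k) :=
      (Fintype.sum_equiv (Equiv.addRight (x k)) _ _ fun _ => rfl).symm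
    conv_lhs => rw [h1]
    rw [Finset.mul_sum, Finset.mul_sum]
    refine Finset.sum_congr rfl fun y _ => ?_
    rw [pauliX_eq_smul_iff.1 (hψ.2 k), dotProduct_add, bitSign_add, sgn_mul]
    linear_combination (sgn (bitSign (b ⬝ᵥ y)) * sgn (s' k) * ψ y) *
      sgn_mul_self (bitSign (b ⬝ᵥ x k))

/-- The indicator function of the span of the `x k` is a joint fixed vector: it is invariant under
these translations, and every `z k` vanishes on its support. -/
theorem stabSpace_one_ne_bot (hzx : ∀ k k', z k ⬝ᵥ x k' = 0) : stabSpace z 1 x 1 ≠ ⊥ := by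
  classical
  let S := Submodule.span (ZMod 2) (Set.range x)
  let ψ : Hilb Q := WithLp.toLp 2 fun y => if y ∈ S then 1 else 0
  have hψ : ∀ y, ψ y = if y ∈ S then 1 else 0 := fun y => rfl
  refine Submodule.ne_bot_iff _ |>.2 ⟨ψ, mem_stabSpace.2 ⟨fun k => ?_, fun k => ?_⟩, fun h => ?_⟩
  · refine pauliZ_eq_smul_iff.2 fun y hy => ?_
    have hy : y ∈ S := by
      by_contra h
      exact hy (by rw [hψ, if_neg h])
    rw [dotProduct_eq_zero_of_mem_span_right hy, bitSign_zero, Pi.one_apply]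
    rintro _ ⟨k', rfl⟩
    exact hzx k k'
  · refine pauliX_eq_smul_iff.2 fun y => ?_
    have : x k ∈ S := Submodule.subset_span ⟨k, rfl⟩
    simp [hψ, S.add_mem_iff_left this]
  · have h1 := hψ 0
    rw [h, if_pos S.zero_mem] at h1
    simp at h1

theorem stabSpace_ne_bot (hzx : ∀ k k', z k ⬝ᵥ x k' = 0) {a b : Bits Q}
    (ha : ∀ k, bitSign (z k ⬝ᵥ a) = s k) (hb : ∀ k, bitSign (b ⬝ᵥ x k) = s' k) :
    stabSpace z s x s' ≠ ⊥ := by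
  obtain ⟨ψ, hψ, h0⟩ := Submodule.exists_mem_ne_zero_of_ne_bot (stabSpace_one_ne_bot hzx)
  refine Submodule.ne_bot_iff _ |>.2 ⟨pauliXZ a b ψ, ?_, by simpa using h0⟩
  have := pauliXZ_mem_stabSpace a b hψ
  simpa [ha, hb] using this

/-- The Pauli operator with the commutation signs prescribed by the eigenvalues maps the joint
eigenspace onto the one with eigenvalues `1`. -/
def stabSpaceEquiv {a b : Bits Q}
    (ha : ∀ k, bitSign (z k ⬝ᵥ a) = s k) (hb : ∀ k, bitSign (b ⬝ᵥ x k) = s' k) :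
    stabSpace z s x s' ≃ₗᵢ[ℂ] stabSpace z 1 x 1 :=
  ((pauliXZ a b).symm.submoduleMap (stabSpace z s x s')).trans
    (LinearIsometryEquiv.ofEq _ _ (by
      ext ψ
      constructor
      · rintro ⟨φ, hφ, rfl⟩
        rw [SetLike.mem_coe] at hφ
        rw [mem_stabSpace] at hφ ⊢
        refine ⟨fun k => ?_, fun k => ?_⟩
        · apply (pauliXZ a b).injective
          have h := pauliZ_pauliXZ a b (z k) ((pauliXZ a b).symm φ)
          rw [LinearIsometryEquiv.apply_symm_apply, hφ.1, ha] at h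
          replace h := smul_right_injective (Hilb Q) (sgn_ne_zero _) h
          simpa using h.symm
        · apply (pauliXZ a b).injective
          have h := pauliX_pauliXZ a b (x k) ((pauliXZ a b).symm φ)
          rw [LinearIsometryEquiv.apply_symm_apply, hφ.2, hb] at h
          replace h := smul_right_injective (Hilb Q) (sgn_ne_zero _) h
          simpa using h.symm
      · intro hψ
        refine ⟨pauliXZ a b ψ, ?_, by simp⟩
        have := pauliXZ_mem_stabSpace a b hψ
        simpa [ha, hb] using this))

theorem stabSpaceEquiv_apply {a b : Bits Q}
    (ha : ∀ k, bitSign (z k ⬝ᵥ a) = s k) (hb : ∀ k, bitSign (b ⬝ᵥ x k) = s' k)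
    (ψ : stabSpace z s x s') :
    (stabSpaceEquiv ha hb ψ : Hilb Q) = (pauliXZ a b).symm ψ := rfl

end StabSpace

/-! ### Unitary equivalences -/

section Carries

variable {E E' E'' : Type*} [NormedAddCommGroup E] [InnerProductSpace ℂ E]
  [NormedAddCommGroup E'] [InnerProductSpace ℂ E'] [NormedAddCommGroup E'']
  [InnerProductSpace ℂ E''] {W : Submodule ℂ E} {F : Submodule ℂ E'} {G : Submodule ℂ E''}

theorem Carries.trans {e : W ≃ₗᵢ[ℂ] F} {e' : F ≃ₗᵢ[ℂ] G} {T : E →ₗ[ℂ] E} {T' : E' →ₗ[ℂ] E'}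
    {T'' : E'' →ₗ[ℂ] E''} (h : Carries e T T') (h' : Carries e' T' T'') :
    Carries (e.trans e') T T'' := by
  intro ψ
  obtain ⟨h1, h2⟩ := h ψ
  obtain ⟨h3, h4⟩ := h' (e ψ)
  refine ⟨h1, ?_⟩
  rw [LinearIsometryEquiv.trans_apply, LinearIsometryEquiv.trans_apply, ← h4]
  congr 2
  exact Subtype.ext h2

theorem Carries.smul {e : W ≃ₗᵢ[ℂ] F} {T : E →ₗ[ℂ] E} {T' : E' →ₗ[ℂ] E'}
    (h : Carries e T T') (c : ℂ) : Carries e (c • T) (c • T') := by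
  intro ψ
  obtain ⟨h1, h2⟩ := h ψ
  refine ⟨W.smul_mem c h1, ?_⟩
  exact (congrArg Subtype.val (map_smul e c ⟨T ψ, h1⟩)).trans (congrArg (c • ·) h2)

theorem Carries.comp {e : W ≃ₗᵢ[ℂ] F} {T S : E →ₗ[ℂ] E} {T' S' : E' →ₗ[ℂ] E'}
    (h : Carries e T T') (h' : Carries e S S') : Carries e (T ∘ₗ S) (T' ∘ₗ S') := by
  intro ψ
  obtain ⟨h1, h2⟩ := h' ψ
  obtain ⟨h3, h4⟩ := h ⟨_, h1⟩
  exact ⟨h3, h4.trans (congrArg T' h2)⟩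

theorem Carries.id {e : W ≃ₗᵢ[ℂ] F} : Carries e LinearMap.id LinearMap.id :=
  fun ψ => ⟨ψ.2, rfl⟩

end Carries

/-! ### Pauli operators under the equivalence of joint eigenspaces -/

section StabCarries

variable {Q κ κ' : Type*} [Fintype Q] [DecidableEq Q] {z : κ → Bits Q} {s : κ → ℤˣ}
  {x : κ' → Bits Q} {s' : κ' → ℤˣ} {a b : Bits Q}
  (ha : ∀ k, bitSign (z k ⬝ᵥ a) = s k) (hb : ∀ k, bitSign (b ⬝ᵥ x k) = s' k)

theorem carries_stabSpaceEquiv_pauliX {v : Bits Q} (hv : ∀ k, z k ⬝ᵥ v = 0) :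
    Carries (stabSpaceEquiv ha hb) (pauliX v) (sgn (bitSign (b ⬝ᵥ v)) • pauliX v) := by
  rintro ⟨ψ, hψ⟩
  refine ⟨?_, ?_⟩
  · rw [mem_stabSpace] at hψ ⊢
    refine ⟨fun k => ?_, fun k => ?_⟩
    · rw [pauliZ_pauliX, hv, bitSign_zero, sgn_one, one_smul, hψ.1, map_smul]
    · rw [pauliX_comm, hψ.2, map_smul]
  · rw [stabSpaceEquiv_apply, stabSpaceEquiv_apply, LinearIsometryEquiv.symm_apply_eq,
      LinearMap.smul_apply, map_smul, ← pauliX_pauliXZ, LinearIsometryEquiv.apply_symm_apply]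

theorem carries_stabSpaceEquiv_pauliZ {v : Bits Q} (hv : ∀ k, v ⬝ᵥ x k = 0) :
    Carries (stabSpaceEquiv ha hb) (pauliZ v) (sgn (bitSign (v ⬝ᵥ a)) • pauliZ v) := by
  rintro ⟨ψ, hψ⟩
  refine ⟨?_, ?_⟩
  · rw [mem_stabSpace] at hψ ⊢
    refine ⟨fun k => ?_, fun k => ?_⟩
    · rw [pauliZ_comm, hψ.1, map_smul]
    · rw [pauliX_pauliZ, hv, bitSign_zero, sgn_one, one_smul, hψ.2, map_smul]
  · rw [stabSpaceEquiv_apply, stabSpaceEquiv_apply, LinearIsometryEquiv.symm_apply_eq,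
      LinearMap.smul_apply, map_smul, ← pauliZ_pauliXZ, LinearIsometryEquiv.apply_symm_apply]

end StabCarries

/-! ### Simultaneous diagonalization of involutions -/

section Involutions

variable {E κ : Type*} [NormedAddCommGroup E] [InnerProductSpace ℂ E]

/-- Induction on `S`: a vector is half the sum of its images under `1 + T k` and `1 - T k`, and
commutation preserves the eigenvalues already fixed. -/
theorem mem_iSup_joint_eigenspace (W : Submodule ℂ E) (T : κ → E →ₗ[ℂ] E)
    (hinv : ∀ k ψ, T k (T k ψ) = ψ) (hcomm : ∀ k k' ψ, T k (T k' ψ) = T k' (T k ψ))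
    (hW : ∀ k, ∀ ψ ∈ W, T k ψ ∈ W) (S : Finset κ) {ψ : E} (hψ : ψ ∈ W) :
    ψ ∈ ⨆ s : κ → ℤˣ, W ⊓ ⨅ k ∈ S, Module.End.eigenspace (T k) (sgn (s k)) := by
  classical
  induction S using Finset.induction_on with
  | empty => exact Submodule.mem_iSup_of_mem 1 (by simpa using hψ)
  | insert k S hk ih =>
    refine (iSup_le fun s => ?_ : (⨆ s : κ → ℤˣ, W ⊓ ⨅ k ∈ S, _) ≤ _) ih
    rintro φ ⟨hφ, hφS⟩
    simp only [SetLike.mem_coe, Submodule.mem_iInf, Module.End.mem_eigenspace_iff] at hφ hφS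
    have key : ∀ t : ℤˣ, φ + sgn t • T k φ ∈ ⨆ s : κ → ℤˣ, W ⊓
        ⨅ i ∈ insert k S, Module.End.eigenspace (T i) (sgn (s i)) := by
      intro t
      refine Submodule.mem_iSup_of_mem (Function.update s k t)
        ⟨W.add_mem hφ (W.smul_mem _ (hW k φ hφ)), ?_⟩
      simp only [SetLike.mem_coe, Submodule.mem_iInf, Module.End.mem_eigenspace_iff]
      intro k' hk'
      by_cases h : k' = k
      · subst h
        rw [Function.update_self, map_add, map_smul, hinv, smul_add, smul_smul, sgn_mul_self,
          one_smul, add_comm]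
      · rw [Function.update_of_ne h, map_add, map_smul, hcomm,
          hφS k' (Finset.mem_of_mem_insert_of_ne hk' h), map_smul, smul_add, smul_comm]
    have h2 : φ = (2⁻¹ : ℂ) • ((φ + sgn 1 • T k φ) + (φ + sgn (-1) • T k φ)) := by
      rw [sgn_one, sgn_neg_one]
      module
    rw [h2]
    exact Submodule.smul_mem _ _ (Submodule.add_mem _ (key 1) (key (-1)))

/-- A subspace preserved by commuting unitary involutions is the orthogonal direct sum of their
joint eigenspaces in it. -/
theorem isOrthogonalSum_of_involutions [Finite κ] (W : Submodule ℂ E) (T : κ → E →ₗ[ℂ] E)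
    (hnorm : ∀ k ψ, ‖T k ψ‖ = ‖ψ‖)
    (hinv : ∀ k ψ, T k (T k ψ) = ψ) (hcomm : ∀ k k' ψ, T k (T k' ψ) = T k' (T k ψ))
    (hW : ∀ k, ∀ ψ ∈ W, T k ψ ∈ W) :
    IsOrthogonalSum W fun s : κ → ℤˣ => W ⊓ ⨅ k, Module.End.eigenspace (T k) (sgn (s k)) := by
  classical
  have := Fintype.ofFinite κ
  constructor
  · intro s t hst φ ψ
    obtain ⟨k, hk⟩ := Function.ne_iff.1 hst
    have hφ := φ.2.2
    have hψ := ψ.2.2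
    simp only [SetLike.mem_coe, Submodule.mem_iInf, Module.End.mem_eigenspace_iff] at hφ hψ
    exact inner_eq_zero_of_involution (hnorm k) hk (hφ k) (hψ k)
  · refine le_antisymm (iSup_le fun s => inf_le_left) fun ψ hψ => ?_
    simpa using mem_iSup_joint_eigenspace W T hinv hcomm hW Finset.univ hψ

theorem IsOrthogonalSum.comp_equiv {ι ι' : Type*} {W : Submodule ℂ E} {V : ι → Submodule ℂ E}
    (h : IsOrthogonalSum W V) (e : ι' ≃ ι) : IsOrthogonalSum W (fun a => V (e a)) :=
  ⟨h.1.comp e.injective, by rw [← h.2]; exact e.iSup_comp (g := V)⟩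

end Involutions

/-! ### Ground spaces of commuting projectors -/

section GroundSpace

variable {E κ : Type*} [NormedAddCommGroup E] [InnerProductSpace ℂ E] [Fintype κ]

/-- The ground space of minus the sum of unitary involutions with a common fixed vector. -/
theorem groundSpace_neg_sum (T : κ → E →ₗ[ℂ] E) (hnorm : ∀ k ψ, ‖T k ψ‖ = ‖ψ‖)
    {ψ₀ : E} (h0 : ψ₀ ≠ 0) (hψ₀ : ∀ k, T k ψ₀ = ψ₀) (ψ : E) :
    ψ ∈ groundSpace (-∑ k, T k) ↔ ∀ k, T k ψ = ψ := by
  -- The triangle inequality bounds every eigenvalue in absolute value by the number of terms, and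
  -- `ψ₀` attains minus this bound.
  have hE : groundEnergy (-∑ k, T k) = -(Fintype.card κ : ℝ) := by
    refine IsLeast.csInf_eq ⟨?_, ?_⟩
    · refine Module.End.hasEigenvalue_of_hasEigenvector (x := ψ₀) ⟨?_, h0⟩
      rw [Module.End.mem_eigenspace_iff]
      simp [LinearMap.sum_apply, hψ₀, Nat.cast_smul_eq_nsmul]
    · intro e he
      obtain ⟨φ, hφ, hφ0⟩ := he.exists_hasEigenvector
      rw [Module.End.mem_eigenspace_iff] at hφ
      have h1 : ‖(e : ℂ) • φ‖ ≤ Fintype.card κ * ‖φ‖ := by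
        rw [← hφ, LinearMap.neg_apply, norm_neg, LinearMap.sum_apply]
        refine (norm_sum_le _ _).trans ?_
        simp [hnorm]
      rw [norm_smul, Complex.norm_real, Real.norm_eq_abs] at h1
      have h2 := le_of_mul_le_mul_right h1 (norm_pos_iff.2 hφ0)
      linarith [neg_abs_le e]
  rw [groundSpace, hE, Module.End.mem_eigenspace_iff]
  constructor
  · intro h
    have h1 : ∑ k, T k ψ = (Fintype.card κ : ℂ) • ψ := by
      simpa [LinearMap.sum_apply] using h
    -- Equality case: the squared distances sum to twice the number of terms times `‖ψ‖ ^ 2`, minus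
    -- twice the real part of `⟪ψ, ∑ T k ψ⟫`, which is zero for a ground state.
    have h2 : ∑ k, ‖T k ψ - ψ‖ ^ 2 = 0 := by
      have h3 : ∀ k, ‖T k ψ - ψ‖ ^ 2 = 2 * ‖ψ‖ ^ 2 - 2 * RCLike.re (inner ℂ ψ (T k ψ)) := by
        intro k
        rw [@norm_sub_sq ℂ, hnorm, inner_re_symm]
        ring
      simp only [h3, Finset.sum_sub_distrib, ← Finset.mul_sum]
      rw [← map_sum, ← inner_sum, h1, inner_smul_right, inner_self_eq_norm_sq_to_K]
      have h4 : RCLike.re ((Fintype.card κ : ℂ) * (‖ψ‖ : ℂ) ^ 2) =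
          (Fintype.card κ : ℝ) * ‖ψ‖ ^ 2 := by
        have h5 : ((Fintype.card κ : ℂ) * (‖ψ‖ : ℂ) ^ 2) =
            (((Fintype.card κ : ℝ) * ‖ψ‖ ^ 2 : ℝ) : ℂ) := by push_cast; rfl
        rw [h5]
        exact Complex.ofReal_re _
      erw [h4]
      simp
    intro k
    have h6 := (Finset.sum_eq_zero_iff_of_nonneg fun k _ => sq_nonneg _).1 h2 k (Finset.mem_univ k)
    simpa [sub_eq_zero] using h6
  · intro h
    simp [LinearMap.sum_apply, h, Nat.cast_smul_eq_nsmul]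

end GroundSpace

/-! ### Code spaces -/

section CodeSpace

variable {V Y₀ : Type*} [AddCommGroup V] [Module (ZMod 2) V] [AddCommGroup Y₀]
  [Module (ZMod 2) Y₀]

/-- The functions supported on the coset `x₀ + D` and invariant under translation by `E`. -/
def codeSpace (x₀ : V) (D E : Submodule (ZMod 2) V) : Submodule ℂ (EuclideanSpace ℂ V) where
  carrier := {g | (∀ x, g x ≠ 0 → x + x₀ ∈ D) ∧ ∀ e ∈ E, ∀ x, g (x + e) = g x}
  zero_mem' := by simp
  add_mem' := by
    rintro f g ⟨hf, hf'⟩ ⟨hg, hg'⟩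
    refine ⟨fun x hx => ?_, fun e he x => by simp [hf' e he, hg' e he]⟩
    by_cases h : f x = 0
    · exact hg x (by simpa [h] using hx)
    · exact hf x h
  smul_mem' := by
    rintro c g ⟨hg, hg'⟩
    exact ⟨fun x hx => hg x (right_ne_zero_of_mul hx), fun e he x => by simp [hg' e he]⟩

/-- Every nonempty fibre of `φ` is a coset of its kernel, and `h` vanishes over the empty ones. -/
theorem sum_comp_addMonoidHom {G H : Type*} [AddGroup G] [AddGroup H] [Fintype G] [Fintype H]
    (φ : G →+ H) (h : H → ℝ) (hh : ∀ v, h v ≠ 0 → v ∈ φ.range) :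
    ∑ p, h (φ p) = (Nat.card φ.ker : ℝ) * ∑ v, h v := by
  classical
  rw [Finset.mul_sum, ← Finset.sum_fiberwise_of_maps_to (s := Finset.univ) (t := Finset.univ)
    (g := φ) (fun _ _ => Finset.mem_univ _)]
  refine Finset.sum_congr rfl fun v _ => ?_
  rw [Finset.sum_congr rfl (g := fun _ => h v) (fun p hp => by rw [(Finset.mem_filter.1 hp).2]),
    Finset.sum_const, nsmul_eq_mul]
  by_cases hv : h v = 0
  · simp [hv]
  · congr 2
    rw [AddMonoidHom.card_fiber_eq_of_mem_range φ (hh v hv) (zero_mem φ.range), Nat.subtype_card]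
    simp [AddMonoidHom.mem_ker]

variable [Fintype V] [Fintype Y₀] (T : Y₀ →ₗ[ZMod 2] V) (x₀ : V) (Y : Submodule (ZMod 2) Y₀)
  (D E : Submodule (ZMod 2) V)

/-- Restriction of functions along an affine map, as a unitary equivalence of code spaces. -/
theorem exists_codeSpace_equiv (hD : D = Y.map T ⊔ E) :
    ∃ (e : codeSpace x₀ D E ≃ₗᵢ[ℂ] codeSpace (0 : Y₀) Y (Y ⊓ E.comap T)) (c : ℂ),
      ∀ g y, (e g : EuclideanSpace ℂ Y₀) y =
        c * (Y : Set Y₀).indicator (fun y => (g : EuclideanSpace ℂ V) (x₀ + T y)) y := by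
  classical
  have : Fintype Y := Fintype.ofFinite _
  have : Fintype E := Fintype.ofFinite _
  let φ : Y × E →+ V := (AddMonoidHom.coprod (T.toAddMonoidHom.comp Y.subtype.toAddMonoidHom)
    E.subtype.toAddMonoidHom)
  have hφ : ∀ p, φ p = T p.1 + p.2 := fun p => rfl
  have hφr : ∀ v, v ∈ D → v ∈ φ.range := by
    intro v hv
    rw [hD, Submodule.mem_sup] at hv
    obtain ⟨_, ⟨y, hy, rfl⟩, e, he, rfl⟩ := hv
    exact ⟨(⟨y, hy⟩, ⟨e, he⟩), rfl⟩
  have hcancel : ∀ v : V, x₀ + v + x₀ = v := fun v => by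
    rw [add_right_comm, add_self_eq_zero_of_zmod_two, zero_add]
  have hm : (0 : ℝ) < Nat.card φ.ker := Nat.cast_pos.2 Nat.card_pos
  have hE : (0 : ℝ) < Fintype.card E := Nat.cast_pos.2 Fintype.card_pos
  -- Summing `‖g (x₀ + T y + e)‖ ^ 2` over `Y × E` gives `|E|` times the sum over `Y`, by
  -- invariance, and `|ker φ|` times the sum over all of `V`. Hence this `c` makes the restriction
  -- isometric.
  let c : ℝ := √(Fintype.card E / Nat.card φ.ker)
  have hc : 0 < c := Real.sqrt_pos.2 (div_pos hE hm)
  have hc0 : (c : ℂ) ≠ 0 := Complex.ofReal_ne_zero.2 hc.ne'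
  have hnorm : ∀ g ∈ codeSpace x₀ D E,
      ∑ y, ‖(c : ℂ) * (Y : Set Y₀).indicator (fun y => g (x₀ + T y)) y‖ ^ 2 =
        ∑ x, ‖g x‖ ^ 2 := by
    intro g hg
    have h1 := sum_comp_addMonoidHom φ (fun v => ‖g (x₀ + v)‖ ^ 2) (fun v hv => hφr v (by
      have := hg.1 (x₀ + v) (fun h0 => hv (by simp [h0]))
      rwa [hcancel] at this))
    rw [Fintype.sum_prod_type] at h1
    have h2 : ∀ (y : Y) (e : E), g (x₀ + φ (y, e)) = g (x₀ + T y) := by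
      intro y e
      rw [hφ, ← add_assoc, hg.2 e e.2]
    simp only [h2, Finset.sum_const, nsmul_eq_mul, ← Finset.mul_sum] at h1
    rw [Fintype.sum_equiv (Equiv.addLeft x₀) (fun v => ‖g (x₀ + v)‖ ^ 2) (fun x => ‖g x‖ ^ 2)
      (fun v => rfl)] at h1
    have h3 : ∑ y, ‖(c : ℂ) * (Y : Set Y₀).indicator (fun y => g (x₀ + T y)) y‖ ^ 2 =
        c ^ 2 * ∑ y : Y, ‖g (x₀ + T y)‖ ^ 2 := by
      simp only [norm_mul, mul_pow, ← Finset.mul_sum]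
      congr 1
      · simp
      · rw [← Finset.sum_subtype (p := fun y => y ∈ Y) (Finset.univ.filter (· ∈ Y)) (by simp)
          (fun y => ‖g (x₀ + T y)‖ ^ 2), Finset.sum_filter]
        refine Finset.sum_congr rfl fun y _ => ?_
        by_cases hy : y ∈ Y <;> simp [hy]
    rw [h3, Real.sq_sqrt (div_pos hE hm).le, div_mul_eq_mul_div, div_eq_iff hm.ne',
      mul_comm _ (Nat.card φ.ker : ℝ), ← h1, Finset.card_univ]
  let f₀ : codeSpace x₀ D E →ₗ[ℂ] codeSpace (0 : Y₀) Y (Y ⊓ E.comap T) :=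
    { toFun := fun g => ⟨WithLp.toLp 2 fun y =>
          (c : ℂ) * (Y : Set Y₀).indicator (fun y => (g : EuclideanSpace ℂ V) (x₀ + T y)) y, by
        refine ⟨fun y hy => ?_, fun e he y => ?_⟩
        · rw [add_zero]
          by_contra h
          exact hy (by simp [h])
        · have hey : y + e ∈ Y ↔ y ∈ Y := Y.add_mem_iff_left he.1
          by_cases hy : y ∈ Y
          · simp only [Set.indicator, SetLike.mem_coe, hey, hy, if_true, map_add, ← add_assoc]
            rw [g.2.2 (T e) he.2]
          · simp [Set.indicator, hey, hy]⟩
      map_add' := fun f g => by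
        ext y
        by_cases hy : y ∈ Y <;> simp [hy, mul_add]
      map_smul' := fun t g => by
        ext y
        by_cases hy : y ∈ Y <;> simp [hy, mul_left_comm] }
  have hf₀ : ∀ g y, (f₀ g : EuclideanSpace ℂ Y₀) y =
      (c : ℂ) * (Y : Set Y₀).indicator (fun y => (g : EuclideanSpace ℂ V) (x₀ + T y)) y :=
    fun g y => rfl
  let f : codeSpace x₀ D E →ₗᵢ[ℂ] codeSpace (0 : Y₀) Y (Y ⊓ E.comap T) :=
    ⟨f₀, fun g => by
      rw [Submodule.coe_norm, Submodule.coe_norm, EuclideanSpace.norm_eq, EuclideanSpace.norm_eq]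
      simp only [hf₀]
      rw [hnorm g g.2]⟩
  have hf : ∀ g y, (f g : EuclideanSpace ℂ Y₀) y =
      (c : ℂ) * (Y : Set Y₀).indicator (fun y => (g : EuclideanSpace ℂ V) (x₀ + T y)) y :=
    fun g y => rfl
  have hsurj : Function.Surjective f := by
    rintro ⟨k, hk⟩
    let r : V → Prop := fun x => ∃ y ∈ Y, ∃ e ∈ E, x = x₀ + T y + e
    -- The preimage of `k` takes the value `c⁻¹ k(y)` at `x₀ + T y + e`. Two such expressions for
    -- one point differ by an element of `Y ⊓ E.comap T` in `y`, under which `k` is invariant.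
    let G : V → ℂ := fun x => if h : r x then (c : ℂ)⁻¹ * k h.choose else 0
    have hG : ∀ y ∈ Y, ∀ e ∈ E, G (x₀ + T y + e) = (c : ℂ)⁻¹ * k y := by
      intro y hy e he
      have hr : r (x₀ + T y + e) := ⟨y, hy, e, he, rfl⟩
      obtain ⟨hy', e', he', heq⟩ := hr.choose_spec
      simp only [G, dif_pos hr]
      congr 1
      generalize hr.choose = y' at hy' heq ⊢
      rw [add_assoc, add_assoc, add_right_inj] at heq
      have h1 : T (y + y') = e + e' := by
        rw [map_add]
        calc T y + T y' = (T y + e) + (e + T y') := by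
              rw [add_add_add_comm, add_comm e, ← add_add_add_comm, add_self_eq_zero_of_zmod_two,
                add_zero]
          _ = (T y' + e') + (e + T y') := by rw [heq]
          _ = e + e' := by
              rw [add_comm e, add_add_add_comm, add_self_eq_zero_of_zmod_two, zero_add, add_comm]
      have h2 := hk.2 (y + y') ⟨Y.add_mem hy hy', by
        rw [SetLike.mem_coe, Submodule.mem_comap, h1]; exact E.add_mem he he'⟩ y
      rwa [← add_assoc, add_self_eq_zero_of_zmod_two, zero_add] at h2
    have hG0 : ∀ x, ¬ r x → G x = 0 := fun x hx => dif_neg hx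
    have hrE : ∀ x, ∀ e ∈ E, r x → r (x + e) := by
      rintro _ e he ⟨y, hy, e', he', rfl⟩
      exact ⟨y, hy, e' + e, E.add_mem he' he, add_assoc _ _ _⟩
    refine ⟨⟨WithLp.toLp 2 G, fun x hx => ?_, fun e he x => ?_⟩, ?_⟩
    · have hr : r x := by
        by_contra h
        exact hx (hG0 x h)
      obtain ⟨y, hy, e, he, rfl⟩ := hr
      rw [add_assoc x₀, hcancel, hD]
      exact Submodule.add_mem_sup ⟨y, hy, rfl⟩ he
    · change G (x + e) = G x
      by_cases hr : r x
      · obtain ⟨y, hy, e', he', rfl⟩ := hr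
        rw [hG y hy e' he', add_assoc, hG y hy _ (E.add_mem he' he)]
      · rw [hG0 x hr, hG0]
        intro h
        have := hrE _ e he h
        rw [add_add_cancel_of_zmod_two] at this
        exact hr this
    · ext y
      rw [hf]
      by_cases hy : y ∈ Y
      · rw [Set.indicator_of_mem (by exact hy)]
        change (c : ℂ) * G (x₀ + T y) = k y
        rw [← add_zero (x₀ + T y), hG y hy 0 E.zero_mem, mul_inv_cancel_left₀ hc0]
      · rw [Set.indicator_of_notMem (by exact hy), mul_zero]
        by_contra h
        exact hy (by simpa using hk.1 y (Ne.symm h))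
  exact ⟨LinearIsometryEquiv.ofSurjective f hsurj, c, hf⟩

end CodeSpace

section Invariants

variable {V : Type*} [AddCommGroup V] [Module (ZMod 2) V]

/-- The translations that leave a function invariant. -/
def translationInvariants (g : V → ℂ) : Submodule (ZMod 2) V where
  carrier := {e | ∀ x, g (x + e) = g x}
  zero_mem' := by simp
  add_mem' := by
    intro e f he hf x
    rw [← add_assoc, hf, he]
  smul_mem' := by
    intro t e he x
    rcases zmod_two_eq_zero_or_one t with rfl | rfl
    · simp
    · simpa using he x

theorem mem_translationInvariants {g : V → ℂ} {e : V} :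
    e ∈ translationInvariants g ↔ ∀ x, g (x + e) = g x := Iff.rfl

theorem mem_codeSpace_iff_le {x₀ : V} {D E : Submodule (ZMod 2) V} {g : EuclideanSpace ℂ V} :
    g ∈ codeSpace x₀ D E ↔ (∀ x, g x ≠ 0 → x + x₀ ∈ D) ∧ E ≤ translationInvariants g := Iff.rfl

end Invariants

/-- The passage from operators to subspaces: the translations fixing a function form a subspace, so
invariance under the generators is invariance under their span. -/
theorem stabSpace_one_eq_codeSpace {Q κ κ' : Type*} [Fintype Q] [DecidableEq Q]
    (z : κ → Bits Q) (x : κ' → Bits Q) :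
    stabSpace z 1 x 1 =
      codeSpace 0 (symmetries z) (Submodule.span (ZMod 2) (Set.range x)) := by
  ext ψ
  rw [mem_stabSpace, mem_codeSpace_iff_le, Submodule.span_le]
  refine and_congr ?_ ?_
  · simp only [Pi.one_apply, pauliZ_eq_smul_iff]
    refine ⟨fun h y hy k => ?_, fun h k y hy => ?_⟩
    · rw [add_zero, dotProduct_comm]
      exact bitSign_injective (h k y hy)
    · rw [dotProduct_comm, ← add_zero y, h y hy k, bitSign_zero]
  · have h1 : ∀ k, pauliX (x k) ψ = sgn ((1 : κ' → ℤˣ) k) • ψ ↔ x k ∈ translationInvariants ψ := by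
      intro k
      rw [pauliX_eq_smul_iff, mem_translationInvariants]
      simp
    simp only [h1]
    exact ⟨fun h => Set.range_subset_iff.2 h, Set.range_subset_iff.1⟩

/-! ### Two copies -/

section Tensor

variable {Q : Type*} [Fintype Q] [DecidableEq Q]

/-- The tensor square of the Hilbert space in the computational basis. -/
def tensorFun (Q : Type*) [Fintype Q] [DecidableEq Q] :
    Hilb Q ⊗[ℂ] Hilb Q ≃ₗᵢ[ℂ] EuclideanSpace ℂ (Bits Q × Bits Q) :=
  ((EuclideanSpace.basisFun (Bits Q) ℂ).tensorProduct (EuclideanSpace.basisFun (Bits Q) ℂ)).repr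

theorem tensorFun_tmul (φ ψ : Hilb Q) (y : Bits Q × Bits Q) :
    tensorFun Q (φ ⊗ₜ ψ) y = φ y.1 * ψ y.2 := by
  rw [tensorFun, OrthonormalBasis.tensorProduct_repr_tmul_apply']
  simp [mul_comm]

theorem tensorFun_map_pauliX (a b : Bits Q) (ψ : Hilb Q ⊗[ℂ] Hilb Q) (y : Bits Q × Bits Q) :
    tensorFun Q (TensorProduct.map (pauliX a) (pauliX b) ψ) y = tensorFun Q ψ (y + (a, b)) := by
  induction ψ using TensorProduct.induction_on with
  | zero => simp
  | tmul u v => rw [TensorProduct.map_tmul, tensorFun_tmul, tensorFun_tmul]; rfl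
  | add u v hu hv => simp only [map_add, PiLp.add_apply, hu, hv]

theorem tensorFun_map_pauliZ (a b : Bits Q) (ψ : Hilb Q ⊗[ℂ] Hilb Q) (y : Bits Q × Bits Q) :
    tensorFun Q (TensorProduct.map (pauliZ a) (pauliZ b) ψ) y =
      sgn (bitSign (a ⬝ᵥ y.1 + b ⬝ᵥ y.2)) * tensorFun Q ψ y := by
  induction ψ using TensorProduct.induction_on with
  | zero => simp
  | tmul u v =>
    rw [TensorProduct.map_tmul, tensorFun_tmul, tensorFun_tmul, pauliZ_apply_eq_sgn,
      pauliZ_apply_eq_sgn, bitSign_add, sgn_mul]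
    ring
  | add u v hu hv => simp only [map_add, PiLp.add_apply, hu, hv, mul_add]

open Classical in
/-- Restriction to `Y` after summation over the translations in `S`. -/
def codeProjection (Y S : Submodule (ZMod 2) (Bits Q)) : Hilb Q →ₗ[ℂ] Hilb Q where
  toFun ψ := WithLp.toLp 2 fun x => if x ∈ Y then ∑ a : S, ψ (x + a) else 0
  map_add' φ ψ := by
    ext x
    by_cases hx : x ∈ Y <;> simp [hx, Finset.sum_add_distrib]
  map_smul' c ψ := by
    ext x
    by_cases hx : x ∈ Y <;> simp [hx, Finset.mul_sum]

open Classical in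
theorem codeProjection_apply (Y S : Submodule (ZMod 2) (Bits Q)) (ψ : Hilb Q) (x : Bits Q) :
    codeProjection Y S ψ x = if x ∈ Y then ∑ a : S, ψ (x + a) else 0 := rfl

theorem codeProjection_mem {Y S : Submodule (ZMod 2) (Bits Q)} (hSY : S ≤ Y) (ψ : Hilb Q) :
    codeProjection Y S ψ ∈ codeSpace 0 Y S := by
  classical
  refine ⟨fun x hx => ?_, fun e he x => ?_⟩
  · by_contra h
    rw [add_zero] at h
    exact hx (by rw [codeProjection_apply, if_neg h])
  · rw [codeProjection_apply, codeProjection_apply, Y.add_mem_iff_left (hSY he)]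
    congr 1
    exact Fintype.sum_equiv (Equiv.addLeft (⟨e, he⟩ : S)) _ _ fun a => by simp [add_assoc]

open Classical in
theorem tensorFun_map_codeProjection (Y S : Submodule (ZMod 2) (Bits Q))
    (ψ : Hilb Q ⊗[ℂ] Hilb Q) (y : Bits Q × Bits Q) :
    tensorFun Q (TensorProduct.map (codeProjection Y S) (codeProjection Y S) ψ) y =
      if y ∈ Y.prod Y then
        ∑ a : S, ∑ b : S, tensorFun Q ψ (y + ((a : Bits Q), (b : Bits Q)))
      else 0 := by
  induction ψ using TensorProduct.induction_on with
  | zero => simp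
  | tmul u v =>
    simp only [TensorProduct.map_tmul, tensorFun_tmul, codeProjection_apply, Submodule.mem_prod,
      Prod.fst_add, Prod.snd_add]
    by_cases h1 : y.1 ∈ Y <;> by_cases h2 : y.2 ∈ Y <;> simp [h1, h2, Finset.sum_mul_sum]
  | add u v hu hv =>
    simp only [map_add, PiLp.add_apply, hu, hv, Finset.sum_add_distrib]
    split_ifs <;> simp

/-- For the converse, the tensor square of `codeProjection` has values in the range of the
inclusion, while on a function satisfying the code conditions it acts as the nonzero scalar `|S| ^
2`. -/
theorem mem_range_mapIncl_codeSpace {Y S : Submodule (ZMod 2) (Bits Q)} (hSY : S ≤ Y)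
    (ψ : Hilb Q ⊗[ℂ] Hilb Q) :
    ψ ∈ LinearMap.range (TensorProduct.mapIncl (codeSpace (0 : Bits Q) Y S) (codeSpace 0 Y S)) ↔
      tensorFun Q ψ ∈ codeSpace 0 (Y.prod Y) (S.prod S) := by
  classical
  constructor
  · rintro ⟨t, rfl⟩
    induction t using TensorProduct.induction_on with
    | zero => simp
    | tmul u v =>
      rw [TensorProduct.mapIncl, TensorProduct.map_tmul]
      refine ⟨fun y hy => ?_, fun e he y => ?_⟩
      · rw [tensorFun_tmul] at hy
        exact ⟨by simpa using u.2.1 _ (left_ne_zero_of_mul hy),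
          by simpa using v.2.1 _ (right_ne_zero_of_mul hy)⟩
      · rw [tensorFun_tmul, tensorFun_tmul]
        exact congrArg₂ _ (u.2.2 _ he.1 _) (v.2.2 _ he.2 _)
    | add u v hu hv =>
      rw [map_add, map_add]
      exact Submodule.add_mem _ hu hv
  · intro h
    have hp : ∀ φ, codeProjection Y S φ ∈ codeSpace 0 Y S := codeProjection_mem hSY
    have h1 : TensorProduct.map (codeProjection Y S) (codeProjection Y S) ψ ∈
        LinearMap.range (TensorProduct.mapIncl (codeSpace (0 : Bits Q) Y S) (codeSpace 0 Y S)) := by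
      refine ⟨TensorProduct.map ((codeProjection Y S).codRestrict _ hp)
        ((codeProjection Y S).codRestrict _ hp) ψ, ?_⟩
      rw [TensorProduct.mapIncl, ← LinearMap.comp_apply, ← TensorProduct.map_comp]
      rfl
    have h2 : TensorProduct.map (codeProjection Y S) (codeProjection Y S) ψ =
        ((Fintype.card S : ℂ) * Fintype.card S) • ψ := by
      apply (tensorFun Q).injective
      ext y
      rw [tensorFun_map_codeProjection, map_smul, PiLp.smul_apply, smul_eq_mul]
      by_cases hy : y ∈ Y.prod Y
      · rw [if_pos hy]
        have : ∀ a b : S, tensorFun Q ψ (y + ((a : Bits Q), (b : Bits Q))) = tensorFun Q ψ y :=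
          fun a b => h.2 _ ⟨a.2, b.2⟩ y
        simp [this, mul_assoc]
      · rw [if_neg hy]
        by_contra h0
        exact hy (by simpa using h.1 y (right_ne_zero_of_mul (Ne.symm h0)))
    rw [h2] at h1
    have hc : (Fintype.card S : ℂ) ≠ 0 := Nat.cast_ne_zero.2 Fintype.card_ne_zero
    exact (Submodule.smul_mem_iff _ (mul_ne_zero hc hc)).1 h1

/-- A code space of a layered system as a code space of two copies. -/
theorem exists_codeSpace_equiv_tensor {N : Type*} [Fintype N] [DecidableEq N]
    (F : Submodule ℂ (Hilb Q ⊗[ℂ] Hilb Q)) (Y S : Submodule (ZMod 2) (Bits Q × Bits Q))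
    (hF : ∀ ψ, ψ ∈ F ↔ tensorFun Q ψ ∈ codeSpace 0 Y S)
    (T : Bits Q × Bits Q →ₗ[ZMod 2] Bits N) (x₀ : Bits N) (D E : Submodule (ZMod 2) (Bits N))
    (hD : D = Y.map T ⊔ E) (hS : Y ⊓ E.comap T = S) :
    ∃ e : codeSpace x₀ D E ≃ₗᵢ[ℂ] F,
      (∀ y ∈ Y, Carries e (pauliX (T y)) (TensorProduct.map (pauliX y.1) (pauliX y.2))) ∧
      ∀ (v : Bits N) (b b' : Bits Q), (∀ x ∈ E, v ⬝ᵥ x = 0) →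
        (∀ y ∈ Y, v ⬝ᵥ T y = b ⬝ᵥ y.1 + b' ⬝ᵥ y.2) →
        Carries e (pauliZ v)
          (sgn (bitSign (v ⬝ᵥ x₀)) • TensorProduct.map (pauliZ b) (pauliZ b')) := by
  classical
  subst hS
  obtain ⟨e, c, he⟩ := exists_codeSpace_equiv T x₀ Y D E hD
  let τ : F ≃ₗᵢ[ℂ] codeSpace (0 : Bits Q × Bits Q) Y (Y ⊓ E.comap T) :=
    ((tensorFun Q).submoduleMap F).trans (LinearIsometryEquiv.ofEq _ _ (by
      ext g
      constructor
      · rintro ⟨ψ, hψ, rfl⟩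
        exact (hF ψ).1 hψ
      · intro hg
        exact ⟨(tensorFun Q).symm g, (hF _).2 (by simpa using hg), by simp⟩))
  have hτ : ∀ ψ : F, (τ ψ : EuclideanSpace ℂ (Bits Q × Bits Q)) = tensorFun Q ψ := fun ψ => rfl
  have hτe : ∀ g, tensorFun Q (e.trans τ.symm g : F) = e g := by
    intro g
    exact (hτ _).symm.trans (congrArg Subtype.val (τ.apply_symm_apply (e g)))
  refine ⟨e.trans τ.symm, fun y hy g => ?_, fun v b b' hv hv' g => ?_⟩
  · have hTy : T y ∈ D := hD ▸ Submodule.mem_sup_left ⟨y, hy, rfl⟩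
    have hmem : pauliX (T y) (g : Hilb N) ∈ codeSpace x₀ D E := by
      refine ⟨fun x hx => ?_, fun e he x => ?_⟩
      · rw [pauliX_apply] at hx
        have h := D.add_mem (g.2.1 _ hx) hTy
        rwa [add_right_comm x, add_add_cancel_of_zmod_two] at h
      · rw [pauliX_apply, pauliX_apply, add_right_comm, g.2.2 e he]
    refine ⟨hmem, (tensorFun Q).injective ?_⟩
    ext w
    rw [hτe, tensorFun_map_pauliX, hτe, he, he]
    congr 1
    have hwy : w + (y.1, y.2) ∈ Y ↔ w ∈ Y := Y.add_mem_iff_left hy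
    by_cases hw : w ∈ Y
    · rw [Set.indicator_of_mem (by exact hw), Set.indicator_of_mem (by exact hwy.2 hw),
        pauliX_apply, map_add, add_assoc]
    · rw [Set.indicator_of_notMem (by exact hw),
        Set.indicator_of_notMem (by rwa [SetLike.mem_coe, hwy])]
  · have hmem : pauliZ v (g : Hilb N) ∈ codeSpace x₀ D E := by
      refine ⟨fun x hx => ?_, fun e he x => ?_⟩
      · rw [pauliZ_apply] at hx
        exact g.2.1 _ (right_ne_zero_of_mul hx)
      · rw [pauliZ_apply, pauliZ_apply, dotProduct_add, hv e he, add_zero, g.2.2 e he]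
    refine ⟨hmem, (tensorFun Q).injective ?_⟩
    ext w
    rw [hτe, LinearMap.smul_apply, map_smul, PiLp.smul_apply, tensorFun_map_pauliZ, hτe, he, he,
      smul_eq_mul]
    -- On the basis state `x₀ + T w` the sign splits into the constant part from `x₀` and the action
    -- of `b` and `b'` on the two components of `w`.
    by_cases hw : w ∈ Y
    · rw [Set.indicator_of_mem (by exact hw), Set.indicator_of_mem (by exact hw),
        pauliZ_apply_eq_sgn, dotProduct_add, hv' w hw, bitSign_add, sgn_mul]
      ring
    · rw [Set.indicator_of_notMem (by exact hw), Set.indicator_of_notMem (by exact hw)]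
      simp

end Tensor

/-! ### Layers -/

section Layers

variable {Q Q' : Type*} {K : ℕ}

/-- The restriction to an odd layer. -/
def oddPart (j : Fin (K + 2)) : Bits (Stack Q Q' K) →ₗ[ZMod 2] Bits Q where
  toFun x q := x (Sum.inl (j, q))
  map_add' _ _ := rfl
  map_smul' _ _ := rfl

/-- The restriction to an even layer. -/
def evenPart (j : Fin (K + 1)) : Bits (Stack Q Q' K) →ₗ[ZMod 2] Bits Q' where
  toFun x q := x (Sum.inr (j, q))
  map_add' _ _ := rfl
  map_smul' _ _ := rfl

/-- `onOdd` as a linear map. -/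
def onOddₗ (j : Fin (K + 2)) : Bits Q →ₗ[ZMod 2] Bits (Stack Q Q' K) where
  toFun := onOdd j
  map_add' a b := by
    ext (p | p)
    · simp only [onOdd, Sum.elim_inl, Pi.add_apply]; split_ifs <;> simp
    · simp [onOdd]
  map_smul' t a := by
    ext (p | p)
    · simp [onOdd]
    · simp [onOdd]

/-- `onEven` as a linear map. -/
def onEvenₗ (j : Fin (K + 1)) : Bits Q' →ₗ[ZMod 2] Bits (Stack Q Q' K) where
  toFun := onEven j
  map_add' a b := by
    ext (p | p)
    · simp [onEven]
    · simp only [onEven, Sum.elim_inr, Pi.add_apply]; split_ifs <;> simp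
  map_smul' t a := by
    ext (p | p)
    · simp [onEven]
    · simp [onEven]

theorem onOddₗ_apply (j : Fin (K + 2)) (a : Bits Q) :
    (onOddₗ j a : Bits (Stack Q Q' K)) = onOdd j a := rfl

theorem onEvenₗ_apply (j : Fin (K + 1)) (a : Bits Q') :
    (onEvenₗ j a : Bits (Stack Q Q' K)) = onEven j a := rfl

@[simp] theorem oddPart_onOdd (i j : Fin (K + 2)) (a : Bits Q) :
    oddPart i (onOdd j a : Bits (Stack Q Q' K)) = if i = j then a else 0 := by
  ext q
  simp only [oddPart, onOdd, LinearMap.coe_mk, AddHom.coe_mk, Sum.elim_inl]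
  split_ifs <;> simp

@[simp] theorem evenPart_onOdd (i : Fin (K + 1)) (j : Fin (K + 2)) (a : Bits Q) :
    evenPart i (onOdd j a : Bits (Stack Q Q' K)) = 0 := rfl

@[simp] theorem oddPart_onEven (i : Fin (K + 2)) (j : Fin (K + 1)) (a : Bits Q') :
    oddPart i (onEven j a : Bits (Stack Q Q' K)) = 0 := rfl

@[simp] theorem evenPart_onEven (i j : Fin (K + 1)) (a : Bits Q') :
    evenPart i (onEven j a : Bits (Stack Q Q' K)) = if i = j then a else 0 := by
  ext q
  simp only [evenPart, onEven, LinearMap.coe_mk, AddHom.coe_mk, Sum.elim_inr]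
  split_ifs <;> simp

theorem stack_ext {x y : Bits (Stack Q Q' K)} (h1 : ∀ j, oddPart j x = oddPart j y)
    (h2 : ∀ j, evenPart j x = evenPart j y) : x = y := by
  ext (⟨j, q⟩ | ⟨j, q⟩)
  · exact congrFun (h1 j) q
  · exact congrFun (h2 j) q

theorem stack_eq_sum (x : Bits (Stack Q Q' K)) :
    x = ∑ j, onOddₗ j (oddPart j x) + ∑ j, onEvenₗ j (evenPart j x) := by
  refine stack_ext (fun j => ?_) fun j => ?_
  · simp [map_sum, onOddₗ_apply, onEvenₗ_apply]
  · simp [map_sum, onOddₗ_apply, onEvenₗ_apply]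

theorem odd_layer_cases (i : Fin (K + 2)) :
    i = 0 ∨ i = Fin.last (K + 1) ∨ ∃ j : Fin K, i = j.succ.castSucc := by
  induction i using Fin.cases with
  | zero => exact Or.inl rfl
  | succ i =>
    induction i using Fin.lastCases with
    | last => exact Or.inr (Or.inl (Fin.succ_last _))
    | cast j => exact Or.inr (Or.inr ⟨j, Fin.succ_castSucc j⟩)

/-- The Pauli products whose restrictions to the layers belong to given groups. -/
def layerGroup (S : Submodule (ZMod 2) (Bits Q)) (S' : Submodule (ZMod 2) (Bits Q')) (K : ℕ) :
    Submodule (ZMod 2) (Bits (Stack Q Q' K)) :=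
  (⨅ j, S.comap (oddPart j)) ⊓ ⨅ j, S'.comap (evenPart j)

theorem mem_layerGroup {S : Submodule (ZMod 2) (Bits Q)} {S' : Submodule (ZMod 2) (Bits Q')}
    {x : Bits (Stack Q Q' K)} :
    x ∈ layerGroup S S' K ↔ (∀ j, oddPart j x ∈ S) ∧ ∀ j, evenPart j x ∈ S' := by
  simp [layerGroup, Submodule.mem_iInf]

theorem layerGroup_le {S : Submodule (ZMod 2) (Bits Q)} {S' : Submodule (ZMod 2) (Bits Q')}
    {G : Submodule (ZMod 2) (Bits (Stack Q Q' K))} (h1 : ∀ j, S ≤ G.comap (onOddₗ j))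
    (h2 : ∀ j, S' ≤ G.comap (onEvenₗ j)) : layerGroup S S' K ≤ G := by
  intro x hx
  rw [mem_layerGroup] at hx
  rw [stack_eq_sum x]
  exact Submodule.add_mem _ (Submodule.sum_mem _ fun j _ => h1 j (hx.1 j))
    (Submodule.sum_mem _ fun j _ => h2 j (hx.2 j))

/-- The placement of two Pauli products on the first and on the last layer. -/
def onEnds (Q Q' : Type*) (K : ℕ) : Bits Q × Bits Q →ₗ[ZMod 2] Bits (Stack Q Q' K) :=
  LinearMap.coprod (onOddₗ 0) (onOddₗ (Fin.last (K + 1)))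

theorem onEnds_apply (y : Bits Q × Bits Q) :
    onEnds Q Q' K y = onOdd 0 y.1 + onOdd (Fin.last (K + 1)) y.2 := rfl

theorem onEnds_left (a : Bits Q) : onEnds Q Q' K (a, 0) = onOdd 0 a := by
  simp [onEnds_apply, ← onOddₗ_apply]

theorem onEnds_right (a : Bits Q) : onEnds Q Q' K (0, a) = onOdd (Fin.last (K + 1)) a := by
  simp [onEnds_apply, ← onOddₗ_apply]

@[simp] theorem oddPart_zero_onEnds (y : Bits Q × Bits Q) :
    oddPart 0 (onEnds Q Q' K y) = y.1 := by
  simp [onEnds_apply]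

@[simp] theorem oddPart_last_onEnds (y : Bits Q × Bits Q) :
    oddPart (Fin.last (K + 1)) (onEnds Q Q' K y) = y.2 := by
  simp [onEnds_apply]

theorem oddPart_internal_onEnds (j : Fin K) (y : Bits Q × Bits Q) :
    oddPart j.succ.castSucc (onEnds Q Q' K y) = 0 := by
  have h1 : j.succ.castSucc ≠ 0 := by simp [Fin.ext_iff]
  have h2 : j.succ.castSucc ≠ Fin.last (K + 1) := (Fin.castSucc_lt_last _).ne
  simp only [onEnds_apply, map_add, oddPart_onOdd, if_neg h1, if_neg h2, add_zero]

@[simp] theorem evenPart_onEnds (j : Fin (K + 1)) (y : Bits Q × Bits Q) :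
    evenPart j (onEnds Q Q' K y) = 0 := by
  simp [onEnds_apply]

variable [Fintype Q] [Fintype Q']

@[simp] theorem onOdd_dotProduct (j : Fin (K + 2)) (b : Bits Q) (x : Bits (Stack Q Q' K)) :
    onOdd j b ⬝ᵥ x = b ⬝ᵥ oddPart j x := by
  simp [dotProduct, onOdd, oddPart, Fintype.sum_sum_type, Fintype.sum_prod_type]

@[simp] theorem onEven_dotProduct (j : Fin (K + 1)) (b : Bits Q') (x : Bits (Stack Q Q' K)) :
    onEven j b ⬝ᵥ x = b ⬝ᵥ evenPart j x := by
  simp [dotProduct, onEven, evenPart, Fintype.sum_sum_type, Fintype.sum_prod_type]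

@[simp] theorem dotProduct_onOdd (j : Fin (K + 2)) (b : Bits Q) (x : Bits (Stack Q Q' K)) :
    x ⬝ᵥ onOdd j b = oddPart j x ⬝ᵥ b := by
  rw [dotProduct_comm, onOdd_dotProduct, dotProduct_comm]

@[simp] theorem dotProduct_onEven (j : Fin (K + 1)) (b : Bits Q') (x : Bits (Stack Q Q' K)) :
    x ⬝ᵥ onEven j b = evenPart j x ⬝ᵥ b := by
  rw [dotProduct_comm, onEven_dotProduct, dotProduct_comm]

end Layers

theorem mem_symmetries {Q ι : Type*} [Fintype Q] {T : ι → Bits Q} {b : Bits Q} :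
    b ∈ symmetries T ↔ ∀ i, b ⬝ᵥ T i = 0 := Iff.rfl

namespace DualPair

variable {Q Q' A I ιr ιs ιρ ισ : Type*} [Fintype Q] [Fintype Q']
variable (P : DualPair Q Q' A I ιr ιs ιρ ισ)

/-- The compatible symmetry group as the span of local and nonlocal generators. -/
theorem span_sup_span_of_isNonlocalGenerators {N ι : Type*} [Fintype N] {n : ℕ}
    {S : Submodule (ZMod 2) (Bits N)} {G : ι → Bits N} {U : Fin n → Bits N}
    (h : IsNonlocalGenerators S G U) (hG : ∀ k, G k ∈ S) :
    Submodule.span (ZMod 2) (Set.range G) ⊔ Submodule.span (ZMod 2) (Set.range U) = S :=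
  le_antisymm (sup_le (Submodule.span_le.2 (Set.range_subset_iff.2 hG))
    (Submodule.span_le.2 (Set.range_subset_iff.2 h.mem))) h.maximal

theorem symX_le_symmetries_GZ : P.symX ≤ symmetries P.GZ :=
  fun _ ha r => ha.2 ⟨_, P.GZ_mem r⟩

theorem span_GX_le_symX : Submodule.span (ZMod 2) (Set.range P.GX) ≤ P.symX :=
  Submodule.span_le.2 (Set.range_subset_iff.2 P.GX_mem)

theorem span_ΓX_le_dualSymX : Submodule.span (ZMod 2) (Set.range P.ΓX) ≤ P.dualSymX :=
  Submodule.span_le.2 (Set.range_subset_iff.2 P.ΓX_mem)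

theorem span_GZ_le_symZ : Submodule.span (ZMod 2) (Set.range P.GZ) ≤ P.symZ :=
  Submodule.span_le.2 (Set.range_subset_iff.2 P.GZ_mem)

/-- The pairs of `X`-type symmetries of the model that are equal up to local symmetries. -/
def ficGroup : Submodule (ZMod 2) (Bits Q × Bits Q) :=
  P.symX.comap (LinearMap.fst _ _ _) ⊓ P.symX.comap (LinearMap.snd _ _ _) ⊓
    (Submodule.span (ZMod 2) (Set.range P.GX)).comap
      (LinearMap.fst (ZMod 2) (Bits Q) (Bits Q) + LinearMap.snd (ZMod 2) (Bits Q) (Bits Q))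

theorem mem_ficGroup {y : Bits Q × Bits Q} : y ∈ P.ficGroup ↔
    (y.1 ∈ P.symX ∧ y.2 ∈ P.symX) ∧
      y.1 + y.2 ∈ Submodule.span (ZMod 2) (Set.range P.GX) := Iff.rfl

/-- The pairs of `X`-type operators that commute with the local symmetries `GZ`. -/
def gaugePairs : Submodule (ZMod 2) (Bits Q × Bits Q) :=
  (symmetries P.GZ).prod (symmetries P.GZ)

section DualTerms

variable [Fintype A]

/-- Products of the Ising terms. -/
def prodOZ : (A → ZMod 2) →ₗ[ZMod 2] Bits Q := Fintype.linearCombination (ZMod 2) P.OZ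

/-- Products of the duals of the Ising terms. -/
def prodDZ : (A → ZMod 2) →ₗ[ZMod 2] Bits Q' := Fintype.linearCombination (ZMod 2) P.DZ

theorem prodOZ_apply (u : A → ZMod 2) : P.prodOZ u = ∑ i, u i • P.OZ i := rfl

theorem prodDZ_apply (u : A → ZMod 2) : P.prodDZ u = ∑ i, u i • P.DZ i := rfl

theorem dotProduct_prodDZ (i : I) (u : A → ZMod 2) :
    P.prodDZ u ⬝ᵥ P.DX i = P.prodOZ u ⬝ᵥ P.OX i := by
  simp [prodDZ_apply, prodOZ_apply, sum_dotProduct, smul_dotProduct, P.dual]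

theorem prodDZ_dotProduct_of_mem_dualSymX {a : Bits Q'} (ha : a ∈ P.dualSymX) (u : A → ZMod 2) :
    P.prodDZ u ⬝ᵥ a = 0 := by
  rw [dotProduct_comm, prodDZ_apply, dotProduct_sum]
  refine Finset.sum_eq_zero fun i _ => ?_
  rw [dotProduct_smul, ha i, smul_zero]

/-- Duality preserves the commutation signs with the transverse-field terms. A product of `DZ` terms
commutes with all of `dualSymX` automatically, so compatibility is no extra condition. -/
theorem prodDZ_mem_dualSymZ_iff (u : A → ZMod 2) :
    P.prodDZ u ∈ P.dualSymZ ↔ P.prodOZ u ∈ P.symZ := by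
  constructor
  · exact fun h i => (P.dotProduct_prodDZ i u).symm.trans (h.1 i)
  · exact fun h => ⟨fun i => (P.dotProduct_prodDZ i u).trans (h i),
      fun b => P.prodDZ_dotProduct_of_mem_dualSymX b.2 u⟩

end DualTerms

variable [Fintype I]

/-- Products of the transverse-field terms. -/
def prodOX : (I → ZMod 2) →ₗ[ZMod 2] Bits Q := Fintype.linearCombination (ZMod 2) P.OX

/-- Products of the duals of the transverse-field terms. -/
def prodDX : (I → ZMod 2) →ₗ[ZMod 2] Bits Q' := Fintype.linearCombination (ZMod 2) P.DX

theorem prodOX_apply (u : I → ZMod 2) : P.prodOX u = ∑ i, u i • P.OX i := rfl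

theorem prodDX_apply (u : I → ZMod 2) : P.prodDX u = ∑ i, u i • P.DX i := rfl

theorem dotProduct_prodDX (α : A) (u : I → ZMod 2) :
    P.DZ α ⬝ᵥ P.prodDX u = P.OZ α ⬝ᵥ P.prodOX u := by
  simp [prodDX_apply, prodOX_apply, dotProduct_sum, dotProduct_smul, P.dual]

theorem prodOX_dotProduct_of_mem_symZ {b : Bits Q} (hb : b ∈ P.symZ) (u : I → ZMod 2) :
    P.prodOX u ⬝ᵥ b = 0 := by
  rw [dotProduct_comm, prodOX_apply, dotProduct_sum]
  refine Finset.sum_eq_zero fun i _ => ?_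
  rw [dotProduct_smul, hb i, smul_zero]

theorem prodOX_mem_symmetries_GZ (u : I → ZMod 2) : P.prodOX u ∈ symmetries P.GZ :=
  fun r => P.prodOX_dotProduct_of_mem_symZ (P.GZ_mem r) u

/-- `symZ` is the annihilator of the terms `OX`, so its own annihilator is their span. Compatible
`X`-type symmetries are therefore products of transverse-field terms and possess duals. -/
theorem exists_prodOX_eq {x : Bits Q} (h : ∀ b ∈ P.symZ, x ⬝ᵥ b = 0) : ∃ u, P.prodOX u = x := by
  have h1 := mem_span_of_forall_dotProduct_eq_zero P.OX x fun a ha =>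
    h a fun i => by rw [dotProduct_comm]; exact ha i
  rwa [← Fintype.range_linearCombination] at h1

theorem exists_prodOX_eq_of_mem_symX {a : Bits Q} (ha : a ∈ P.symX) : ∃ u, P.prodOX u = a :=
  P.exists_prodOX_eq fun b hb => ha.2 ⟨b, hb⟩

theorem prodOX_mem_symX_iff (u : I → ZMod 2) : P.prodOX u ∈ P.symX ↔ P.prodDX u ∈ P.dualSymX := by
  have h1 : ∀ α, P.prodOX u ⬝ᵥ P.OZ α = P.prodDX u ⬝ᵥ P.DZ α := fun α => by
    rw [dotProduct_comm, ← P.dotProduct_prodDX, dotProduct_comm]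
  constructor
  · exact fun h α => (h1 α).symm.trans (h.1 α)
  · exact fun h => ⟨fun α => (h1 α).trans (h α), fun b => P.prodOX_dotProduct_of_mem_symZ b.2 u⟩

/-- A string that commutes with the compatible `Z`-type symmetries of the dual. -/
theorem exists_add_prodDX_mem_dualSymX {y : Bits Q'} (h : ∀ b ∈ P.dualSymZ, b ⬝ᵥ y = 0) :
    ∃ u, y + P.prodDX u ∈ P.dualSymX := by
  -- `dualSymZ` is the common annihilator of the terms `DX` and of `dualSymX`, so `y` is a product
  -- of `DX` terms times a dual symmetry.
  have h1 := mem_span_of_forall_dotProduct_eq_zero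
    (Sum.elim P.DX fun s : P.dualSymX => (s : Bits Q')) y fun a ha => by
      rw [dotProduct_comm]
      refine h a ⟨fun i => ?_, fun s => ?_⟩
      · rw [dotProduct_comm]; exact ha (Sum.inl i)
      · rw [dotProduct_comm]; exact ha (Sum.inr s)
  rw [Set.Sum.elim_range, Submodule.span_union, Submodule.mem_sup] at h1
  obtain ⟨d, hd, s, hs, rfl⟩ := h1
  rw [← Fintype.range_linearCombination] at hd
  obtain ⟨u, rfl⟩ := hd
  refine ⟨u, ?_⟩
  change P.prodDX u + s + P.prodDX u ∈ _
  rw [add_comm (P.prodDX u), add_add_cancel_of_zmod_two]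
  rwa [Subtype.range_coe_subtype, show {x | x ∈ P.dualSymX} = (P.dualSymX : Set (Bits Q')) from rfl,
    Submodule.span_eq] at hs

/-! ### The stabilizer group -/

/-- Products of the suspensions `OX ΔX OX`. -/
def suspMap (K : ℕ) : (Fin (K + 1) → I → ZMod 2) →ₗ[ZMod 2] Bits (Stack Q Q' K) :=
  ∑ j, (onOddₗ j.castSucc ∘ₗ P.prodOX + onEvenₗ j ∘ₗ P.prodDX + onOddₗ j.succ ∘ₗ P.prodOX) ∘ₗ
    LinearMap.proj j

variable {K : ℕ}

theorem suspMap_apply (u : Fin (K + 1) → I → ZMod 2) :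
    P.suspMap K u = ∑ j, (onOdd j.castSucc (P.prodOX (u j)) + onEven j (P.prodDX (u j)) +
      onOdd j.succ (P.prodOX (u j))) := by
  simp [suspMap, LinearMap.sum_apply, onOddₗ_apply, onEvenₗ_apply]

theorem evenPart_suspMap (u : Fin (K + 1) → I → ZMod 2) (j : Fin (K + 1)) :
    evenPart j (P.suspMap K u) = P.prodDX (u j) := by
  simp [suspMap_apply, map_sum]

theorem oddPart_zero_suspMap (u : Fin (K + 1) → I → ZMod 2) :
    oddPart 0 (P.suspMap K u) = P.prodOX (u 0) := by
  have h1 : ∀ j : Fin (K + 1), (0 : Fin (K + 2)) = j.castSucc ↔ 0 = j := fun j => by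
    simp [Fin.ext_iff]
  have h2 : ∀ j : Fin (K + 1), (0 : Fin (K + 2)) ≠ j.succ := fun j => (Fin.succ_ne_zero j).symm
  simp [suspMap_apply, map_sum, h1, h2]

theorem oddPart_last_suspMap (u : Fin (K + 1) → I → ZMod 2) :
    oddPart (Fin.last (K + 1)) (P.suspMap K u) = P.prodOX (u (Fin.last K)) := by
  have h1 : ∀ j : Fin (K + 1), Fin.last (K + 1) ≠ j.castSucc :=
    fun j => (Fin.castSucc_lt_last j).ne'
  have h2 : ∀ j : Fin (K + 1), Fin.last (K + 1) = j.succ ↔ Fin.last K = j := fun j => by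
    rw [← Fin.succ_last, Fin.succ_inj]
  simp [suspMap_apply, map_sum, h1, h2]

theorem oddPart_internal_suspMap (u : Fin (K + 1) → I → ZMod 2) (j : Fin K) :
    oddPart j.succ.castSucc (P.suspMap K u) =
      P.prodOX (u j.castSucc) + P.prodOX (u j.succ) := by
  have h1 : ∀ i : Fin (K + 1), j.succ.castSucc = i.castSucc ↔ j.succ = i :=
    fun i => Fin.castSucc_inj
  have h2 : ∀ i : Fin (K + 1), j.succ.castSucc = i.succ ↔ j.castSucc = i := fun i => by
    rw [← Fin.succ_castSucc, Fin.succ_inj]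
  simp only [suspMap_apply, map_sum, map_add, oddPart_onOdd, oddPart_onEven, add_zero,
    Finset.sum_add_distrib, h1, h2, Finset.sum_ite_eq, Finset.mem_univ, if_true,
    Finset.sum_const_zero]
  rw [add_comm]

theorem suspMap_single (j : Fin (K + 1)) (i : I) [DecidableEq I] :
    P.suspMap K (Pi.single j (Pi.single i 1)) = P.suspX K i j := by
  rw [suspMap_apply, Finset.sum_eq_single j]
  · simp [suspX, prodOX, prodDX]
  · intro j' _ hj'
    simp [Pi.single_eq_of_ne hj', ← onOddₗ_apply, ← onEvenₗ_apply]
  · simp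

/-- The group generated by the suspensions `OX ΔX OX`, by `GX` on the odd layers, and by a group
on the even layers. -/
def suspGroup (K : ℕ) (Γ : Submodule (ZMod 2) (Bits Q')) :
    Submodule (ZMod 2) (Bits (Stack Q Q' K)) :=
  LinearMap.range (P.suspMap K) ⊔ layerGroup (Submodule.span (ZMod 2) (Set.range P.GX)) Γ K

theorem mem_suspGroup {Γ : Submodule (ZMod 2) (Bits Q')} {x : Bits (Stack Q Q' K)} :
    x ∈ P.suspGroup K Γ ↔ ∃ u,
      x + P.suspMap K u ∈ layerGroup (Submodule.span (ZMod 2) (Set.range P.GX)) Γ K := by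
  rw [suspGroup, Submodule.mem_sup]
  constructor
  · rintro ⟨_, ⟨u, rfl⟩, y, hy, rfl⟩
    exact ⟨u, by rwa [add_comm (P.suspMap K u), add_add_cancel_of_zmod_two]⟩
  · rintro ⟨u, hu⟩
    exact ⟨_, ⟨u, rfl⟩, _, hu, by rw [add_comm x, ← add_assoc, add_self_eq_zero_of_zmod_two,
      zero_add]⟩

theorem suspGroup_mono {Γ Γ' : Submodule (ZMod 2) (Bits Q')} (h : Γ ≤ Γ') :
    P.suspGroup K Γ ≤ P.suspGroup K Γ' := by
  intro x hx
  rw [mem_suspGroup] at hx ⊢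
  obtain ⟨u, hu⟩ := hx
  rw [mem_layerGroup] at hu
  exact ⟨u, mem_layerGroup.2 ⟨hu.1, fun j => h (hu.2 j)⟩⟩

theorem onOdd_mem_suspGroup {Γ : Submodule (ZMod 2) (Bits Q')} {a : Bits Q} (j : Fin (K + 2))
    (ha : a ∈ Submodule.span (ZMod 2) (Set.range P.GX)) : onOdd j a ∈ P.suspGroup K Γ := by
  refine Submodule.mem_sup_right (mem_layerGroup.2 ⟨fun i => ?_, fun i => by simp⟩)
  rw [oddPart_onOdd]
  split_ifs
  exacts [ha, Submodule.zero_mem _]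

theorem onEven_mem_suspGroup {Γ : Submodule (ZMod 2) (Bits Q')} {a : Bits Q'} (j : Fin (K + 1))
    (ha : a ∈ Γ) : onEven j a ∈ P.suspGroup K Γ := by
  refine Submodule.mem_sup_right (mem_layerGroup.2 ⟨fun i => by simp, fun i => ?_⟩)
  rw [evenPart_onEven]
  split_ifs
  exacts [ha, Submodule.zero_mem _]

theorem suspX_mem_suspGroup {Γ : Submodule (ZMod 2) (Bits Q')} (i : I) (j : Fin (K + 1)) :
    P.suspX K i j ∈ P.suspGroup K Γ := by
  classical
  exact Submodule.mem_sup_left ⟨_, P.suspMap_single j i⟩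

theorem suspGroup_le {Γ : Submodule (ZMod 2) (Bits Q')}
    {G : Submodule (ZMod 2) (Bits (Stack Q Q' K))} (h1 : ∀ i j, P.suspX K i j ∈ G)
    (h2 : ∀ s j, onOdd j (P.GX s) ∈ G) (h3 : ∀ j, ∀ a ∈ Γ, onEven j a ∈ G) :
    P.suspGroup K Γ ≤ G := by
  classical
  refine sup_le ?_ (layerGroup_le (fun j => ?_) (fun j a ha => h3 j a ha))
  · rintro _ ⟨u, rfl⟩
    have hu : u = ∑ j, ∑ i, u j i • Pi.single j (Pi.single i 1) := by
      ext j' i'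
      simp [Finset.sum_apply, Pi.single_apply, Finset.sum_ite_eq, ite_apply]
    rw [hu]
    simp only [map_sum, map_smul, suspMap_single]
    exact Submodule.sum_mem _ fun j _ => Submodule.sum_mem _ fun i _ =>
      Submodule.smul_mem _ _ (h1 i j)
  · rw [Submodule.span_le, Set.range_subset_iff]
    exact fun s => h2 s j

/-- Equal symmetries on the first and on the last layer are products of bulk operators and of
symmetries on the even layers. -/
theorem onEnds_prodOX_mem_suspGroup {Γ : Submodule (ZMod 2) (Bits Q')} {u : I → ZMod 2}
    (hu : P.prodDX u ∈ Γ) :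
    onEnds Q Q' K (P.prodOX u, P.prodOX u) ∈ P.suspGroup K Γ := by
  rw [mem_suspGroup]
  refine ⟨fun _ => u, mem_layerGroup.2 ⟨fun i => ?_, fun i => ?_⟩⟩
  · rw [map_add]
    rcases odd_layer_cases i with rfl | rfl | ⟨j, rfl⟩
    · rw [oddPart_zero_onEnds, oddPart_zero_suspMap, add_self_eq_zero_of_zmod_two]
      exact Submodule.zero_mem _
    · rw [oddPart_last_onEnds, oddPart_last_suspMap, add_self_eq_zero_of_zmod_two]
      exact Submodule.zero_mem _
    · rw [oddPart_internal_onEnds, oddPart_internal_suspMap, add_self_eq_zero_of_zmod_two, add_zero]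
      exact Submodule.zero_mem _
  · rw [map_add, evenPart_onEnds, evenPart_suspMap, zero_add]
    exact hu

/-- The even layers force each dual product `prodDX (u j)` into `Γ`, the internal odd layers force
neighbouring `prodOX (u j)` to agree modulo `GX`, and the end layers tie the first and last of them
to `y`. -/
theorem exists_of_onEnds_mem_suspGroup {Γ : Submodule (ZMod 2) (Bits Q')} {y : Bits Q × Bits Q}
    (hy : onEnds Q Q' K y ∈ P.suspGroup K Γ) :
    ∃ u v, P.prodDX u ∈ Γ ∧ P.prodDX v ∈ Γ ∧
      y.1 + P.prodOX u ∈ Submodule.span (ZMod 2) (Set.range P.GX) ∧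
      y.2 + P.prodOX v ∈ Submodule.span (ZMod 2) (Set.range P.GX) ∧
      P.prodOX u + P.prodOX v ∈ Submodule.span (ZMod 2) (Set.range P.GX) := by
  rw [mem_suspGroup] at hy
  obtain ⟨u, hu⟩ := hy
  simp only [mem_layerGroup, map_add, evenPart_onEnds, evenPart_suspMap, zero_add] at hu
  obtain ⟨h1, h2⟩ := hu
  have h3 := h1 0
  have h4 := h1 (Fin.last (K + 1))
  rw [oddPart_zero_onEnds, oddPart_zero_suspMap] at h3
  rw [oddPart_last_onEnds, oddPart_last_suspMap] at h4
  refine ⟨u 0, u (Fin.last K), h2 _, h2 _, h3, h4, ?_⟩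
  -- Chaining the internal layers compares every `u j` with `u 0`.
  have h5 : ∀ j : Fin (K + 1), P.prodOX (u 0) + P.prodOX (u j) ∈
      Submodule.span (ZMod 2) (Set.range P.GX) := by
    intro j
    induction j using Fin.induction with
    | zero => rw [add_self_eq_zero_of_zmod_two]; exact Submodule.zero_mem _
    | succ j ih =>
      have h6 := h1 j.succ.castSucc
      rw [oddPart_internal_onEnds, oddPart_internal_suspMap, zero_add] at h6
      have h7 := Submodule.add_mem _ ih h6
      rwa [← add_assoc, add_add_cancel_of_zmod_two] at h7
  exact h5 _

/-- The origin of the constraint `U ⊗ U = 1`. A product of `DX` terms is a dual symmetry exactly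
when the product of `OX` terms is in `symX`; conversely, a common symmetry on both ends is the
product of the same suspensions at all even layers, up to dual symmetries there. -/
theorem gaugePairs_inf_comap_suspGroup_dualSymX :
    P.gaugePairs ⊓ (P.suspGroup K P.dualSymX).comap (onEnds Q Q' K) = P.ficGroup := by
  ext y
  rw [Submodule.mem_inf, mem_ficGroup]
  constructor
  · rintro ⟨-, hy⟩
    obtain ⟨u, v, hu, hv, h1, h2, h3⟩ := P.exists_of_onEnds_mem_suspGroup hy
    refine ⟨⟨?_, ?_⟩, ?_⟩
    · rw [← add_add_cancel_of_zmod_two y.1 (P.prodOX u)]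
      exact Submodule.add_mem _ (P.span_GX_le_symX h1) ((P.prodOX_mem_symX_iff u).2 hu)
    · rw [← add_add_cancel_of_zmod_two y.2 (P.prodOX v)]
      exact Submodule.add_mem _ (P.span_GX_le_symX h2) ((P.prodOX_mem_symX_iff v).2 hv)
    · have h4 := Submodule.add_mem _ (Submodule.add_mem _ h1 h2) h3
      rwa [add_add_add_comm, add_add_cancel_of_zmod_two, add_add_cancel_of_zmod_two] at h4
  · rintro ⟨⟨h1, h2⟩, h3⟩
    refine ⟨⟨P.symX_le_symmetries_GZ h1, P.symX_le_symmetries_GZ h2⟩, ?_⟩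
    obtain ⟨u, hu⟩ := P.exists_prodOX_eq_of_mem_symX h1
    have h4 := P.onEnds_prodOX_mem_suspGroup (K := K) ((P.prodOX_mem_symX_iff u).1 (hu ▸ h1))
    have h5 := P.onOdd_mem_suspGroup (Γ := P.dualSymX) (Fin.last (K + 1)) h3
    have h6 := Submodule.add_mem _ h4 h5
    rw [Submodule.mem_comap]
    convert h6 using 1
    rw [hu, onEnds_apply, onEnds_apply, ← onOddₗ_apply, ← onOddₗ_apply (Fin.last (K + 1)),
      ← onOddₗ_apply (Fin.last (K + 1)), ← onOddₗ_apply (Fin.last (K + 1)), map_add, add_assoc,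
      ← add_assoc (onOddₗ (Fin.last (K + 1)) y.1), add_self_eq_zero_of_zmod_two, zero_add]

/-- Under `hX` the two products at the ends are separately in the span of `GX`, so no coupling
between the copies survives. -/
theorem gaugePairs_inf_comap_suspGroup_span_ΓX
    (hX : ∀ u, P.prodDX u ∈ Submodule.span (ZMod 2) (Set.range P.ΓX) →
      P.prodOX u ∈ Submodule.span (ZMod 2) (Set.range P.GX)) :
    P.gaugePairs ⊓ (P.suspGroup K (Submodule.span (ZMod 2) (Set.range P.ΓX))).comap
      (onEnds Q Q' K) =
      (Submodule.span (ZMod 2) (Set.range P.GX)).prod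
        (Submodule.span (ZMod 2) (Set.range P.GX)) := by
  ext y
  rw [Submodule.mem_inf, Submodule.mem_prod]
  constructor
  · rintro ⟨-, hy⟩
    obtain ⟨u, v, hu, hv, h1, h2, -⟩ := P.exists_of_onEnds_mem_suspGroup hy
    have h3 := Submodule.add_mem _ h1 (hX u hu)
    have h4 := Submodule.add_mem _ h2 (hX v hv)
    rw [add_add_cancel_of_zmod_two] at h3 h4
    exact ⟨h3, h4⟩
  · rintro ⟨h1, h2⟩
    refine ⟨⟨P.symX_le_symmetries_GZ (P.span_GX_le_symX h1),
      P.symX_le_symmetries_GZ (P.span_GX_le_symX h2)⟩, ?_⟩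
    exact Submodule.add_mem _ (P.onOdd_mem_suspGroup _ h1) (P.onOdd_mem_suspGroup _ h2)

end DualPair

/-! ### Locality -/

section LocalityLemmas

variable {M Q Q' I : Type*} [PseudoMetricSpace M]

theorem PauliVec.supp_mk (a b : Bits Q) : PauliVec.supp (a, b) = GI.supp a ∪ GI.supp b := rfl

@[simp] theorem supp_zero : supp (0 : Bits Q) = ∅ := by simp [supp]

theorem map_mem_span_image {ι : Type*} {F : ι → PauliVec Q} {J : Set ι} {v : PauliVec Q}
    (hv : v ∈ Submodule.span (ZMod 2) (F '' J)) (π : PauliVec Q →ₗ[ZMod 2] Bits Q)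
    {S : Submodule (ZMod 2) (Bits Q)} (hS : ∀ i ∈ J, π (F i) ∈ S) : π v ∈ S := by
  have h1 : Submodule.span (ZMod 2) (F '' J) ≤ S.comap π := by
    rw [Submodule.span_le]
    rintro _ ⟨i, hi, rfl⟩
    exact hS i hi
  exact h1 hv

variable [Fintype Q] [Fintype Q'] [Fintype I]

/-- The dual of a product of terms in a region has a slightly larger diameter at most. -/
theorem exists_dual_diam_le (pos : Q → M) (pos' : Q' → M) {ℓ : ℝ} (hℓ : 0 ≤ ℓ) (T : I → Bits Q)
    (T' : I → Bits Q')
    (hT : ∀ i, Metric.diam (pos '' supp (T i) ∪ pos' '' supp (T' i)) ≤ ℓ) (U : Set Q)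
    {a : Bits Q} (ha : a ∈ Submodule.span (ZMod 2) (T '' {i | supp (T i) ⊆ U})) :
    ∃ w : I → ZMod 2, ∑ i, w i • T i = a ∧
      Metric.diam (pos' '' supp (∑ i, w i • T' i)) ≤ Metric.diam (pos '' U) + 2 * ℓ := by
  classical
  -- Trivial terms are discarded, since an identity operator can have a dual far away from `U`. Each
  -- term kept has a support point in `U`, within `ℓ` of the support of its dual; the two ends of a
  -- distance give `2 * ℓ`.
  have h1 : ∃ w : I → ZMod 2, ∑ i, w i • T i = a ∧ ∀ i, w i ≠ 0 → supp (T i) ⊆ U ∧ T i ≠ 0 := by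
    induction ha using Submodule.span_induction with
    | mem v hv =>
      obtain ⟨i, hi, rfl⟩ := hv
      by_cases h0 : T i = 0
      · exact ⟨0, by simp [h0], by simp⟩
      · refine ⟨Pi.single i 1, by simp [Pi.single_apply], fun j hj => ?_⟩
        have : j = i := by
          by_contra h
          exact hj (Pi.single_eq_of_ne h _)
        subst this
        exact ⟨hi, h0⟩
    | zero => exact ⟨0, by simp, by simp⟩
    | add u v _ _ hu hv =>
      obtain ⟨w, rfl, hw⟩ := hu
      obtain ⟨w', rfl, hw'⟩ := hv
      refine ⟨w + w', by simp [add_smul, Finset.sum_add_distrib], fun i hi => ?_⟩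
      by_cases h : w i = 0
      · exact hw' i (by simpa [h] using hi)
      · exact hw i h
    | smul t v _ hv =>
      obtain ⟨w, rfl, hw⟩ := hv
      exact ⟨t • w, by simp [Finset.smul_sum, mul_smul], fun i hi => hw i (right_ne_zero_of_mul hi)⟩
  obtain ⟨w, hw, hw'⟩ := h1
  refine ⟨w, hw, ?_⟩
  have hbdd : ∀ s : Set Q, Bornology.IsBounded (pos '' s) :=
    fun s => (s.toFinite.image pos).isBounded
  have hbdd' : ∀ s : Set Q', Bornology.IsBounded (pos' '' s) :=
    fun s => (s.toFinite.image pos').isBounded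
  have hnear : ∀ q' ∈ supp (∑ i, w i • T' i), ∃ q ∈ U, dist (pos' q') (pos q) ≤ ℓ := by
    intro q' hq'
    obtain ⟨i, -, hi⟩ : ∃ i ∈ Finset.univ, (w i • T' i) q' ≠ 0 := by
      refine Finset.exists_ne_zero_of_sum_ne_zero ?_
      simpa [supp, Finset.sum_apply] using hq'
    obtain ⟨hiU, hi0⟩ := hw' i (left_ne_zero_of_mul hi)
    obtain ⟨q, hq⟩ := Function.ne_iff.1 hi0
    refine ⟨q, hiU hq, (Metric.dist_le_diam_of_mem ((hbdd _).union (hbdd' _)) ?_ ?_).trans (hT i)⟩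
    · exact Or.inr ⟨q', right_ne_zero_of_mul hi, rfl⟩
    · exact Or.inl ⟨q, hq, rfl⟩
  refine Metric.diam_le_of_forall_dist_le (by positivity) ?_
  rintro _ ⟨q₁, hq₁, rfl⟩ _ ⟨q₂, hq₂, rfl⟩
  obtain ⟨p₁, hp₁, h₁⟩ := hnear q₁ hq₁
  obtain ⟨p₂, hp₂, h₂⟩ := hnear q₂ hq₂
  have h3 := Metric.dist_le_diam_of_mem (hbdd U) ⟨p₁, hp₁, rfl⟩ ⟨p₂, hp₂, rfl⟩
  have h4 := dist_triangle4 (pos' q₁) (pos p₁) (pos p₂) (pos' q₂)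
  rw [dist_comm (pos p₂)] at h4
  linarith

end LocalityLemmas

namespace DualPair

variable {Q Q' A I ιr ιs ιρ ισ : Type*} [Fintype Q] [Fintype Q']
variable {P : DualPair Q Q' A I ιr ιs ιρ ισ}
variable {M : Type*} [PseudoMetricSpace M] {pos : Q → M} {pos' : Q' → M} {ℓ c R : ℝ}

/-- Local `X`-type symmetries are products of transverse-field terms whose dual is trivial up to
local symmetries. -/
theorem IsLocal.exists_prodOX_eq [Fintype I] (hP : P.IsLocal pos pos' ℓ c R) {a : Bits Q}
    (ha : a ∈ Submodule.span (ZMod 2) (Set.range P.GX)) :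
    ∃ w, P.prodOX w = a ∧ P.prodDX w ∈ Submodule.span (ZMod 2) (Set.range P.ΓX) := by
  suffices h : Submodule.span (ZMod 2) (Set.range P.GX) ≤
      ((Submodule.span (ZMod 2) (Set.range P.ΓX)).comap P.prodDX).map P.prodOX by
    obtain ⟨w, hw, hw'⟩ := h ha
    exact ⟨w, hw', hw⟩
  rw [Submodule.span_le]
  rintro _ ⟨s, rfl⟩
  have hscale := hP.scale
  have hℓ := hP.nonneg_ℓ
  have hc := hP.nonneg_c
  obtain ⟨U, -, hU, hmem⟩ := hP.cslo (P.GX s, 0) (by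
    rw [PauliVec.supp_mk, supp_zero, Set.union_empty]
    linarith [hP.diam_GX s]) (by
    rintro (i | r)
    · simp [PauliVec.Commutes]
    · simpa [PauliVec.Commutes, dotProduct_comm] using P.symX_le_symmetries_GZ (P.GX_mem s) r)
  rw [PauliVec.supp_mk, supp_zero, Set.union_empty] at hU
  -- Projection to the `X` component drops the generators `GZ`.
  have h1 : P.GX s ∈ Submodule.span (ZMod 2) (P.OX '' {i | supp (P.OX i) ⊆ U}) := by
    refine map_mem_span_image hmem (LinearMap.fst _ _ _) ?_
    rintro (i | r) hi
    · refine Submodule.subset_span ⟨i, ?_, rfl⟩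
      simpa [PauliVec.supp_mk] using hi
    · exact Submodule.zero_mem _
  obtain ⟨w, hw, hdiam⟩ := exists_dual_diam_le pos pos' hℓ P.OX P.DX hP.diam_X U h1
  refine ⟨w, ?_, hw⟩
  have hw' : P.prodOX w = P.GX s := hw
  have h2 : P.prodDX w ∈ P.dualSymX := (P.prodOX_mem_symX_iff w).1 (hw' ▸ P.GX_mem s)
  -- The dual is local: `ℓ` for `GX s`, plus `c` for the generating region, plus `2 * ℓ` for passing
  -- to the dual. This is the bound `3 * ℓ + c ≤ R`.
  obtain ⟨U', -, -, hmem'⟩ := hP.dual_cslo (P.prodDX w, 0) (by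
    rw [PauliVec.supp_mk, supp_zero, Set.union_empty, prodDX_apply]
    linarith [hP.diam_GX s]) (by
    rintro (α | ρ)
    · simpa [PauliVec.Commutes, dotProduct_comm] using h2 α
    · simp [PauliVec.Commutes])
  rw [SetLike.mem_coe, Submodule.mem_comap]
  refine map_mem_span_image hmem' (LinearMap.fst _ _ _) ?_
  rintro (α | ρ) -
  · exact Submodule.zero_mem _
  · exact Submodule.subset_span ⟨ρ, rfl⟩

/-- Local `Z`-type symmetries of the dual are products of duals of Ising terms such that the
product of the Ising terms is trivial up to local symmetries. -/
theorem IsLocal.exists_prodDZ_eq [Fintype A] (hP : P.IsLocal pos pos' ℓ c R) {a : Bits Q'}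
    (ha : a ∈ Submodule.span (ZMod 2) (Set.range P.ΓZ)) :
    ∃ w, P.prodDZ w = a ∧ P.prodOZ w ∈ Submodule.span (ZMod 2) (Set.range P.GZ) := by
  suffices h : Submodule.span (ZMod 2) (Set.range P.ΓZ) ≤
      ((Submodule.span (ZMod 2) (Set.range P.GZ)).comap P.prodOZ).map P.prodDZ by
    obtain ⟨w, hw, hw'⟩ := h ha
    exact ⟨w, hw', hw⟩
  rw [Submodule.span_le]
  rintro _ ⟨s, rfl⟩
  have hscale := hP.scale
  have hℓ := hP.nonneg_ℓ
  have hc := hP.nonneg_c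
  obtain ⟨U, -, hU, hmem⟩ := hP.dual_cslo (0, P.ΓZ s) (by
    rw [PauliVec.supp_mk, supp_zero, Set.empty_union]
    linarith [hP.diam_ΓZ s]) (by
    rintro (α | ρ)
    · simp [PauliVec.Commutes]
    · simpa [PauliVec.Commutes, dotProduct_comm] using (P.ΓZ_mem s).2 ⟨_, P.ΓX_mem ρ⟩)
  rw [PauliVec.supp_mk, supp_zero, Set.empty_union] at hU
  have h1 : P.ΓZ s ∈ Submodule.span (ZMod 2) (P.DZ '' {i | supp (P.DZ i) ⊆ U}) := by
    refine map_mem_span_image hmem (LinearMap.snd _ _ _) ?_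
    rintro (i | r) hi
    · refine Submodule.subset_span ⟨i, ?_, rfl⟩
      simpa [PauliVec.supp_mk] using hi
    · exact Submodule.zero_mem _
  obtain ⟨w, hw, hdiam⟩ := exists_dual_diam_le pos' pos hℓ P.DZ P.OZ
    (fun α => by rw [Set.union_comm]; exact hP.diam_Z α) U h1
  refine ⟨w, ?_, hw⟩
  have hw' : P.prodDZ w = P.ΓZ s := hw
  have h2 : P.prodOZ w ∈ P.symZ := (P.prodDZ_mem_dualSymZ_iff w).1 (hw' ▸ P.ΓZ_mem s)
  obtain ⟨U', -, -, hmem'⟩ := hP.cslo (0, P.prodOZ w) (by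
    rw [PauliVec.supp_mk, supp_zero, Set.empty_union, prodOZ_apply]
    linarith [hP.diam_ΓZ s]) (by
    rintro (α | ρ)
    · simpa [PauliVec.Commutes, dotProduct_comm] using h2 α
    · simp [PauliVec.Commutes])
  rw [SetLike.mem_coe, Submodule.mem_comap]
  refine map_mem_span_image hmem' (LinearMap.snd _ _ _) ?_
  rintro (α | ρ) -
  · exact Submodule.zero_mem _
  · exact Submodule.subset_span ⟨ρ, rfl⟩

theorem sum_smul_eq_sum_filter {N ι : Type*} [Fintype ι] (T : ι → Bits N) (w : ι → ZMod 2) :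
    ∑ i, w i • T i = ∑ i ∈ Finset.univ.filter (fun i => w i ≠ 0), T i := by
  rw [Finset.sum_filter]
  refine Finset.sum_congr rfl fun i _ => ?_
  rcases zmod_two_eq_zero_or_one (w i) with h | h <;> simp [h]

theorem sum_eq_sum_smul_indicator {N ι : Type*} [Fintype ι] [DecidableEq ι] (T : ι → Bits N)
    (J : Finset ι) : ∑ i ∈ J, T i = ∑ i, (if i ∈ J then (1 : ZMod 2) else 0) • T i := by
  simp

/-- Without the first relation, products of transverse-field terms with a locally trivial dual are
locally trivial. -/
theorem IsLocal.prodOX_mem_span_GX [Fintype I] (hP : P.IsLocal pos pos' ℓ c R) {n : ℕ}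
    {UX : Fin n → Bits Q}
    (hUX : IsNonlocalGenerators P.symX P.GX UX)
    (h : ∀ N : Finset (Fin n), N.Nonempty → ∀ J, ¬ P.ChargeRelation UX N J) (u : I → ZMod 2)
    (hu : P.prodDX u ∈ Submodule.span (ZMod 2) (Set.range P.ΓX)) :
    P.prodOX u ∈ Submodule.span (ZMod 2) (Set.range P.GX) := by
  have h1 := hUX.maximal ((P.prodOX_mem_symX_iff u).2 (P.span_ΓX_le_dualSymX hu))
  rw [Submodule.mem_sup] at h1
  obtain ⟨g, hg, v, hv, hgv⟩ := h1
  -- The local factor is itself a product of transverse-field terms with trivial dual. Absorbing it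
  -- into `u` turns the remaining product of `UX` into a `ChargeRelation`, so that product must be
  -- empty.
  obtain ⟨w, rfl, hw⟩ := hP.exists_prodOX_eq hg
  rw [← Fintype.range_linearCombination] at hv
  obtain ⟨k, rfl⟩ := hv
  have h2 : Fintype.linearCombination (ZMod 2) UX k = P.prodOX (w + u) := by
    rw [map_add, ← hgv, ← add_assoc, add_self_eq_zero_of_zmod_two, zero_add]
  rw [Fintype.linearCombination_apply, prodOX_apply, sum_smul_eq_sum_filter,
    sum_smul_eq_sum_filter] at h2
  have h3 : P.prodDX (w + u) ∈ Submodule.span (ZMod 2) (Set.range P.ΓX) := by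
    rw [map_add]
    exact Submodule.add_mem _ hw hu
  rw [prodDX_apply, sum_smul_eq_sum_filter] at h3
  have h4 := Finset.not_nonempty_iff_eq_empty.1 fun hne => h _ hne _ ⟨h2, h3⟩
  rw [← hgv, Fintype.linearCombination_apply, sum_smul_eq_sum_filter, h4, Finset.sum_empty,
    add_zero]
  exact hg

/-- Without the second relation, products of Ising terms that are locally trivial have a locally
trivial dual. -/
theorem IsLocal.prodDZ_mem_span_ΓZ [Fintype A] (hP : P.IsLocal pos pos' ℓ c R) {n : ℕ}
    {ΩZ : Fin n → Bits Q'}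
    (hΩZ : IsNonlocalGenerators P.dualSymZ P.ΓZ ΩZ)
    (h : ∀ N : Finset (Fin n), N.Nonempty → ∀ S, ¬ P.BoundaryRelation ΩZ N S) (u : A → ZMod 2)
    (hu : P.prodOZ u ∈ Submodule.span (ZMod 2) (Set.range P.GZ)) :
    P.prodDZ u ∈ Submodule.span (ZMod 2) (Set.range P.ΓZ) := by
  have h1 := hΩZ.maximal ((P.prodDZ_mem_dualSymZ_iff u).2 (P.span_GZ_le_symZ hu))
  rw [Submodule.mem_sup] at h1
  obtain ⟨g, hg, v, hv, hgv⟩ := h1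
  obtain ⟨w, rfl, hw⟩ := hP.exists_prodDZ_eq hg
  rw [← Fintype.range_linearCombination] at hv
  obtain ⟨k, rfl⟩ := hv
  have h2 : Fintype.linearCombination (ZMod 2) ΩZ k = P.prodDZ (w + u) := by
    rw [map_add, ← hgv, ← add_assoc, add_self_eq_zero_of_zmod_two, zero_add]
  rw [Fintype.linearCombination_apply, prodDZ_apply, sum_smul_eq_sum_filter,
    sum_smul_eq_sum_filter] at h2
  have h3 : P.prodOZ (w + u) ∈ Submodule.span (ZMod 2) (Set.range P.GZ) := by
    rw [map_add]
    exact Submodule.add_mem _ hw hu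
  rw [prodOZ_apply, sum_smul_eq_sum_filter] at h3
  have h4 := Finset.not_nonempty_iff_eq_empty.1 fun hne => h _ hne _ ⟨h2, h3⟩
  rw [← hgv, Fintype.linearCombination_apply, sum_smul_eq_sum_filter, h4, Finset.sum_empty,
    add_zero]
  exact hg

end DualPair

/-! ### Sums over layers -/

theorem sum_castSucc_add_succ {K : ℕ} (f : Fin (K + 1) → ZMod 2) :
    ∑ j : Fin K, (f j.castSucc + f j.succ) = f 0 + f (Fin.last K) := by
  have h1 := Fin.sum_univ_castSucc f
  rw [Fin.sum_univ_succ] at h1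
  have h0 : (2 : ZMod 2) = 0 := rfl
  rw [Finset.sum_add_distrib]
  linear_combination h1 + (∑ i : Fin K, f i.castSucc - f 0) * h0

theorem sum_odd_layers {K : ℕ} {G : Type*} [AddCommMonoid G] (f : Fin (K + 2) → G) :
    ∑ j, f j = f 0 + ∑ j : Fin K, f j.succ.castSucc + f (Fin.last (K + 1)) := by
  rw [Fin.sum_univ_castSucc, Fin.sum_univ_succ]
  rfl

namespace DualPair

variable {Q Q' A I ιr ιs ιρ ισ : Type*} [Fintype Q] [Fintype Q']
variable (P : DualPair Q Q' A I ιr ιs ιρ ισ)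

/-! ### Generators -/

/-- The `Z`-type bulk terms. -/
def bulkZ (K : ℕ) : (A × Fin K) ⊕ (ιr × Fin (K + 2)) ⊕ (ισ × Fin (K + 1)) → Bits (Stack Q Q' K) :=
  Sum.elim (fun p => P.suspZ K p.1 p.2)
    (Sum.elim (fun p => onOdd p.2 (P.GZ p.1)) (fun p => onEven p.2 (P.ΓZ p.1)))

/-- The `X`-type bulk terms. -/
def bulkX (K : ℕ) :
    (I × Fin (K + 1)) ⊕ (ιs × Fin (K + 2)) ⊕ (ιρ × Fin (K + 1)) → Bits (Stack Q Q' K) :=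
  Sum.elim (fun p => P.suspX K p.1 p.2)
    (Sum.elim (fun p => onOdd p.2 (P.GX p.1)) (fun p => onEven p.2 (P.ΓX p.1)))

/-- The `Z`-type bulk terms and the `Z`-type operators that label the sectors. -/
def sectorZ {nZ mZ : ℕ} (UZ : Fin nZ → Bits Q) (ΩZ : Fin mZ → Bits Q') (K : ℕ) (l : Fin (K + 1)) :
    ((A × Fin K) ⊕ (ιr × Fin (K + 2)) ⊕ (ισ × Fin (K + 1))) ⊕ (Fin mZ ⊕ (Fin K × Fin nZ)) →
      Bits (Stack Q Q' K) :=
  Sum.elim (P.bulkZ K) (Sum.elim (fun k => onEven l (ΩZ k))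
    (fun p => onOdd p.1.succ.castSucc (UZ p.2)))

/-- The `X`-type bulk terms and the `X`-type operators that label the sectors. -/
def sectorX {mX : ℕ} (ΩX : Fin mX → Bits Q') (K : ℕ) :
    ((I × Fin (K + 1)) ⊕ (ιs × Fin (K + 2)) ⊕ (ιρ × Fin (K + 1))) ⊕ (Fin (K + 1) × Fin mX) →
      Bits (Stack Q Q' K) :=
  Sum.elim (P.bulkX K) (fun p => onEven p.1 (ΩX p.2))

variable {P} {K : ℕ}

theorem mem_symmetries_bulkZ {x : Bits (Stack Q Q' K)} :
    x ∈ symmetries (P.bulkZ K) ↔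
      (∀ α (j : Fin K), P.DZ α ⬝ᵥ evenPart j.castSucc x +
        P.OZ α ⬝ᵥ oddPart j.succ.castSucc x + P.DZ α ⬝ᵥ evenPart j.succ x = 0) ∧
      (∀ j, oddPart j x ∈ symmetries P.GZ) ∧ ∀ j, evenPart j x ∈ symmetries P.ΓZ := by
  rw [mem_symmetries, Sum.forall, Sum.forall, Prod.forall, Prod.forall, Prod.forall]
  refine and_congr ?_ (and_congr ?_ ?_)
  · refine forall₂_congr fun α j => ?_
    simp [bulkZ, suspZ, dotProduct_add, dotProduct_comm]
  · rw [forall_comm]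
    simp [bulkZ, mem_symmetries]
  · rw [forall_comm]
    simp [bulkZ, mem_symmetries]

theorem mem_symmetries_sectorZ {nZ mZ : ℕ} {UZ : Fin nZ → Bits Q} {ΩZ : Fin mZ → Bits Q'}
    {l : Fin (K + 1)} {x : Bits (Stack Q Q' K)} :
    x ∈ symmetries (P.sectorZ UZ ΩZ K l) ↔ x ∈ symmetries (P.bulkZ K) ∧
      evenPart l x ∈ symmetries ΩZ ∧ ∀ j : Fin K, oddPart j.succ.castSucc x ∈ symmetries UZ := by
  rw [mem_symmetries, Sum.forall]
  refine and_congr ?_ (Sum.forall.trans (and_congr ?_ ?_))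
  · simp [sectorZ, mem_symmetries]
  · simp [sectorZ, mem_symmetries]
  · rw [Prod.forall]
    refine forall₂_congr fun j k => ?_
    simp only [sectorZ, Sum.elim_inr, dotProduct_onOdd]

/-! ### Boundary terms -/

variable (P) (K) in
/-- The exponent vector of the Ising boundary term on the first two layers. -/
def firstZVec (α : A) : Bits (Stack Q Q' K) := onOdd 0 (P.OZ α) + onEven 0 (P.DZ α)

variable (P) (K) in
/-- The exponent vector of the Ising boundary term on the last two layers. -/
def lastZVec (α : A) : Bits (Stack Q Q' K) :=
  onEven (Fin.last K) (P.DZ α) + onOdd (Fin.last (K + 1)) (P.OZ α)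

theorem firstZVec_dotProduct (α : A) (x : Bits (Stack Q Q' K)) :
    P.firstZVec K α ⬝ᵥ x = P.OZ α ⬝ᵥ oddPart 0 x + P.DZ α ⬝ᵥ evenPart 0 x := by
  rw [firstZVec, add_dotProduct, onOdd_dotProduct, onEven_dotProduct]

theorem lastZVec_dotProduct (α : A) (x : Bits (Stack Q Q' K)) :
    P.lastZVec K α ⬝ᵥ x = P.OZ α ⬝ᵥ oddPart (Fin.last (K + 1)) x +
      P.DZ α ⬝ᵥ evenPart (Fin.last K) x := by
  rw [lastZVec, add_dotProduct, onOdd_dotProduct, onEven_dotProduct, add_comm]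

theorem onEnds_mem_symmetries_sectorZ {nZ mZ : ℕ} {UZ : Fin nZ → Bits Q} {ΩZ : Fin mZ → Bits Q'}
    {l : Fin (K + 1)} {y : Bits Q × Bits Q} (hy : y ∈ P.gaugePairs) :
    onEnds Q Q' K y ∈ symmetries (P.sectorZ UZ ΩZ K l) := by
  refine mem_symmetries_sectorZ.2 ⟨mem_symmetries_bulkZ.2 ⟨fun α j => ?_, fun i => ?_, fun j => ?_⟩,
    ?_, fun j => ?_⟩
  · rw [evenPart_onEnds, evenPart_onEnds, oddPart_internal_onEnds]
    simp
  · rcases odd_layer_cases i with rfl | rfl | ⟨j, rfl⟩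
    · rw [oddPart_zero_onEnds]; exact hy.1
    · rw [oddPart_last_onEnds]; exact hy.2
    · rw [oddPart_internal_onEnds]; exact Submodule.zero_mem _
  · rw [evenPart_onEnds]; exact Submodule.zero_mem _
  · rw [evenPart_onEnds]; exact Submodule.zero_mem _
  · rw [oddPart_internal_onEnds]; exact Submodule.zero_mem _

theorem ZVec_dotProduct_onEnds (y : Bits Q × Bits Q) (α : A) :
    P.firstZVec K α ⬝ᵥ onEnds Q Q' K y = P.OZ α ⬝ᵥ y.1 ∧
      P.lastZVec K α ⬝ᵥ onEnds Q Q' K y = P.OZ α ⬝ᵥ y.2 := by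
  simp [firstZVec_dotProduct, lastZVec_dotProduct]

/-- The suspensions over all internal odd layers, multiplied together, leave `DZ` only on the first
and last even layer. With the two boundary terms these cancel, and `OZ` on every odd layer remains.
-/
theorem firstZVec_dotProduct_add_lastZVec_dotProduct {x : Bits (Stack Q Q' K)}
    (hx : x ∈ symmetries (P.bulkZ K)) (α : A) :
    P.firstZVec K α ⬝ᵥ x + P.lastZVec K α ⬝ᵥ x = P.OZ α ⬝ᵥ ∑ j, oddPart j x := by
  have hsusp := (mem_symmetries_bulkZ.1 hx).1 α
  have h3 : ∑ j : Fin K, P.OZ α ⬝ᵥ oddPart j.succ.castSucc x =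
      P.DZ α ⬝ᵥ evenPart 0 x + P.DZ α ⬝ᵥ evenPart (Fin.last K) x := by
    rw [← sum_castSucc_add_succ (fun j => P.DZ α ⬝ᵥ evenPart j x)]
    refine Finset.sum_congr rfl fun j _ => eq_of_add_eq_zero_of_zmod_two ?_
    rw [← hsusp j]
    abel
  rw [dotProduct_sum, sum_odd_layers (fun j => P.OZ α ⬝ᵥ oddPart j x), h3, firstZVec_dotProduct,
    lastZVec_dotProduct]
  abel

/-- The shift of a string on the first and on the last layer that makes it commute with the Ising
boundary terms. -/
theorem exists_add_onEnds_dotProduct_eq_zero [Fintype A] [Fintype ιr]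
    (hZ : ∀ u, P.prodOZ u ∈ Submodule.span (ZMod 2) (Set.range P.GZ) →
      P.prodDZ u ∈ Submodule.span (ZMod 2) (Set.range P.ΓZ))
    {x : Bits (Stack Q Q' K)} (hx : x ∈ symmetries (P.bulkZ K)) :
    ∃ y ∈ P.gaugePairs, ∀ α, P.firstZVec K α ⬝ᵥ (x + onEnds Q Q' K y) = 0 ∧
      P.lastZVec K α ⬝ᵥ (x + onEnds Q Q' K y) = 0 := by
  obtain ⟨-, hodd, heven⟩ := mem_symmetries_bulkZ.1 hx
  -- A linear system for `a`: a relation between the `OZ` and the `GZ` puts a product of Ising terms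
  -- in the span of `GZ`. By `hZ` its dual is in the span of `ΓZ`, which annihilates the even parts
  -- of `x`, so the right-hand sides satisfy the relation.
  have key : ∀ j, ∃ a ∈ symmetries P.GZ, ∀ α, P.OZ α ⬝ᵥ a = P.DZ α ⬝ᵥ evenPart j x := by
    intro j
    obtain ⟨a, ha⟩ := exists_dotProduct_eq (Sum.elim P.OZ P.GZ)
      (Sum.elim (fun α => P.DZ α ⬝ᵥ evenPart j x) (fun _ => 0)) fun w hw => by
        simp only [Fintype.sum_sum_type, Sum.elim_inl, Sum.elim_inr, mul_zero,
          Finset.sum_const_zero, add_zero] at hw ⊢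
        have h1 : P.prodOZ (fun α => w (Sum.inl α)) ∈
            Submodule.span (ZMod 2) (Set.range P.GZ) := by
          rw [prodOZ_apply, eq_of_add_eq_zero_of_zmod_two hw]
          exact Submodule.sum_mem _ fun r _ =>
            Submodule.smul_mem _ _ (Submodule.subset_span ⟨r, rfl⟩)
        have h2 := dotProduct_eq_zero_of_mem_span (a := evenPart j x) (hZ _ h1) (by
          rintro _ ⟨σ, rfl⟩
          rw [dotProduct_comm]
          exact heven j σ)
        simpa [prodDZ_apply, sum_dotProduct, smul_dotProduct] using h2
    exact ⟨a, fun r => by rw [dotProduct_comm]; exact ha (Sum.inr r), fun α => ha (Sum.inl α)⟩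
  obtain ⟨a, ha, ha'⟩ := key 0
  obtain ⟨b, hb, hb'⟩ := key (Fin.last K)
  -- Adding `y` replaces the end layers of `x` by `a` and `b`, which cancel the contributions of the
  -- adjacent even layers.
  refine ⟨(oddPart 0 x + a, oddPart (Fin.last (K + 1)) x + b),
    ⟨Submodule.add_mem _ (hodd _) ha, Submodule.add_mem _ (hodd _) hb⟩, fun α => ⟨?_, ?_⟩⟩
  · rw [dotProduct_add, (ZVec_dotProduct_onEnds _ α).1, firstZVec_dotProduct, dotProduct_add, ha',
      add_self_eq_zero_of_zmod_two]
  · rw [dotProduct_add, (ZVec_dotProduct_onEnds _ α).2, lastZVec_dotProduct, dotProduct_add, hb',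
      add_self_eq_zero_of_zmod_two]

/-! ### The stabilizer groups -/

variable [Fintype I]

theorem span_range_bulkX :
    Submodule.span (ZMod 2) (Set.range (P.bulkX K)) =
      P.suspGroup K (Submodule.span (ZMod 2) (Set.range P.ΓX)) := by
  refine le_antisymm ?_ (P.suspGroup_le (fun i j => ?_) (fun s j => ?_) fun j => ?_)
  · rw [Submodule.span_le, Set.range_subset_iff]
    rintro (⟨i, j⟩ | ⟨s, j⟩ | ⟨ρ, j⟩)
    · exact P.suspX_mem_suspGroup i j
    · exact P.onOdd_mem_suspGroup j (Submodule.subset_span ⟨s, rfl⟩)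
    · exact P.onEven_mem_suspGroup j (Submodule.subset_span ⟨ρ, rfl⟩)
  · exact Submodule.subset_span ⟨Sum.inl (i, j), rfl⟩
  · exact Submodule.subset_span ⟨Sum.inr (Sum.inl (s, j)), rfl⟩
  · have h : Submodule.span (ZMod 2) (Set.range P.ΓX) ≤
        (Submodule.span (ZMod 2) (Set.range (P.bulkX K))).comap (onEvenₗ j) := by
      rw [Submodule.span_le, Set.range_subset_iff]
      exact fun ρ => Submodule.subset_span ⟨Sum.inr (Sum.inr (ρ, j)), rfl⟩
    exact fun a ha => h ha

/-- The labels `ΩX` on every even layer enlarge the span of `ΓX` to the full group `dualSymX`. -/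
theorem span_range_sectorX {mX : ℕ} {ΩX : Fin mX → Bits Q'}
    (hΩX : IsNonlocalGenerators P.dualSymX P.ΓX ΩX) :
    Submodule.span (ZMod 2) (Set.range (P.sectorX ΩX K)) = P.suspGroup K P.dualSymX := by
  refine le_antisymm ?_ (P.suspGroup_le (fun i j => ?_) (fun s j => ?_) fun j => ?_)
  · rw [Submodule.span_le, Set.range_subset_iff]
    rintro ((⟨i, j⟩ | ⟨s, j⟩ | ⟨ρ, j⟩) | ⟨j, k⟩)
    · exact P.suspX_mem_suspGroup i j
    · exact P.onOdd_mem_suspGroup j (Submodule.subset_span ⟨s, rfl⟩)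
    · exact P.onEven_mem_suspGroup j (P.ΓX_mem ρ)
    · exact P.onEven_mem_suspGroup j (hΩX.mem k)
  · exact Submodule.subset_span ⟨Sum.inl (Sum.inl (i, j)), rfl⟩
  · exact Submodule.subset_span ⟨Sum.inl (Sum.inr (Sum.inl (s, j))), rfl⟩
  · have h : P.dualSymX ≤
        (Submodule.span (ZMod 2) (Set.range (P.sectorX ΩX K))).comap (onEvenₗ j) := by
      rw [← span_sup_span_of_isNonlocalGenerators hΩX P.ΓX_mem]
      refine sup_le ?_ ?_
      · rw [Submodule.span_le, Set.range_subset_iff]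
        exact fun ρ => Submodule.subset_span ⟨Sum.inl (Sum.inr (Sum.inr (ρ, j))), rfl⟩
      · rw [Submodule.span_le, Set.range_subset_iff]
        exact fun k => Submodule.subset_span ⟨Sum.inr (j, k), rfl⟩
    exact fun a ha => h ha

theorem bulkX_mem_suspGroup (k) : P.bulkX K k ∈ P.suspGroup K P.dualSymX :=
  P.suspGroup_mono P.span_ΓX_le_dualSymX
    (span_range_bulkX (P := P) ▸ Submodule.subset_span ⟨k, rfl⟩)

theorem sectorX_mem_suspGroup {mX : ℕ} {ΩX : Fin mX → Bits Q'}
    (hΩX : IsNonlocalGenerators P.dualSymX P.ΓX ΩX) (k) :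
    P.sectorX ΩX K k ∈ P.suspGroup K P.dualSymX :=
  span_range_sectorX (P := P) hΩX ▸ Submodule.subset_span ⟨k, rfl⟩

/-! ### Operators that commute with the stabilizers -/

theorem exists_oddPart_suspMap (u : Fin (K + 1) → I → ZMod 2) (i : Fin (K + 2)) :
    ∃ v, oddPart i (P.suspMap K u) = P.prodOX v := by
  rcases odd_layer_cases i with rfl | rfl | ⟨j, rfl⟩
  · exact ⟨_, P.oddPart_zero_suspMap u⟩
  · exact ⟨_, P.oddPart_last_suspMap u⟩
  · exact ⟨_, by rw [P.oddPart_internal_suspMap, ← map_add]⟩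

theorem symmetries_le_of_isNonlocalGenerators {N ι : Type*} [Fintype N] {n : ℕ}
    {S : Submodule (ZMod 2) (Bits N)} {G : ι → Bits N} {U : Fin n → Bits N}
    (h : IsNonlocalGenerators S G U) {x : Bits N} (hG : x ∈ symmetries G)
    (hU : x ∈ symmetries U) {b : Bits N} (hb : b ∈ S) : b ⬝ᵥ x = 0 := by
  have h1 := h.maximal hb
  rw [← Submodule.span_union] at h1
  refine dotProduct_eq_zero_of_mem_span h1 ?_
  rintro _ (⟨k, rfl⟩ | ⟨k, rfl⟩)
  · rw [dotProduct_comm]; exact hG k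
  · rw [dotProduct_comm]; exact hU k

variable {nZ mZ : ℕ} {UZ : Fin nZ → Bits Q} {ΩZ : Fin mZ → Bits Q'} {l : Fin (K + 1)}

/-- Overlapping suspensions of opposite type meet on two adjacent layers, at a pair of terms and at
the pair of their duals, so the two signs cancel. The remaining cases are commutation of symmetries
with terms and compatibility of symmetries. -/
theorem suspGroup_dualSymX_le (hUZ : ∀ k, UZ k ∈ P.symZ) (hΩZ : ∀ k, ΩZ k ∈ P.dualSymZ) :
    P.suspGroup K P.dualSymX ≤ symmetries (P.sectorZ UZ ΩZ K l) := by
  have hDX : ∀ b ∈ P.dualSymZ, ∀ u, P.prodDX u ⬝ᵥ b = 0 := fun b hb u => by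
    rw [dotProduct_comm, prodDX_apply, dotProduct_sum]
    refine Finset.sum_eq_zero fun i _ => ?_
    rw [dotProduct_smul, hb.1 i, smul_zero]
  refine sup_le ?_ ?_
  · rintro _ ⟨u, rfl⟩
    refine mem_symmetries_sectorZ.2 ⟨mem_symmetries_bulkZ.2 ⟨fun α j => ?_, fun i r => ?_,
      fun j σ => ?_⟩, fun k => ?_, fun j k => ?_⟩
    · rw [evenPart_suspMap, evenPart_suspMap, oddPart_internal_suspMap, dotProduct_prodDX,
        dotProduct_prodDX, dotProduct_add, ← add_assoc, add_self_eq_zero_of_zmod_two, zero_add,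
        add_self_eq_zero_of_zmod_two]
    · obtain ⟨v, hv⟩ := P.exists_oddPart_suspMap u i
      rw [hv]
      exact P.prodOX_dotProduct_of_mem_symZ (P.GZ_mem r) v
    · rw [evenPart_suspMap]
      exact hDX _ (P.ΓZ_mem σ) _
    · rw [evenPart_suspMap]
      exact hDX _ (hΩZ k) _
    · obtain ⟨v, hv⟩ := P.exists_oddPart_suspMap u j.succ.castSucc
      rw [hv]
      exact P.prodOX_dotProduct_of_mem_symZ (hUZ k) v
  · intro x hx
    rw [mem_layerGroup] at hx
    have h1 : ∀ j, oddPart j x ∈ P.symX := fun j => P.span_GX_le_symX (hx.1 j)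
    refine mem_symmetries_sectorZ.2 ⟨mem_symmetries_bulkZ.2 ⟨fun α j => ?_, fun i r => ?_,
      fun j σ => ?_⟩, fun k => ?_, fun j k => ?_⟩
    · rw [dotProduct_comm, hx.2, dotProduct_comm, (h1 _).1, dotProduct_comm, hx.2]
      simp
    · exact (h1 i).2 ⟨_, P.GZ_mem r⟩
    · rw [dotProduct_comm]
      exact (P.ΓZ_mem σ).2 ⟨_, hx.2 j⟩
    · rw [dotProduct_comm]
      exact (hΩZ k).2 ⟨_, hx.2 l⟩
    · exact (h1 _).2 ⟨_, hUZ k⟩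

/-- The `X`-type operators that commute with the `Z`-type labels of the sectors are generated by
the `X`-type labels and by operators on the first and on the last layer. -/
theorem symmetries_sectorZ (hUZ : IsNonlocalGenerators P.symZ P.GZ UZ)
    (hΩZ : IsNonlocalGenerators P.dualSymZ P.ΓZ ΩZ) :
    symmetries (P.sectorZ UZ ΩZ K l) =
      P.gaugePairs.map (onEnds Q Q' K) ⊔ P.suspGroup K P.dualSymX := by
  refine le_antisymm ?_ (sup_le ?_ (suspGroup_dualSymX_le hUZ.mem hΩZ.mem))
  swap
  · rintro _ ⟨y, hy, rfl⟩
    exact onEnds_mem_symmetries_sectorZ hy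
  intro x hx
  obtain ⟨hbulk, hl, hint⟩ := mem_symmetries_sectorZ.1 hx
  obtain ⟨hsusp, hodd, heven⟩ := mem_symmetries_bulkZ.1 hbulk
  -- On an internal odd layer, the bulk terms `GZ` and the labels `UZ` together force commutation
  -- with all of `symZ`.
  have h1 : ∀ j : Fin K, ∃ v, P.prodOX v = oddPart j.succ.castSucc x := fun j =>
    P.exists_prodOX_eq fun b hb => by
      rw [dotProduct_comm]
      exact symmetries_le_of_isNonlocalGenerators hUZ (hodd _) (hint j) hb
  choose v hv using h1
  -- Discrete integration: suspensions with coefficients `w` reproduce `x` on the internal odd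
  -- layers. The starting value `0` is arbitrary, because a common shift of all `w j` cancels there.
  obtain ⟨w, hw⟩ : ∃ w : Fin (K + 1) → I → ZMod 2, ∀ j : Fin K, w j.succ = w j.castSucc + v j :=
    ⟨Fin.induction 0 fun j a => a + v j, fun j => Fin.induction_succ _ _ _⟩
  have h2 : ∀ b ∈ P.dualSymZ, b ⬝ᵥ (evenPart l x + P.prodDX (w l)) = 0 := by
    intro b hb
    rw [dotProduct_add, symmetries_le_of_isNonlocalGenerators hΩZ (heven l) hl hb, zero_add,
      prodDX_apply, dotProduct_sum]
    refine Finset.sum_eq_zero fun i _ => ?_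
    rw [dotProduct_smul, hb.1 i, smul_zero]
  -- The integration constant is fixed on the layer `l` that carries the labels `ΩZ`. The Ising
  -- suspensions then propagate membership in `dualSymX` to all even layers, which is why a single
  -- layer of labels suffices.
  obtain ⟨u₀, hu₀⟩ := P.exists_add_prodDX_mem_dualSymX h2
  let u : Fin (K + 1) → I → ZMod 2 := fun j => w j + u₀
  have h3 : ∀ j : Fin K, (evenPart j.castSucc x + P.prodDX (u j.castSucc)) +
      (evenPart j.succ x + P.prodDX (u j.succ)) ∈ P.dualSymX := by
    intro j α
    have h0 : (2 : ZMod 2) = 0 := rfl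
    have h4 := hsusp α j
    rw [← hv, ← P.dotProduct_prodDX] at h4
    simp only [u, hw, map_add]
    rw [dotProduct_comm]
    simp only [dotProduct_add]
    linear_combination (P.DZ α ⬝ᵥ P.prodDX (w j.castSucc)) * h0 +
      (P.DZ α ⬝ᵥ P.prodDX u₀) * h0 + h4
  have h5 : ∀ j, (evenPart l x + P.prodDX (u l)) + (evenPart j x + P.prodDX (u j)) ∈
      P.dualSymX := by
    have h6 : ∀ j, (evenPart 0 x + P.prodDX (u 0)) + (evenPart j x + P.prodDX (u j)) ∈
        P.dualSymX := by
      intro j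
      induction j using Fin.induction with
      | zero => rw [add_self_eq_zero_of_zmod_two]; exact Submodule.zero_mem _
      | succ j ih =>
        have h7 := Submodule.add_mem _ ih (h3 j)
        rwa [← add_assoc, add_add_cancel_of_zmod_two] at h7
    intro j
    have h7 := Submodule.add_mem _ (h6 l) (h6 j)
    rwa [add_comm (evenPart 0 x + _), ← add_assoc, add_add_cancel_of_zmod_two] at h7
  have hul : evenPart l x + P.prodDX (u l) ∈ P.dualSymX := by
    simp only [u, map_add, ← add_assoc]
    exact hu₀
  have h8 : ∀ j, evenPart j x + P.prodDX (u j) ∈ P.dualSymX := by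
    intro j
    have h9 := Submodule.add_mem _ (h5 j) hul
    rwa [add_comm (evenPart l x + _), add_add_cancel_of_zmod_two] at h9
  -- What the suspensions leave over on the first and the last layer.
  let y : Bits Q × Bits Q := (oddPart 0 x + P.prodOX (u 0),
    oddPart (Fin.last (K + 1)) x + P.prodOX (u (Fin.last K)))
  have hy : y ∈ P.gaugePairs :=
    ⟨Submodule.add_mem _ (hodd _) (P.prodOX_mem_symmetries_GZ _),
      Submodule.add_mem _ (hodd _) (P.prodOX_mem_symmetries_GZ _)⟩
  rw [← add_add_cancel_of_zmod_two x (onEnds Q Q' K y), add_comm _ (onEnds Q Q' K y)]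
  refine Submodule.add_mem_sup ⟨y, hy, rfl⟩ ?_
  rw [mem_suspGroup]
  refine ⟨u, mem_layerGroup.2 ⟨fun i => ?_, fun j => ?_⟩⟩
  · rw [map_add, map_add]
    rcases odd_layer_cases i with rfl | rfl | ⟨j, rfl⟩
    · rw [oddPart_zero_onEnds, oddPart_zero_suspMap, add_right_comm, add_self_eq_zero_of_zmod_two]
      exact Submodule.zero_mem _
    · rw [oddPart_last_onEnds, oddPart_last_suspMap, add_right_comm, add_self_eq_zero_of_zmod_two]
      exact Submodule.zero_mem _
    · rw [oddPart_internal_onEnds, oddPart_internal_suspMap, add_zero, ← map_add, ← hv, ← map_add]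
      simp only [u, hw]
      have h9 : v j + (w j.castSucc + u₀ + (w j.castSucc + v j + u₀)) = 0 := by
        rw [add_add_add_comm, ← add_assoc (w _), add_self_eq_zero_of_zmod_two, zero_add,
          add_self_eq_zero_of_zmod_two, add_zero, add_self_eq_zero_of_zmod_two]
      rw [h9, map_zero]
      exact Submodule.zero_mem _
  · rw [map_add, map_add, evenPart_onEnds, add_zero, evenPart_suspMap]
    exact h8 j

theorem ZVec_dotProduct_of_mem_suspGroup {x : Bits (Stack Q Q' K)}
    (hx : x ∈ P.suspGroup K P.dualSymX) (α : A) :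
    P.firstZVec K α ⬝ᵥ x = 0 ∧ P.lastZVec K α ⬝ᵥ x = 0 := by
  rw [firstZVec_dotProduct, lastZVec_dotProduct]
  rw [suspGroup, Submodule.mem_sup] at hx
  obtain ⟨_, ⟨u, rfl⟩, z, hz, rfl⟩ := hx
  rw [mem_layerGroup] at hz
  have h1 : ∀ j, P.OZ α ⬝ᵥ oddPart j z = 0 := fun j => by
    rw [dotProduct_comm]; exact (P.span_GX_le_symX (hz.1 j)).1 α
  have h2 : ∀ j, P.DZ α ⬝ᵥ evenPart j z = 0 := fun j => by
    rw [dotProduct_comm]; exact hz.2 j α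
  simp only [map_add, oddPart_zero_suspMap, oddPart_last_suspMap, evenPart_suspMap,
    dotProduct_add, h1, h2, dotProduct_prodDX, add_zero, add_self_eq_zero_of_zmod_two, and_self]

end DualPair

namespace DualPair

/-! ### Signs in the sectors -/

variable {Q Q' A I ιr ιs ιρ ισ : Type*} [Fintype Q] [Fintype Q']
variable {P : DualPair Q Q' A I ιr ιs ιρ ισ} {K : ℕ}
variable {nZ mX mZ : ℕ} {UZ : Fin nZ → Bits Q} {ΩX : Fin mX → Bits Q'}
  {ΩZ : Fin mZ → Bits Q'} {l : Fin (K + 1)}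

/-- The eigenvalues of the `Z`-type operators in a sector. -/
def labelZ (A ιr ισ : Type*) (t : SectorLabel K nZ mX mZ) :
    ((A × Fin K) ⊕ (ιr × Fin (K + 2)) ⊕ (ισ × Fin (K + 1))) ⊕ (Fin mZ ⊕ (Fin K × Fin nZ)) → ℤˣ :=
  Sum.elim 1 (Sum.elim t.dualZ fun p => t.origZ p.1 p.2)

/-- The eigenvalues of the `X`-type operators in a sector. -/
def labelX (I ιs ιρ : Type*) (t : SectorLabel K nZ mX mZ) :
    ((I × Fin (K + 1)) ⊕ (ιs × Fin (K + 2)) ⊕ (ιρ × Fin (K + 1))) ⊕ (Fin (K + 1) × Fin mX) → ℤˣ :=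
  Sum.elim 1 fun p => t.dualX p.1 p.2

theorem labelZ_trivial : labelZ A ιr ισ (SectorLabel.trivial K nZ mX mZ) = 1 := by
  funext k
  rcases k with k | k | k <;> rfl

theorem labelX_trivial : labelX I ιs ιρ (SectorLabel.trivial K nZ mX mZ) = 1 := by
  funext k
  rcases k with k | k <;> rfl

theorem mem_symmetries_bulkZ_of_bitSign_eq {t : SectorLabel K nZ mX mZ} {x : Bits (Stack Q Q' K)}
    (hx : ∀ k, bitSign (P.sectorZ UZ ΩZ K l k ⬝ᵥ x) = labelZ A ιr ισ t k) :
    x ∈ symmetries (P.bulkZ K) := fun k => by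
  rw [dotProduct_comm]
  exact bitSign_injective ((hx (Sum.inl k)).trans bitSign_zero.symm)

/-- In a nonzero sector there is a basis state on which the two Ising boundary terms agree. -/
theorem exists_sectorZ_sign {t : SectorLabel K nZ mX mZ} {x : Bits (Stack Q Q' K)}
    (hx : ∀ k, bitSign (P.sectorZ UZ ΩZ K l k ⬝ᵥ x) = labelZ A ιr ισ t k) :
    ∃ a, (∀ k, bitSign (P.sectorZ UZ ΩZ K l k ⬝ᵥ a) = labelZ A ιr ισ t k) ∧
      ∀ α, P.firstZVec K α ⬝ᵥ a = P.lastZVec K α ⬝ᵥ a := by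
  have hxb := mem_symmetries_bulkZ_of_bitSign_eq hx
  have hsum : ∑ j, oddPart j x ∈ symmetries P.GZ :=
    Submodule.sum_mem _ fun j _ => (mem_symmetries_bulkZ.1 hxb).2.1 j
  have hy : ((∑ j, oddPart j x, 0) : Bits Q × Bits Q) ∈ P.gaugePairs :=
    ⟨hsum, Submodule.zero_mem _⟩
  -- The discrepancy between the two Ising signs is that of `OZ α` on the sum of all odd layers.
  -- Adding this sum to the first layer alone removes it without changing any label.
  refine ⟨x + onEnds Q Q' K (∑ j, oddPart j x, 0), fun k => ?_,
    fun α => eq_of_add_eq_zero_of_zmod_two ?_⟩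
  · have h1 := onEnds_mem_symmetries_sectorZ (UZ := UZ) (ΩZ := ΩZ) (l := l) hy k
    rw [dotProduct_comm] at h1
    rw [dotProduct_add, h1, add_zero, hx]
  · rw [dotProduct_add, dotProduct_add, (ZVec_dotProduct_onEnds _ α).1,
      (ZVec_dotProduct_onEnds _ α).2, dotProduct_zero, add_zero, add_right_comm,
      firstZVec_dotProduct_add_lastZVec_dotProduct hxb, add_self_eq_zero_of_zmod_two]

variable [Fintype I]

theorem sectorZ_dotProduct_sectorX (hUZ : IsNonlocalGenerators P.symZ P.GZ UZ)
    (hΩX : IsNonlocalGenerators P.dualSymX P.ΓX ΩX)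
    (hΩZ : IsNonlocalGenerators P.dualSymZ P.ΓZ ΩZ) (k k') :
    P.sectorZ UZ ΩZ K l k ⬝ᵥ P.sectorX ΩX K k' = 0 := by
  rw [dotProduct_comm]
  exact suspGroup_dualSymX_le hUZ.mem hΩZ.mem (sectorX_mem_suspGroup hΩX k') k

theorem bulkZ_dotProduct_bulkX (k k') : P.bulkZ K k ⬝ᵥ P.bulkX K k' = 0 := by
  rw [dotProduct_comm]
  -- With empty families of labels, the statement about sectors is one about the bulk terms.
  have h := suspGroup_dualSymX_le (P := P) (UZ := Fin.elim0) (ΩZ := Fin.elim0)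
    (l := (0 : Fin (K + 1))) (fun k => k.elim0) (fun k => k.elim0)
    (bulkX_mem_suspGroup k')
  exact h (Sum.inl k)

/-- In a nonzero sector the signs of the `X`-type operators extend trivially to the
transverse-field terms on the last layer. -/
theorem exists_sectorX_sign (hΩX : IsNonlocalGenerators P.dualSymX P.ΓX ΩX)
    {t : SectorLabel K nZ mX mZ} {w : Bits (Stack Q Q' K)}
    (hw : ∀ k, bitSign (w ⬝ᵥ P.sectorX ΩX K k) = labelX I ιs ιρ t k) :
    ∃ b, (∀ k, bitSign (b ⬝ᵥ P.sectorX ΩX K k) = labelX I ιs ιρ t k) ∧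
      ∀ i, b ⬝ᵥ onOdd (Fin.last (K + 1)) (P.OX i) = 0 := by
  obtain ⟨b, hb, hb'⟩ := exists_dotProduct_eq_of_inf (E := P.suspGroup K P.dualSymX)
    (L := LinearMap.range (onOddₗ (Fin.last (K + 1)) ∘ₗ P.prodOX)) w (by
      rintro _ ⟨hE, ⟨u, rfl⟩⟩
      -- The prescription `w` on the stabilizers is compatible with `0` on the last layer: a common
      -- element is a pair `(0, prodOX u)` in `ficGroup`, so `prodOX u` is in the span of `GX`,
      -- where the bulk eigenvalues are `+1`.
      have h1 : ((0, P.prodOX u) : Bits Q × Bits Q) ∈ P.ficGroup := by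
        rw [← P.gaugePairs_inf_comap_suspGroup_dualSymX (K := K)]
        refine ⟨⟨Submodule.zero_mem _, P.prodOX_mem_symmetries_GZ u⟩, ?_⟩
        rw [SetLike.mem_coe, Submodule.mem_comap, onEnds_right]
        exact hE
      have h2 := (P.mem_ficGroup.1 h1).2
      rw [zero_add] at h2
      rw [LinearMap.comp_apply, onOddₗ_apply, dotProduct_onOdd]
      refine dotProduct_eq_zero_of_mem_span_right h2 ?_
      rintro _ ⟨s, rfl⟩
      rw [← dotProduct_onOdd]
      exact bitSign_injective (hw (Sum.inl (Sum.inr (Sum.inl (s, Fin.last (K + 1)))))))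
  refine ⟨b, fun k => ?_, fun i => ?_⟩
  · rw [hb _ (sectorX_mem_suspGroup hΩX k), hw]
  · classical
    refine hb' _ ⟨Pi.single i 1, ?_⟩
    simp [prodOX, onOddₗ_apply]

end DualPair

/-- Some `b'` is orthogonal to all `x k` but not to `v`. Adding it to `b` flips the sign of `v`
alone, so either sign of `v` is consistent with the given eigenvalues. -/
theorem exists_mem_stabSpace_pauliX_eq {Q κ κ' : Type*} [Fintype Q] [DecidableEq Q]
    {z : κ → Bits Q} {s : κ → ℤˣ} {x : κ' → Bits Q} {s' : κ' → ℤˣ}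
    (hzx : ∀ k k', z k ⬝ᵥ x k' = 0) (h : stabSpace z s x s' ≠ ⊥) {v : Bits Q}
    (hv : ∀ k, z k ⬝ᵥ v = 0) (hvx : v ∉ Submodule.span (ZMod 2) (Set.range x)) (u : ℤˣ) :
    ∃ ψ ∈ stabSpace z s x s', ψ ≠ 0 ∧ pauliX v ψ = sgn u • ψ := by
  obtain ⟨⟨a, ha⟩, ⟨b, hb⟩⟩ := exists_signs_of_stabSpace_ne_bot h
  obtain ⟨b', hb', hb'v⟩ : ∃ b', (∀ k, x k ⬝ᵥ b' = 0) ∧ v ⬝ᵥ b' ≠ 0 := by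
    by_contra! h'
    exact hvx (mem_span_of_forall_dotProduct_eq_zero x v h')
  replace hb'v := (zmod_two_eq_zero_or_one _).resolve_left hb'v
  obtain ⟨w, hw, hwv⟩ : ∃ w, (∀ k, bitSign (w ⬝ᵥ x k) = s' k) ∧ bitSign (w ⬝ᵥ v) = u := by
    by_cases hu : bitSign (b ⬝ᵥ v) = u
    · exact ⟨b, hb, hu⟩
    · refine ⟨b + b', fun k => ?_, ?_⟩
      · rw [add_dotProduct, dotProduct_comm b', hb', add_zero, hb]
      · rw [add_dotProduct, dotProduct_comm b', hb'v, bitSign_add, bitSign_one, mul_neg_one]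
        exact (Int.units_ne_iff_eq_neg.1 (Ne.symm hu)).symm
  have h1 : stabSpace z s (Sum.elim x fun _ : Unit => v) (Sum.elim s' fun _ => u) ≠ ⊥ := by
    refine stabSpace_ne_bot (a := a) (b := w) ?_ ha ?_
    · rintro k (k' | _)
      exacts [hzx k k', hv k]
    · rintro (k | _)
      exacts [hw k, hwv]
  obtain ⟨ψ, hψ, h0⟩ := Submodule.exists_mem_ne_zero_of_ne_bot h1
  rw [mem_stabSpace] at hψ
  exact ⟨ψ, mem_stabSpace.2 ⟨hψ.1, fun k => hψ.2 (Sum.inl k)⟩, h0, hψ.2 (Sum.inr ())⟩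

namespace DualPair

variable {Q Q' A I ιr ιs ιρ ισ : Type*} [Fintype Q] [DecidableEq Q] [Fintype Q']
variable {P : DualPair Q Q' A I ιr ιs ιρ ισ}

/-! ### Two copies of the model -/

theorem gaugeSpace_eq_stabSpace : P.gaugeSpace = stabSpace P.GZ 1 P.GX 1 := by
  simp [gaugeSpace, stabSpace]

theorem mem_twoCopies_iff {ψ : Hilb Q ⊗[ℂ] Hilb Q} :
    ψ ∈ P.twoCopies ↔ tensorFun Q ψ ∈ codeSpace 0 P.gaugePairs
      ((Submodule.span (ZMod 2) (Set.range P.GX)).prod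
        (Submodule.span (ZMod 2) (Set.range P.GX))) := by
  rw [twoCopies, gaugeSpace_eq_stabSpace, stabSpace_one_eq_codeSpace,
    mem_range_mapIncl_codeSpace (P.span_GX_le_symX.trans P.symX_le_symmetries_GZ)]
  rfl

/-- The decomposition `(y₁, y₂) = (y₁, y₁) + (0, y₁ + y₂)` shows that the diagonal pairs of `UX` and
the pairs from the span of `GX` generate `ficGroup`. -/
theorem mem_ficSpace_iff {n : ℕ} {UX : Fin n → Bits Q}
    (hUX : IsNonlocalGenerators P.symX P.GX UX) {ψ : Hilb Q ⊗[ℂ] Hilb Q} :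
    ψ ∈ P.ficSpace UX ↔ tensorFun Q ψ ∈ codeSpace 0 P.gaugePairs P.ficGroup := by
  have h1 : ∀ k, TensorProduct.map (pauliX (UX k)) (pauliX (UX k)) ψ = ψ ↔
      (UX k, UX k) ∈ translationInvariants (tensorFun Q ψ) := by
    intro k
    rw [mem_translationInvariants, ← (tensorFun Q).injective.eq_iff]
    simp only [← tensorFun_map_pauliX]
    exact ⟨fun h x => by rw [h], fun h => by ext x; exact h x⟩
  have h2 : ψ ∈ P.ficSpace UX ↔ ψ ∈ P.twoCopies ∧
      ∀ k, (UX k, UX k) ∈ translationInvariants (tensorFun Q ψ) := by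
    simp only [← h1]
    simp [ficSpace, Submodule.mem_iInf]
  rw [h2, mem_twoCopies_iff, mem_codeSpace_iff_le, mem_codeSpace_iff_le, and_assoc]
  refine and_congr_right fun _ => ⟨?_, fun h => ⟨?_, fun k => ?_⟩⟩
  · rintro ⟨hG, hU⟩ y hy
    obtain ⟨⟨hy1, hy2⟩, hy3⟩ := P.mem_ficGroup.1 hy
    let δ : Bits Q →ₗ[ZMod 2] Bits Q × Bits Q := LinearMap.prod LinearMap.id LinearMap.id
    have h3 : P.symX ≤ (translationInvariants (tensorFun Q ψ)).comap δ := by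
      rw [← span_sup_span_of_isNonlocalGenerators hUX P.GX_mem]
      refine sup_le (fun g hg => hG ⟨hg, hg⟩) ?_
      rw [Submodule.span_le, Set.range_subset_iff]
      exact hU
    have h4 : y = δ y.1 + (0, y.1 + y.2) := by
      refine Prod.ext (add_zero _).symm ?_
      change y.2 = y.1 + (y.1 + y.2)
      rw [← add_assoc, add_self_eq_zero_of_zmod_two, zero_add]
    rw [h4]
    exact Submodule.add_mem _ (h3 hy1) (hG ⟨Submodule.zero_mem _, hy3⟩)
  · refine le_trans (fun y hy => P.mem_ficGroup.2 ⟨⟨P.span_GX_le_symX hy.1,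
      P.span_GX_le_symX hy.2⟩, Submodule.add_mem _ hy.1 hy.2⟩) h
  · refine h (P.mem_ficGroup.2 ⟨⟨hUX.mem k, hUX.mem k⟩, ?_⟩)
    rw [add_self_eq_zero_of_zmod_two]
    exact Submodule.zero_mem _

variable {K : ℕ}

/-- Common to the sectors and to the unconstrained pieces, which differ in `E` and `S`. The
condition `hx₀` on the base point makes the Ising signs trivial. -/
theorem isTwoCopies_codeSpace [DecidableEq Q'] [Fintype I] {F : Submodule ℂ (Hilb Q ⊗[ℂ] Hilb Q)}
    {S : Submodule (ZMod 2) (Bits Q × Bits Q)}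
    (hF : ∀ ψ, ψ ∈ F ↔ tensorFun Q ψ ∈ codeSpace 0 P.gaugePairs S)
    {x₀ : Bits (Stack Q Q' K)} {D E : Submodule (ZMod 2) (Bits (Stack Q Q' K))}
    (hD : D = P.gaugePairs.map (onEnds Q Q' K) ⊔ E)
    (hS : P.gaugePairs ⊓ E.comap (onEnds Q Q' K) = S)
    (hE : E ≤ P.suspGroup K P.dualSymX)
    (hx₀ : ∀ α, P.firstZVec K α ⬝ᵥ x₀ = 0 ∧ P.lastZVec K α ⬝ᵥ x₀ = 0) :
    P.IsTwoCopies K (codeSpace x₀ D E) F 1 1 1 1 := by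
  classical
  obtain ⟨e, heX, heZ⟩ := exists_codeSpace_equiv_tensor F P.gaugePairs S hF (onEnds Q Q' K) x₀ D E
    hD hS
  have hOX : ∀ i, P.OX i ∈ symmetries P.GZ := fun i r => by
    rw [dotProduct_comm]
    exact P.GZ_mem r i
  refine ⟨e, fun i => ?_, fun i => ?_, fun α => ?_, fun α => ?_⟩
  · have h := heX (P.OX i, 0) ⟨hOX i, Submodule.zero_mem _⟩
    rw [onEnds_left, pauliX_zero] at h
    rw [Pi.one_apply, sgn_one, one_smul]
    exact h
  · have h := heX (0, P.OX i) ⟨Submodule.zero_mem _, hOX i⟩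
    rw [onEnds_right, pauliX_zero] at h
    rw [Pi.one_apply, sgn_one, one_smul]
    exact h
  · have h := heZ (P.firstZVec K α) (P.OZ α) 0
      (fun x hx => (ZVec_dotProduct_of_mem_suspGroup (hE hx) α).1)
      (fun y _ => by rw [(ZVec_dotProduct_onEnds y α).1, zero_dotProduct, add_zero])
    rw [(hx₀ α).1, bitSign_zero, pauliZ_zero] at h
    exact h
  · have h := heZ (P.lastZVec K α) 0 (P.OZ α)
      (fun x hx => (ZVec_dotProduct_of_mem_suspGroup (hE hx) α).2)
      (fun y _ => by rw [(ZVec_dotProduct_onEnds y α).2, zero_dotProduct, zero_add])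
    rw [(hx₀ α).2, bitSign_zero, pauliZ_zero] at h
    exact h

/-! ### The boundary space and its sectors -/

section Sectors

variable {nZ nX mX mZ : ℕ} {UZ : Fin nZ → Bits Q} {UX : Fin nX → Bits Q} {ΩX : Fin mX → Bits Q'}
  {ΩZ : Fin mZ → Bits Q'} {l : Fin (K + 1)}

/-- A pair of copies in a joint eigenspace, up to the signs of a Pauli operator. -/
theorem IsTwoCopies.of_stabSpace_one [DecidableEq Q'] {κ κ' : Type*}
    {z : κ → Bits (Stack Q Q' K)}
    {s : κ → ℤˣ} {x : κ' → Bits (Stack Q Q' K)} {s' : κ' → ℤˣ}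
    {F : Submodule ℂ (Hilb Q ⊗[ℂ] Hilb Q)} (h : P.IsTwoCopies K (stabSpace z 1 x 1) F 1 1 1 1)
    {a b : Bits (Stack Q Q' K)} (ha : ∀ k, bitSign (z k ⬝ᵥ a) = s k)
    (hb : ∀ k, bitSign (b ⬝ᵥ x k) = s' k)
    (hfirst : ∀ i k, z k ⬝ᵥ onOdd 0 (P.OX i) = 0)
    (hlast : ∀ i k, z k ⬝ᵥ onOdd (Fin.last (K + 1)) (P.OX i) = 0)
    (hfirst' : ∀ α k, P.firstZVec K α ⬝ᵥ x k = 0) (hlast' : ∀ α k, P.lastZVec K α ⬝ᵥ x k = 0) :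
    P.IsTwoCopies K (stabSpace z s x s') F (fun i => bitSign (b ⬝ᵥ onOdd 0 (P.OX i)))
      (fun i => bitSign (b ⬝ᵥ onOdd (Fin.last (K + 1)) (P.OX i)))
      (fun α => bitSign (P.firstZVec K α ⬝ᵥ a)) (fun α => bitSign (P.lastZVec K α ⬝ᵥ a)) := by
  obtain ⟨e, he1, he2, he3, he4⟩ := h
  simp only [Pi.one_apply, sgn_one, one_smul] at he1 he2 he3 he4
  refine ⟨(stabSpaceEquiv ha hb).trans e, fun i => ?_, fun i => ?_, fun α => ?_, fun α => ?_⟩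
  · exact (carries_stabSpaceEquiv_pauliX ha hb (hfirst i)).trans ((he1 i).smul _)
  · exact (carries_stabSpaceEquiv_pauliX ha hb (hlast i)).trans ((he2 i).smul _)
  · exact (carries_stabSpaceEquiv_pauliZ ha hb (hfirst' α)).trans ((he3 α).smul _)
  · exact (carries_stabSpaceEquiv_pauliZ ha hb (hlast' α)).trans ((he4 α).smul _)

variable [Fintype I] [DecidableEq Q'] [Fintype A] [Fintype ιr] [Fintype ιs] [Fintype ιρ]
  [Fintype ισ]

theorem bdrySpace_eq_stabSpace :
    P.bdrySpace K = stabSpace (P.bulkZ K) 1 (P.bulkX K) 1 := by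
  obtain ⟨ψ₀, hψ₀, h0⟩ := Submodule.exists_mem_ne_zero_of_ne_bot
    (stabSpace_one_ne_bot (bulkZ_dotProduct_bulkX (P := P) (K := K)))
  let T := Sum.elim (fun k => pauliZ (P.bulkZ K k)) (fun k => pauliX (P.bulkX K k))
  have hT : P.bulkHamiltonian K = -∑ k, T k := by
    simp only [T, Fintype.sum_sum_type, Sum.elim_inl, Sum.elim_inr, bulkHamiltonian, bulkZ, bulkX,
      Fintype.sum_prod_type]
    abel
  have hmem : ∀ ψ, ψ ∈ stabSpace (P.bulkZ K) 1 (P.bulkX K) 1 ↔ ∀ k, T k ψ = ψ := by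
    intro ψ
    rw [mem_stabSpace, Sum.forall]
    simp [T]
  ext ψ
  rw [hmem, bdrySpace, hT]
  refine groundSpace_neg_sum T ?_ h0 ((hmem ψ₀).1 hψ₀) ψ
  rintro (k | k) φ
  exacts [norm_pauliZ _ _, norm_pauliX _ _]

theorem bdrySpace_eq_codeSpace :
    P.bdrySpace K = codeSpace 0 (symmetries (P.bulkZ K))
      (P.suspGroup K (Submodule.span (ZMod 2) (Set.range P.ΓX))) := by
  rw [bdrySpace_eq_stabSpace, stabSpace_one_eq_codeSpace, span_range_bulkX]

theorem sector_eq_stabSpace (t : SectorLabel K nZ mX mZ) :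
    P.sector UZ ΩX ΩZ K l t =
      stabSpace (P.sectorZ UZ ΩZ K l) (labelZ A ιr ισ t) (P.sectorX ΩX K) (labelX I ιs ιρ t) := by
  ext ψ
  rw [sector, bdrySpace_eq_stabSpace, mem_stabSpace]
  simp only [Submodule.mem_inf, mem_stabSpace, Submodule.mem_iInf, Module.End.mem_eigenspace_iff]
  constructor
  · rintro ⟨⟨⟨⟨h1, h2⟩, h3⟩, h4⟩, h5⟩
    refine ⟨?_, ?_⟩
    · rintro (k | k | ⟨j, k⟩)
      exacts [h1 k, h3 k, h4 j k]
    · rintro (k | ⟨j, k⟩)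
      exacts [h2 k, h5 j k]
  · rintro ⟨h1, h2⟩
    exact ⟨⟨⟨⟨fun k => h1 (Sum.inl k), fun k => h2 (Sum.inl k)⟩, fun k => h1 (Sum.inr (Sum.inl k))⟩,
      fun j k => h1 (Sum.inr (Sum.inr (j, k)))⟩, fun j k => h2 (Sum.inr (j, k))⟩

theorem sector_trivial_eq_stabSpace :
    P.sector UZ ΩX ΩZ K l (SectorLabel.trivial K nZ mX mZ) =
      stabSpace (P.sectorZ UZ ΩZ K l) 1 (P.sectorX ΩX K) 1 := by
  rw [sector_eq_stabSpace, labelZ_trivial, labelX_trivial]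

theorem sector_trivial_ne_bot (hUZ : IsNonlocalGenerators P.symZ P.GZ UZ)
    (hΩX : IsNonlocalGenerators P.dualSymX P.ΓX ΩX)
    (hΩZ : IsNonlocalGenerators P.dualSymZ P.ΓZ ΩZ) :
    P.sector UZ ΩX ΩZ K l (SectorLabel.trivial K nZ mX mZ) ≠ ⊥ := by
  rw [sector_trivial_eq_stabSpace]
  exact stabSpace_one_ne_bot (sectorZ_dotProduct_sectorX hUZ hΩX hΩZ)

theorem isTwoCopies_sector_trivial (hUZ : IsNonlocalGenerators P.symZ P.GZ UZ)
    (hUX : IsNonlocalGenerators P.symX P.GX UX)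
    (hΩX : IsNonlocalGenerators P.dualSymX P.ΓX ΩX)
    (hΩZ : IsNonlocalGenerators P.dualSymZ P.ΓZ ΩZ) :
    P.IsTwoCopies K (P.sector UZ ΩX ΩZ K l (SectorLabel.trivial K nZ mX mZ))
      (P.ficSpace UX) 1 1 1 1 := by
  rw [sector_trivial_eq_stabSpace, stabSpace_one_eq_codeSpace, span_range_sectorX hΩX]
  exact isTwoCopies_codeSpace (fun ψ => mem_ficSpace_iff hUX) (symmetries_sectorZ hUZ hΩZ)
    P.gaugePairs_inf_comap_suspGroup_dualSymX le_rfl (fun α => by simp)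

/-- The boundary space is the orthogonal direct sum of its sectors. -/
theorem isOrthogonalSum_sector (hUZ : IsNonlocalGenerators P.symZ P.GZ UZ)
    (hΩX : IsNonlocalGenerators P.dualSymX P.ΓX ΩX)
    (hΩZ : IsNonlocalGenerators P.dualSymZ P.ΓZ ΩZ) :
    IsOrthogonalSum (P.bdrySpace K) (P.sector UZ ΩX ΩZ K l) := by
  have hzx := sectorZ_dotProduct_sectorX (l := l) (K := K) hUZ hΩX hΩZ
  let T : (Fin mZ ⊕ (Fin K × Fin nZ)) ⊕ (Fin (K + 1) × Fin mX) →
      Hilb (Stack Q Q' K) →ₗ[ℂ] Hilb (Stack Q Q' K) :=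
    Sum.elim (fun k => pauliZ (P.sectorZ UZ ΩZ K l (Sum.inr k)))
      (fun k => pauliX (P.sectorX ΩX K (Sum.inr k)))
  have h := isOrthogonalSum_of_involutions (P.bdrySpace K) T
    (by
      rintro (k | k) ψ
      exacts [norm_pauliZ _ _, norm_pauliX _ _])
    (by
      rintro (k | k) ψ
      exacts [pauliZ_pauliZ _ _, pauliX_pauliX _ _])
    (by
      rintro (k | k) (k' | k') ψ
      · exact pauliZ_comm _ _ _
      · simp only [T, Sum.elim_inl, Sum.elim_inr]
        rw [pauliZ_pauliX, hzx, bitSign_zero, sgn_one, one_smul]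
      · simp only [T, Sum.elim_inl, Sum.elim_inr]
        rw [pauliX_pauliZ, hzx, bitSign_zero, sgn_one, one_smul]
      · exact pauliX_comm _ _ _)
    (by
      rw [bdrySpace_eq_stabSpace]
      rintro (k | k) ψ hψ
      · rw [mem_stabSpace] at hψ ⊢
        refine ⟨fun k' => ?_, fun k' => ?_⟩
        · simp only [T, Sum.elim_inl]
          rw [pauliZ_comm, hψ.1, map_smul]
        · simp only [T, Sum.elim_inl]
          rw [pauliX_pauliZ, show _ ⬝ᵥ P.bulkX K k' = 0 from hzx _ (Sum.inl k'), bitSign_zero,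
            sgn_one, one_smul, hψ.2, map_smul]
      · rw [mem_stabSpace] at hψ ⊢
        refine ⟨fun k' => ?_, fun k' => ?_⟩
        · simp only [T, Sum.elim_inr]
          rw [pauliZ_pauliX, show P.bulkZ K k' ⬝ᵥ _ = 0 from hzx (Sum.inl k') _, bitSign_zero,
            sgn_one, one_smul, hψ.1, map_smul]
        · simp only [T, Sum.elim_inr]
          rw [pauliX_comm, hψ.2, map_smul])
  let e : SectorLabel K nZ mX mZ ≃ ((Fin mZ ⊕ (Fin K × Fin nZ)) ⊕ (Fin (K + 1) × Fin mX) → ℤˣ) :=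
    { toFun := fun t => Sum.elim (Sum.elim t.dualZ fun p => t.origZ p.1 p.2)
        fun p => t.dualX p.1 p.2
      invFun := fun s => ⟨fun k => s (Sum.inl (Sum.inl k)), fun j k => s (Sum.inl (Sum.inr (j, k))),
        fun j k => s (Sum.inr (j, k))⟩
      left_inv := fun t => rfl
      right_inv := fun s => by
        funext k
        rcases k with (k | k) | k <;> rfl }
  convert h.comp_equiv e using 1
  funext t
  ext ψ
  rw [sector]
  simp only [Submodule.mem_inf, Submodule.mem_iInf, Module.End.mem_eigenspace_iff, and_assoc]
  refine and_congr_right fun _ => ?_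
  constructor
  · rintro ⟨h3, h4, h5⟩
    rintro ((k | ⟨j, k⟩) | ⟨j, k⟩)
    exacts [h3 k, h4 j k, h5 j k]
  · intro h
    exact ⟨fun k => h (Sum.inl (Sum.inl k)), fun j k => h (Sum.inl (Sum.inr (j, k))),
      fun j k => h (Sum.inr (j, k))⟩

/-- Every nonzero sector is a pair of copies up to signs. -/
theorem exists_isTwoCopies_sector (hUZ : IsNonlocalGenerators P.symZ P.GZ UZ)
    (hUX : IsNonlocalGenerators P.symX P.GX UX)
    (hΩX : IsNonlocalGenerators P.dualSymX P.ΓX ΩX)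
    (hΩZ : IsNonlocalGenerators P.dualSymZ P.ΓZ ΩZ) (t : SectorLabel K nZ mX mZ)
    (ht : P.sector UZ ΩX ΩZ K l t ≠ ⊥) :
    ∃ (ε : I → ℤˣ) (η : A → ℤˣ),
      P.IsTwoCopies K (P.sector UZ ΩX ΩZ K l t) (P.ficSpace UX) ε 1 η η := by
  rw [sector_eq_stabSpace] at ht ⊢
  obtain ⟨⟨x, hx⟩, ⟨w, hw⟩⟩ := exists_signs_of_stabSpace_ne_bot ht
  obtain ⟨a, ha, hZ⟩ := exists_sectorZ_sign hx
  obtain ⟨b, hb, hX⟩ := exists_sectorX_sign hΩX hw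
  have htriv := isTwoCopies_sector_trivial (P := P) (K := K) (l := l) hUZ hUX hΩX hΩZ
  rw [sector_trivial_eq_stabSpace] at htriv
  have hOX : ∀ i, P.OX i ∈ symmetries P.GZ := fun i r => by
    rw [dotProduct_comm]
    exact P.GZ_mem r i
  have hZX : ∀ α k, P.firstZVec K α ⬝ᵥ P.sectorX ΩX K k = 0 ∧
      P.lastZVec K α ⬝ᵥ P.sectorX ΩX K k = 0 := fun α k =>
    ZVec_dotProduct_of_mem_suspGroup (sectorX_mem_suspGroup hΩX k) α
  have h := htriv.of_stabSpace_one ha hb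
    (fun i k => by
      rw [← onEnds_left, dotProduct_comm]
      exact onEnds_mem_symmetries_sectorZ ⟨hOX i, Submodule.zero_mem _⟩ k)
    (fun i k => by
      rw [← onEnds_right, dotProduct_comm]
      exact onEnds_mem_symmetries_sectorZ ⟨Submodule.zero_mem _, hOX i⟩ k)
    (fun α k => (hZX α k).1) (fun α k => (hZX α k).2)
  simp only [hX, hZ] at h
  exact ⟨_, _, h⟩

end Sectors

end DualPair

/-! ### Coset decompositions and products of carried operators -/

theorem exists_apply_ne_zero {N : Type*} [Fintype N] [DecidableEq N] {ψ : Hilb N} (h : ψ ≠ 0) :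
    ∃ x, ψ x ≠ 0 := by
  by_contra! h'
  exact h (by ext x; exact h' x)

/-- A decomposition of a code space by cosets of a smaller support group. -/
theorem exists_isOrthogonalSum_codeSpace {V : Type*} [AddCommGroup V] [Module (ZMod 2) V]
    [Fintype V] {D D₀ E N : Submodule (ZMod 2) V} (hED : E ≤ D₀) (hD : N ⊔ D₀ = D) :
    ∃ (n : ℕ) (x : Fin n → V), (∀ a, x a ∈ N) ∧
      IsOrthogonalSum (codeSpace 0 D E) fun a => codeSpace (x a) D₀ E := by
  classical
  -- One piece for each coset of `D₀` that meets `N`, with its representative chosen in `N`; since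
  -- `N ⊔ D₀ = D`, these cosets cover `D`.
  let ι := {q : V ⧸ D₀ // ∃ x ∈ N, D₀.mkQ x = q}
  have : Finite (V ⧸ D₀) := Finite.of_surjective _ D₀.mkQ_surjective
  have : Finite ι := Subtype.finite
  have := Fintype.ofFinite ι
  choose x hxN hx using fun q : ι => q.2
  have heq : ∀ {q q' : ι}, x q + x q' ∈ D₀ → q = q' := by
    intro q q' h
    refine Subtype.ext ?_
    rw [← hx q, ← hx q', ← sub_eq_zero, ← map_sub, sub_eq_add_of_zmod_two]
    exact (Submodule.Quotient.mk_eq_zero _).2 h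
  have heq' : ∀ {q q' : ι} {y : V}, y + x q ∈ D₀ → y + x q' ∈ D₀ → q = q' := by
    intro q q' y h h'
    refine heq ?_
    have h1 := D₀.add_mem h h'
    rwa [add_add_add_comm, add_self_eq_zero_of_zmod_two, zero_add] at h1
  have hsum : IsOrthogonalSum (codeSpace 0 D E) fun q => codeSpace (x q) D₀ E := by
    refine ⟨fun q q' hq f g => ?_, le_antisymm (iSup_le fun q f hf => ⟨fun y hy => ?_, hf.2⟩) ?_⟩
    · change inner ℂ (f : EuclideanSpace ℂ V) (g : EuclideanSpace ℂ V) = 0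
      rw [PiLp.inner_apply]
      refine Finset.sum_eq_zero fun y _ => ?_
      by_cases hf : (f : EuclideanSpace ℂ V) y = 0
      · rw [hf, inner_zero_left]
      by_cases hg : (g : EuclideanSpace ℂ V) y = 0
      · rw [hg, inner_zero_right]
      exact absurd (heq' (f.2.1 y hf) (g.2.1 y hg)) hq
    · rw [add_zero, ← add_add_cancel_of_zmod_two y (x q), add_comm, ← hD]
      exact Submodule.add_mem_sup (hxN q) (hf.1 y hy)
    · intro g hg
      let G : ι → EuclideanSpace ℂ V := fun q => WithLp.toLp 2 fun y =>
        if y + x q ∈ D₀ then g y else 0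
      have hG : ∀ q y, G q y = if y + x q ∈ D₀ then g y else 0 := fun q y => rfl
      have hGmem : ∀ q, G q ∈ codeSpace (x q) D₀ E := by
        refine fun q => ⟨fun y hy => ?_, fun e he y => ?_⟩
        · by_contra h
          exact hy (by rw [hG, if_neg h])
        · rw [hG, hG, hg.2 e he, add_right_comm, D₀.add_mem_iff_left (hED he)]
      have hgG : g = ∑ q, G q := by
        ext y
        rw [WithLp.ofLp_sum, Finset.sum_apply]
        by_cases hy : g y = 0
        · rw [hy]
          refine (Finset.sum_eq_zero fun q _ => ?_).symm
          rw [hG, hy, ite_self]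
        · have h1 := hg.1 y hy
          rw [add_zero, ← hD, Submodule.mem_sup] at h1
          obtain ⟨m, hm, d, hd, rfl⟩ := h1
          let q : ι := ⟨D₀.mkQ m, m, hm, rfl⟩
          have hq : m + d + x q ∈ D₀ := by
            have h2 : D₀.mkQ (m + x q) = 0 := by
              rw [← sub_eq_add_of_zmod_two, map_sub, hx q, sub_self]
            rw [add_right_comm]
            exact D₀.add_mem ((Submodule.Quotient.mk_eq_zero _).1 h2) hd
          rw [Finset.sum_eq_single q]
          · rw [hG, if_pos hq]
          · intro q' _ hq'
            rw [hG, if_neg fun h => hq' (heq' h hq)]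
          · exact fun h => absurd (Finset.mem_univ q) h
      rw [hgG]
      exact Submodule.sum_mem _ fun q _ => Submodule.mem_iSup_of_mem q (hGmem q)
  exact ⟨_, fun a => x ((Finite.equivFin ι).symm a), fun a => hxN _,
    hsum.comp_equiv (Finite.equivFin ι).symm⟩

/-- Products of operators are carried to products of operators. -/
theorem Carries.finset_sum {E E' V V' A : Type*} [NormedAddCommGroup E] [InnerProductSpace ℂ E]
    [NormedAddCommGroup E'] [InnerProductSpace ℂ E'] [AddCommMonoid V] [AddCommMonoid V']
    {W : Submodule ℂ E} {F : Submodule ℂ E'} {e : W ≃ₗᵢ[ℂ] F} {f : V → E →ₗ[ℂ] E}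
    {g : V' → E' →ₗ[ℂ] E'} (f_zero : f 0 = LinearMap.id) (f_add : ∀ a b, f (a + b) = f a ∘ₗ f b)
    (g_zero : g 0 = LinearMap.id) (g_add : ∀ a b, g (a + b) = g a ∘ₗ g b)
    {v : A → V} {w : A → V'} {η : A → ℤˣ} (h : ∀ α, Carries e (f (v α)) (sgn (η α) • g (w α)))
    (S : Finset A) :
    Carries e (f (∑ α ∈ S, v α)) (sgn (∏ α ∈ S, η α) • g (∑ α ∈ S, w α)) := by
  classical
  induction S using Finset.induction_on with
  | empty =>
    rw [Finset.sum_empty, Finset.sum_empty, Finset.prod_empty, f_zero, g_zero, sgn_one, one_smul]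
    exact Carries.id
  | insert α S hα ih =>
    rw [Finset.sum_insert hα, Finset.sum_insert hα, Finset.prod_insert hα, f_add, g_add, sgn_mul,
      mul_smul, ← LinearMap.comp_smul, ← LinearMap.smul_comp]
    exact (h α).comp ih

namespace DualPair

variable {Q Q' A I ιr ιs ιρ ισ : Type*} [Fintype Q] [Fintype Q']
variable {P : DualPair Q Q' A I ιr ιs ιρ ισ} {K : ℕ}

/-! ### The two relations -/

section Relations

variable {n : ℕ}

theorem ChargeRelation.exists_prodOX_eq [Fintype I] {U : Fin n → Bits Q} {N : Finset (Fin n)}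
    {J : Finset I} (h : P.ChargeRelation U N J) :
    ∃ u, P.prodOX u = ∑ k ∈ N, U k ∧
      P.prodDX u ∈ Submodule.span (ZMod 2) (Set.range P.ΓX) := by
  classical
  refine ⟨fun i => if i ∈ J then 1 else 0, ?_, ?_⟩
  · rw [prodOX_apply, ← sum_eq_sum_smul_indicator, h.1]
  · rw [prodDX_apply, ← sum_eq_sum_smul_indicator]
    exact h.2

theorem ChargeRelation.onEnds_mem_suspGroup [Fintype I] {U : Fin n → Bits Q} {N : Finset (Fin n)}
    {J : Finset I} (h : P.ChargeRelation U N J) :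
    onEnds Q Q' K (∑ k ∈ N, U k, ∑ k ∈ N, U k) ∈
      P.suspGroup K (Submodule.span (ZMod 2) (Set.range P.ΓX)) := by
  obtain ⟨u, hu, hu'⟩ := h.exists_prodOX_eq
  rw [← hu]
  exact P.onEnds_prodOX_mem_suspGroup hu'

variable {Ω : Fin n → Bits Q'} {N : Finset (Fin n)} {S : Finset A}

/-- The product over `S` of the suspensions at an internal odd layer is the product of the `Ω k` on
both neighbouring even layers, times an element of the span of `GZ` in between. Its eigenvalue `+1`
equates the values on neighbouring layers. -/
theorem BoundaryRelation.dotProduct_evenPart (h : P.BoundaryRelation Ω N S)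
    {x : Bits (Stack Q Q' K)} (hx : x ∈ symmetries (P.bulkZ K)) (j j' : Fin (K + 1)) :
    (∑ k ∈ N, Ω k) ⬝ᵥ evenPart j x = (∑ k ∈ N, Ω k) ⬝ᵥ evenPart j' x := by
  obtain ⟨hsusp, hodd, -⟩ := mem_symmetries_bulkZ.1 hx
  have hstep : ∀ j : Fin K, (∑ k ∈ N, Ω k) ⬝ᵥ evenPart j.succ x =
      (∑ k ∈ N, Ω k) ⬝ᵥ evenPart j.castSucc x := by
    intro j
    have h1 : (∑ α ∈ S, P.OZ α) ⬝ᵥ oddPart j.succ.castSucc x = 0 := by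
      refine dotProduct_eq_zero_of_mem_span h.2 ?_
      rintro _ ⟨r, rfl⟩
      rw [dotProduct_comm]
      exact hodd _ r
    have h2 : ∑ α ∈ S, (P.DZ α ⬝ᵥ evenPart j.castSucc x +
        P.OZ α ⬝ᵥ oddPart j.succ.castSucc x + P.DZ α ⬝ᵥ evenPart j.succ x) = 0 :=
      Finset.sum_eq_zero fun α _ => hsusp α j
    rw [Finset.sum_add_distrib, Finset.sum_add_distrib, ← sum_dotProduct, ← sum_dotProduct,
      ← sum_dotProduct, h1, add_zero, ← h.1, add_comm] at h2
    exact eq_of_add_eq_zero_of_zmod_two h2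
  have h0 : ∀ j, (∑ k ∈ N, Ω k) ⬝ᵥ evenPart j x = (∑ k ∈ N, Ω k) ⬝ᵥ evenPart 0 x := by
    intro j
    induction j using Fin.induction with
    | zero => rfl
    | succ j ih => rw [hstep, ih]
  rw [h0 j, h0 j']

theorem BoundaryRelation.sum_ZVec_dotProduct (h : P.BoundaryRelation Ω N S)
    {x : Bits (Stack Q Q' K)} (hx : x ∈ symmetries (P.bulkZ K)) (l : Fin (K + 1)) :
    (∑ α ∈ S, P.firstZVec K α) ⬝ᵥ x = (∑ k ∈ N, Ω k) ⬝ᵥ evenPart l x ∧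
      (∑ α ∈ S, P.lastZVec K α) ⬝ᵥ x = (∑ k ∈ N, Ω k) ⬝ᵥ evenPart l x := by
  have h1 : ∀ j, (∑ α ∈ S, P.OZ α) ⬝ᵥ oddPart j x = 0 := by
    intro j
    refine dotProduct_eq_zero_of_mem_span h.2 ?_
    rintro _ ⟨r, rfl⟩
    rw [dotProduct_comm]
    exact (mem_symmetries_bulkZ.1 hx).2.1 j r
  simp only [sum_dotProduct, firstZVec_dotProduct, lastZVec_dotProduct, Finset.sum_add_distrib]
  simp only [← sum_dotProduct, h1, zero_add, ← h.1]
  exact ⟨h.dotProduct_evenPart hx _ _, h.dotProduct_evenPart hx _ _⟩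

/-- Adding up all even layers kills each suspension, whose two `DZ` factors cancel, and each `GZ`;
only the `ΓZ` survive. -/
theorem mem_span_ΓZ_of_onEven_mem_span_bulkZ {b : Bits Q'} {l : Fin (K + 1)}
    (hb : (onEven l b : Bits (Stack Q Q' K)) ∈
      Submodule.span (ZMod 2) (Set.range (P.bulkZ K))) :
    b ∈ Submodule.span (ZMod 2) (Set.range P.ΓZ) := by
  have h1 : Submodule.span (ZMod 2) (Set.range (P.bulkZ K)) ≤
      (Submodule.span (ZMod 2) (Set.range P.ΓZ)).comap (∑ j, evenPart j) := by
    rw [Submodule.span_le]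
    rintro _ ⟨⟨α, j⟩ | ⟨r, j⟩ | ⟨σ, j⟩, rfl⟩
    · simp [bulkZ, suspZ, Finset.sum_add_distrib,
        add_self_eq_zero_of_zmod_two]
    · simp [bulkZ]
    · have h : P.ΓZ σ ∈ Submodule.span (ZMod 2) (Set.range P.ΓZ) :=
        Submodule.subset_span ⟨σ, rfl⟩
      simpa [bulkZ] using h
  simpa using h1 hb

/-- A basis state on which the product of dual symmetries has a given value. -/
theorem exists_mem_symmetries_bulkZ_bitSign_eq {G : Submodule (ZMod 2) (Bits Q')}
    (hΩ : IsNonlocalGenerators G P.ΓZ Ω) (hN : N.Nonempty) (l : Fin (K + 1)) (u : ℤˣ) :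
    ∃ x ∈ symmetries (P.bulkZ K), bitSign ((∑ k ∈ N, Ω k) ⬝ᵥ evenPart l x) = u := by
  obtain ⟨x, hx, hx1⟩ : ∃ x ∈ symmetries (P.bulkZ K), (∑ k ∈ N, Ω k) ⬝ᵥ evenPart l x ≠ 0 := by
    by_contra! h
    refine hN.ne_empty (hΩ.indep N (mem_span_ΓZ_of_onEven_mem_span_bulkZ (l := l)
      (mem_span_of_forall_dotProduct_eq_zero (P.bulkZ K) _ fun x hx => ?_)))
    rw [onEven_dotProduct]
    exact h x fun k => by rw [dotProduct_comm]; exact hx k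
  replace hx1 := (zmod_two_eq_zero_or_one _).resolve_left hx1
  rcases Int.units_eq_one_or u with rfl | rfl
  · exact ⟨0, Submodule.zero_mem _, by simp⟩
  · exact ⟨x, hx, by rw [hx1, bitSign_one]⟩

end Relations

/-! ### Operators on two copies -/

section TwoCopies

variable [DecidableEq Q]

theorem map_pauliZ_eq_self {φ : Hilb Q ⊗[ℂ] Hilb Q} (hφ : φ ∈ P.twoCopies) {b b' : Bits Q}
    (hb : b ∈ Submodule.span (ZMod 2) (Set.range P.GZ))
    (hb' : b' ∈ Submodule.span (ZMod 2) (Set.range P.GZ)) :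
    TensorProduct.map (pauliZ b) (pauliZ b') φ = φ := by
  have h0 : ∀ {b y : Bits Q}, b ∈ Submodule.span (ZMod 2) (Set.range P.GZ) →
      y ∈ symmetries P.GZ → b ⬝ᵥ y = 0 := fun hb hy => by
    refine dotProduct_eq_zero_of_mem_span hb ?_
    rintro _ ⟨r, rfl⟩
    rw [dotProduct_comm]
    exact hy r
  apply (tensorFun Q).injective
  ext y
  rw [tensorFun_map_pauliZ]
  by_cases hy : tensorFun Q φ y = 0
  · rw [hy, mul_zero]
  · have h1 := (mem_twoCopies_iff.1 hφ).1 y hy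
    rw [add_zero] at h1
    rw [h0 hb h1.1, h0 hb' h1.2, add_zero, bitSign_zero, sgn_one, one_mul]

/-- The product is carried to a sign times an operator generated by `GZ`, which is the identity on
`twoCopies`; injectivity of `e` pulls the scalar back. -/
theorem pauliZ_sum_eq_smul {B N : Type*} [Fintype N] [DecidableEq N] {W : Submodule ℂ (Hilb N)}
    {F : Submodule ℂ (Hilb Q ⊗[ℂ] Hilb Q)} (hF : F ≤ P.twoCopies) {e : W ≃ₗᵢ[ℂ] F}
    {v : B → Bits N} {w : B → Bits Q × Bits Q} {η : B → ℤˣ}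
    (h : ∀ α, Carries e (pauliZ (v α))
      (sgn (η α) • TensorProduct.map (pauliZ (w α).1) (pauliZ (w α).2))) {S : Finset B}
    (hw : (∑ α ∈ S, w α).1 ∈ Submodule.span (ZMod 2) (Set.range P.GZ))
    (hw' : (∑ α ∈ S, w α).2 ∈ Submodule.span (ZMod 2) (Set.range P.GZ))
    {ψ : Hilb N} (hψ : ψ ∈ W) :
    pauliZ (∑ α ∈ S, v α) ψ = sgn (∏ α ∈ S, η α) • ψ := by
  have h1 := Carries.finset_sum (e := e) (f := pauliZ)
    (g := fun w : Bits Q × Bits Q => TensorProduct.map (pauliZ w.1) (pauliZ w.2)) pauliZ_zero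
    pauliZ_add (by simp) (fun a b => by
      rw [Prod.fst_add, Prod.snd_add, pauliZ_add, pauliZ_add, TensorProduct.map_comp]) h S
  obtain ⟨h2, h3⟩ := h1 ⟨ψ, hψ⟩
  rw [LinearMap.smul_apply, map_pauliZ_eq_self (hF (Submodule.coe_mem _)) hw hw'] at h3
  have h4 : e ⟨_, h2⟩ = e (sgn (∏ α ∈ S, η α) • ⟨ψ, hψ⟩) := by
    rw [map_smul]
    exact Subtype.ext h3
  exact congrArg Subtype.val (e.injective h4)

theorem IsTwoCopies.pauliZ_sum_ZVec [DecidableEq Q'] {W : Submodule ℂ (Hilb (Stack Q Q' K))}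
    {F : Submodule ℂ (Hilb Q ⊗[ℂ] Hilb Q)} (hF : F ≤ P.twoCopies) {ε ε' : I → ℤˣ} {η η' : A → ℤˣ}
    (h : P.IsTwoCopies K W F ε ε' η η') {S : Finset A}
    (hS : ∑ α ∈ S, P.OZ α ∈ Submodule.span (ZMod 2) (Set.range P.GZ))
    {ψ : Hilb (Stack Q Q' K)} (hψ : ψ ∈ W) :
    pauliZ (∑ α ∈ S, P.firstZVec K α) ψ = sgn (∏ α ∈ S, η α) • ψ ∧
      pauliZ (∑ α ∈ S, P.lastZVec K α) ψ = sgn (∏ α ∈ S, η' α) • ψ := by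
  obtain ⟨e, -, -, h1, h2⟩ := h
  have h0 : ∑ _α ∈ S, (0 : Bits Q) ∈ Submodule.span (ZMod 2) (Set.range P.GZ) :=
    Submodule.sum_mem _ fun _ _ => Submodule.zero_mem _
  constructor
  · refine pauliZ_sum_eq_smul hF (e := e) (w := fun α => (P.OZ α, 0)) (fun α => ?_) ?_ ?_ hψ
    · rw [pauliZ_zero]
      exact h1 α
    · rwa [Prod.fst_sum]
    · rwa [Prod.snd_sum]
  · refine pauliZ_sum_eq_smul hF (e := e) (w := fun α => (0, P.OZ α)) (fun α => ?_) ?_ ?_ hψ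
    · rw [pauliZ_zero]
      exact h2 α
    · rwa [Prod.fst_sum]
    · rwa [Prod.snd_sum]

theorem tmul_mem_twoCopies {φ ψ : Hilb Q} (hφ : φ ∈ P.gaugeSpace) (hψ : ψ ∈ P.gaugeSpace) :
    φ ⊗ₜ[ℂ] ψ ∈ P.twoCopies :=
  ⟨(⟨φ, hφ⟩ : P.gaugeSpace) ⊗ₜ (⟨ψ, hψ⟩ : P.gaugeSpace), TensorProduct.map_tmul _ _ _ _⟩

end TwoCopies

end DualPair

namespace DualPair

variable {Q Q' A I ιr ιs ιρ ισ : Type*} [Fintype Q] [DecidableEq Q] [Fintype Q'] [DecidableEq Q']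
  [Fintype A] [Fintype I] [Fintype ιr] [Fintype ιs] [Fintype ιρ] [Fintype ισ]
variable {P : DualPair Q Q' A I ιr ιs ιρ ισ} {K : ℕ}
variable {nZ nX mX mZ : ℕ} {UZ : Fin nZ → Bits Q} {UX : Fin nX → Bits Q} {ΩX : Fin mX → Bits Q'}
  {ΩZ : Fin mZ → Bits Q'} {l : Fin (K + 1)}

/-! ### Locked symmetry charges -/

theorem ChargeRelation.pauliX_eq {N : Finset (Fin nX)} {J : Finset I}
    (h : P.ChargeRelation UX N J) {ψ : Hilb (Stack Q Q' K)} (hψ : ψ ∈ P.bdrySpace K) :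
    pauliX (onOdd 0 (∑ k ∈ N, UX k)) ψ =
      pauliX (onOdd (Fin.last (K + 1)) (∑ k ∈ N, UX k)) ψ := by
  rw [bdrySpace_eq_codeSpace] at hψ
  ext x
  have h1 := hψ.2 _ h.onEnds_mem_suspGroup (x + onOdd 0 (∑ k ∈ N, UX k))
  rw [onEnds_apply, ← add_assoc, add_add_cancel_of_zmod_two] at h1
  exact h1.symm

/-- By independence modulo `GX`, the product of the `UX k` on one end alone is not in `ficGroup`,
hence not generated by the `X`-type stabilizers and labels; its sign is free. -/
theorem exists_mem_sector_pauliX_eq (hUZ : IsNonlocalGenerators P.symZ P.GZ UZ)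
    (hUX : IsNonlocalGenerators P.symX P.GX UX)
    (hΩX : IsNonlocalGenerators P.dualSymX P.ΓX ΩX)
    (hΩZ : IsNonlocalGenerators P.dualSymZ P.ΓZ ΩZ) {N : Finset (Fin nX)} (hN : N.Nonempty)
    {t : SectorLabel K nZ mX mZ} (ht : P.sector UZ ΩX ΩZ K l t ≠ ⊥) (u : ℤˣ) :
    ∃ ψ ∈ P.sector UZ ΩX ΩZ K l t, ψ ≠ 0 ∧
      pauliX (onOdd 0 (∑ k ∈ N, UX k)) ψ = sgn u • ψ := by
  have hU : ∑ k ∈ N, UX k ∈ P.symX := Submodule.sum_mem _ fun k _ => hUX.mem k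
  have hpair : ((∑ k ∈ N, UX k, 0) : Bits Q × Bits Q) ∈ P.gaugePairs :=
    Submodule.mem_prod.2 ⟨P.symX_le_symmetries_GZ hU, Submodule.zero_mem _⟩
  rw [sector_eq_stabSpace] at ht ⊢
  refine exists_mem_stabSpace_pauliX_eq (sectorZ_dotProduct_sectorX hUZ hΩX hΩZ) ht
    (fun k => ?_) (fun h => ?_) u
  · rw [dotProduct_comm, ← onEnds_left]
    exact onEnds_mem_symmetries_sectorZ hpair k
  · rw [span_range_sectorX hΩX, ← onEnds_left] at h
    have h1 := P.gaugePairs_inf_comap_suspGroup_dualSymX.le ⟨hpair, h⟩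
    have h2 := (P.mem_ficGroup.1 h1).2
    rw [add_zero] at h2
    exact hN.ne_empty (hUX.indep N h2)

/-! ### Locked boundary conditions -/

theorem BoundaryRelation.bitSign_sum_ZVec_dotProduct {N : Finset (Fin mZ)} {S : Finset A}
    (h : P.BoundaryRelation ΩZ N S) {t : SectorLabel K nZ mX mZ} {ψ : Hilb (Stack Q Q' K)}
    (hψ : ψ ∈ P.sector UZ ΩX ΩZ K l t) {x : Bits (Stack Q Q' K)} (hx : ψ x ≠ 0) :
    bitSign ((∑ α ∈ S, P.firstZVec K α) ⬝ᵥ x) = ∏ k ∈ N, t.dualZ k ∧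
      bitSign ((∑ α ∈ S, P.lastZVec K α) ⬝ᵥ x) = ∏ k ∈ N, t.dualZ k := by
  rw [sector_eq_stabSpace, mem_stabSpace] at hψ
  have h1 := fun k => pauliZ_eq_smul_iff.1 (hψ.1 k) x hx
  have h2 := h.sum_ZVec_dotProduct (mem_symmetries_bulkZ_of_bitSign_eq h1) l
  have h3 : bitSign ((∑ k ∈ N, ΩZ k) ⬝ᵥ evenPart l x) = ∏ k ∈ N, t.dualZ k := by
    rw [sum_dotProduct, bitSign_sum]
    refine Finset.prod_congr rfl fun k _ => ?_
    rw [← onEven_dotProduct]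
    exact h1 (Sum.inr (Sum.inl k))
  rw [h2.1, h2.2]
  exact ⟨h3, h3⟩

/-- At one basis state in the support of a vector of the sector, the product of Ising boundary terms
is computed twice: from the isomorphism and from the labels. -/
theorem BoundaryRelation.prod_eq {N : Finset (Fin mZ)} {S : Finset A}
    (h : P.BoundaryRelation ΩZ N S) {t : SectorLabel K nZ mX mZ}
    (ht : P.sector UZ ΩX ΩZ K l t ≠ ⊥) {ε ε' : I → ℤˣ} {η η' : A → ℤˣ}
    (hW : P.IsTwoCopies K (P.sector UZ ΩX ΩZ K l t) (P.ficSpace UX) ε ε' η η') :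
    ∏ α ∈ S, η α = ∏ k ∈ N, t.dualZ k ∧ ∏ α ∈ S, η' α = ∏ k ∈ N, t.dualZ k := by
  obtain ⟨ψ, hψ, h0⟩ := Submodule.exists_mem_ne_zero_of_ne_bot ht
  obtain ⟨x, hx⟩ := exists_apply_ne_zero h0
  have h1 := hW.pauliZ_sum_ZVec inf_le_left h.2 hψ
  have h2 := h.bitSign_sum_ZVec_dotProduct hψ hx
  exact ⟨(pauliZ_eq_smul_iff.1 h1.1 x hx).symm.trans h2.1,
    (pauliZ_eq_smul_iff.1 h1.2 x hx).symm.trans h2.2⟩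

theorem exists_sector_ne_bot (hUZ : IsNonlocalGenerators P.symZ P.GZ UZ)
    (hΩX : IsNonlocalGenerators P.dualSymX P.ΓX ΩX)
    (hΩZ : IsNonlocalGenerators P.dualSymZ P.ΓZ ΩZ) {N : Finset (Fin mZ)} (hN : N.Nonempty)
    (u : ℤˣ) :
    ∃ t, P.sector UZ ΩX ΩZ K l t ≠ ⊥ ∧ ∏ k ∈ N, t.dualZ k = u := by
  obtain ⟨x, hx, rfl⟩ := exists_mem_symmetries_bulkZ_bitSign_eq (K := K) hΩZ hN l u
  -- The `Z`-type labels are read off from the basis state `x`; the `X`-type ones can be taken to be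
  -- `1`.
  refine ⟨⟨fun k => bitSign (ΩZ k ⬝ᵥ evenPart l x),
    fun j k => bitSign (UZ k ⬝ᵥ oddPart j.succ.castSucc x), 1⟩, ?_, ?_⟩
  · rw [sector_eq_stabSpace]
    refine stabSpace_ne_bot (sectorZ_dotProduct_sectorX hUZ hΩX hΩZ) (a := x) (b := 0) ?_ ?_
    · rintro (k | k | ⟨j, k⟩)
      · have h1 := hx k
        rw [dotProduct_comm] at h1
        exact (congrArg bitSign h1).trans bitSign_zero
      · exact congrArg bitSign (onEven_dotProduct _ _ _)
      · exact congrArg bitSign (onOdd_dotProduct _ _ _)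
    · intro k
      rw [zero_dotProduct]
      rcases k with k | k <;> rfl
  · rw [sum_dotProduct, bitSign_sum]

/-! ### The criterion -/

theorem bdrySpace_ne_bot : P.bdrySpace K ≠ ⊥ := by
  rw [bdrySpace_eq_stabSpace]
  exact stabSpace_one_ne_bot bulkZ_dotProduct_bulkX

/-- An unconstrained pair would inherit `U ⊗ 1 = 1 ⊗ U` from the locking, but it contains a nonzero
product `ψ ⊗ φ` with charges `+1` and `-1`. -/
theorem ChargeRelation.anomalous (hUX : IsNonlocalGenerators P.symX P.GX UX)
    {N : Finset (Fin nX)} (hN : N.Nonempty) {J : Finset I} (h : P.ChargeRelation UX N J) :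
    P.Anomalous K := by
  rintro ⟨D, W, ⟨-, hsup⟩, hW⟩
  have hD : Nonempty (Fin D) := by
    by_contra h0
    rw [not_nonempty_iff] at h0
    exact bdrySpace_ne_bot (P := P) (K := K) (by rw [← hsup, iSup_of_empty])
  obtain ⟨a⟩ := hD
  obtain ⟨e, h1, h2, -, -⟩ := hW a
  set U := ∑ k ∈ N, UX k with hU
  have hprod := fun (w : I → Bits Q × Bits Q) (v : I → Bits (Stack Q Q' K))
      (hw : ∀ i, Carries e (pauliX (v i))
        (sgn ((1 : I → ℤˣ) i) • TensorProduct.map (pauliX (w i).1) (pauliX (w i).2))) =>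
    Carries.finset_sum (e := e) (f := pauliX)
      (g := fun w : Bits Q × Bits Q => TensorProduct.map (pauliX w.1) (pauliX w.2)) pauliX_zero
      pauliX_add (by simp) (fun a b => by
        rw [Prod.fst_add, Prod.snd_add, pauliX_add, pauliX_add, TensorProduct.map_comp]) hw J
  have hfirst := hprod (fun i => (P.OX i, 0)) (fun i => onOdd 0 (P.OX i))
    (fun i => by rw [pauliX_zero]; exact h1 i)
  have hlast := hprod (fun i => (0, P.OX i)) (fun i => onOdd (Fin.last (K + 1)) (P.OX i))
    (fun i => by rw [pauliX_zero]; exact h2 i)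
  simp only [← onOddₗ_apply, ← map_sum, ← h.1, ← hU, Pi.one_apply, Finset.prod_const_one, sgn_one,
    one_smul, Prod.fst_sum, Prod.snd_sum, Finset.sum_const_zero, pauliX_zero] at hfirst hlast
  have hlock : ∀ φ ∈ P.twoCopies, TensorProduct.map (pauliX U) LinearMap.id φ =
      TensorProduct.map LinearMap.id (pauliX U) φ := by
    intro φ hφ
    obtain ⟨ψ, hψ⟩ := e.surjective ⟨φ, hφ⟩
    obtain ⟨h3, h4⟩ := hfirst ψ
    obtain ⟨h5, h6⟩ := hlast ψ
    rw [hψ] at h4 h6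
    rw [← h4, ← h6]
    congr 2
    refine Subtype.ext (h.pauliX_eq ?_)
    rw [← hsup]
    exact Submodule.mem_iSup_of_mem a ψ.2
  have hUX' : U ∈ P.symX := Submodule.sum_mem _ fun k _ => hUX.mem k
  have hex : ∀ u : ℤˣ, ∃ ψ ∈ P.gaugeSpace, ψ ≠ 0 ∧ pauliX U ψ = sgn u • ψ := by
    have hGG : ∀ r s, P.GZ r ⬝ᵥ P.GX s = 0 := fun r s => by
      rw [dotProduct_comm]
      exact P.symX_le_symmetries_GZ (P.GX_mem s) r
    rw [gaugeSpace_eq_stabSpace]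
    refine exists_mem_stabSpace_pauliX_eq hGG (stabSpace_one_ne_bot hGG) (fun r => ?_)
      fun h0 => hN.ne_empty (hUX.indep N h0)
    rw [dotProduct_comm]
    exact P.symX_le_symmetries_GZ hUX' r
  obtain ⟨ψ, hψ, hψ0, hψU⟩ := hex 1
  obtain ⟨φ, hφ, hφ0, hφU⟩ := hex (-1)
  have h3 := hlock _ (tmul_mem_twoCopies hψ hφ)
  rw [TensorProduct.map_tmul, TensorProduct.map_tmul, hψU, hφU, LinearMap.id_apply,
    LinearMap.id_apply, sgn_one, one_smul, sgn_neg_one, neg_one_smul, TensorProduct.tmul_neg] at h3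
  have h4 : ψ ⊗ₜ[ℂ] φ = 0 := by
    have h6 : (2 : ℂ) • (ψ ⊗ₜ[ℂ] φ) = 0 := by
      rw [two_smul]
      exact eq_neg_iff_add_eq_zero.1 h3
    exact (smul_eq_zero.1 h6).resolve_left two_ne_zero
  have h5 : ‖ψ‖ * ‖φ‖ = 0 := by rw [← TensorProduct.norm_tmul (𝕜 := ℂ) ψ φ, h4, norm_zero]
  exact mul_ne_zero (norm_ne_zero_iff.2 hψ0) (norm_ne_zero_iff.2 hφ0) h5

/-- Unconstrained pairs with signs `+1` would make the product of Ising boundary terms equal to `1`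
on the whole boundary space, whereas some nonzero sector has the value `-1`. -/
theorem BoundaryRelation.anomalous (hUZ : IsNonlocalGenerators P.symZ P.GZ UZ)
    (hΩX : IsNonlocalGenerators P.dualSymX P.ΓX ΩX)
    (hΩZ : IsNonlocalGenerators P.dualSymZ P.ΓZ ΩZ)
    {N : Finset (Fin mZ)} (hN : N.Nonempty) {S : Finset A} (h : P.BoundaryRelation ΩZ N S) :
    P.Anomalous K := by
  rintro ⟨D, W, ⟨-, hsup⟩, hW⟩
  have h1 : P.bdrySpace K ≤
      Module.End.eigenspace (pauliZ (∑ α ∈ S, P.firstZVec K α)) 1 := by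
    rw [← hsup]
    refine iSup_le fun a ψ hψ => Module.End.mem_eigenspace_iff.2 ?_
    have h2 := ((hW a).pauliZ_sum_ZVec le_rfl h.2 hψ).1
    simpa using h2
  obtain ⟨t, ht, hu⟩ := exists_sector_ne_bot (K := K) (l := 0) hUZ hΩX hΩZ hN (-1)
  obtain ⟨ψ, hψ, h0⟩ := Submodule.exists_mem_ne_zero_of_ne_bot ht
  obtain ⟨x, hx⟩ := exists_apply_ne_zero h0
  have h2 := (h.bitSign_sum_ZVec_dotProduct hψ hx).1
  have h3 := h1 (isOrthogonalSum_sector hUZ hΩX hΩZ |>.2.le (Submodule.mem_iSup_of_mem t hψ))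
  rw [Module.End.mem_eigenspace_iff, ← sgn_one] at h3
  rw [hu, pauliZ_eq_smul_iff.1 h3 x hx] at h2
  exact absurd h2 (by decide)

/-- Without the two relations, the boundary space consists of unconstrained pairs of copies. -/
theorem not_anomalous
    (hX : ∀ u, P.prodDX u ∈ Submodule.span (ZMod 2) (Set.range P.ΓX) →
      P.prodOX u ∈ Submodule.span (ZMod 2) (Set.range P.GX))
    (hZ : ∀ u, P.prodOZ u ∈ Submodule.span (ZMod 2) (Set.range P.GZ) →
      P.prodDZ u ∈ Submodule.span (ZMod 2) (Set.range P.ΓZ)) : ¬ P.Anomalous K := by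
  rw [Anomalous, not_not]
  let E := P.suspGroup K (Submodule.span (ZMod 2) (Set.range P.ΓX))
  let D₀ := P.gaugePairs.map (onEnds Q Q' K) ⊔ E
  -- Representatives taken from `N` commute with all Ising boundary terms, so every piece of the
  -- decomposition has trivial signs.
  let N := symmetries (P.bulkZ K) ⊓ symmetries (Sum.elim (P.firstZVec K) (P.lastZVec K))
  have hends : ∀ y ∈ P.gaugePairs, onEnds Q Q' K y ∈ symmetries (P.bulkZ K) := fun y hy =>
    (mem_symmetries_sectorZ (UZ := Fin.elim0) (ΩZ := Fin.elim0) (l := 0).1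
      (onEnds_mem_symmetries_sectorZ hy)).1
  have hE : E ≤ symmetries (P.bulkZ K) := by
    change P.suspGroup K _ ≤ _
    rw [← span_range_bulkX, Submodule.span_le]
    rintro _ ⟨k, rfl⟩ k'
    rw [dotProduct_comm]
    exact bulkZ_dotProduct_bulkX k' k
  have hD : N ⊔ D₀ = symmetries (P.bulkZ K) := by
    refine le_antisymm (sup_le inf_le_left (sup_le ?_ hE)) fun x hx => ?_
    · rintro _ ⟨y, hy, rfl⟩
      exact hends y hy
    · obtain ⟨y, hy, hxy⟩ := exists_add_onEnds_dotProduct_eq_zero hZ hx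
      rw [← add_add_cancel_of_zmod_two x (onEnds Q Q' K y)]
      refine Submodule.add_mem_sup ⟨Submodule.add_mem _ hx (hends y hy), ?_⟩
        (Submodule.mem_sup_left ⟨y, hy, rfl⟩)
      rintro (α | α)
      · rw [dotProduct_comm]; exact (hxy α).1
      · rw [dotProduct_comm]; exact (hxy α).2
  obtain ⟨n, x, hx, hsum⟩ := exists_isOrthogonalSum_codeSpace (le_sup_right : E ≤ D₀) hD
  refine ⟨n, fun a => codeSpace (x a) D₀ E, by rwa [bdrySpace_eq_codeSpace], fun a => ?_⟩
  refine isTwoCopies_codeSpace (fun ψ => mem_twoCopies_iff) rfl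
    (P.gaugePairs_inf_comap_suspGroup_span_ΓX hX) (P.suspGroup_mono P.span_ΓX_le_dualSymX)
    fun α => ⟨?_, ?_⟩
  · rw [dotProduct_comm]; exact (hx a).2 (Sum.inl α)
  · rw [dotProduct_comm]; exact (hx a).2 (Sum.inr α)

end DualPair

end GI

end

/-! ### The theorem -/

theorem claim1 {M Q Q' A I ιr ιs ιρ ισ : Type*} [PseudoMetricSpace M]
    [Fintype Q] [DecidableEq Q] [Fintype Q'] [DecidableEq Q'] [Fintype A] [Fintype I]
    [Fintype ιr] [Fintype ιs] [Fintype ιρ] [Fintype ισ]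
    (P : GI.DualPair Q Q' A I ιr ιs ιρ ισ)
    (pos : Q → M) (pos' : Q' → M) (ℓ c R : ℝ) (hP : P.IsLocal pos pos' ℓ c R)
    {nZ nX mX mZ : ℕ}
    (UZ : Fin nZ → GI.Bits Q) (hUZ : GI.IsNonlocalGenerators P.symZ P.GZ UZ)
    (UX : Fin nX → GI.Bits Q) (hUX : GI.IsNonlocalGenerators P.symX P.GX UX)
    (ΩX : Fin mX → GI.Bits Q') (hΩX : GI.IsNonlocalGenerators P.dualSymX P.ΓX ΩX)
    (ΩZ : Fin mZ → GI.Bits Q') (hΩZ : GI.IsNonlocalGenerators P.dualSymZ P.ΓZ ΩZ)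
    (K : ℕ) (l : Fin (K + 1)) :
    -- the criterion
    (P.Anomalous K ↔
      (∃ N : Finset (Fin nX), N.Nonempty ∧ ∃ J, P.ChargeRelation UX N J) ∨
      (∃ N : Finset (Fin mZ), N.Nonempty ∧ ∃ S, P.BoundaryRelation ΩZ N S)) ∧
    -- the boundary space is the direct sum of the sectors
    GI.IsOrthogonalSum (P.bdrySpace K) (P.sector UZ ΩX ΩZ K l) ∧
    -- the sector with trivial label is a pair of copies with `U_k ⊗ U_k = 1`
    P.sector UZ ΩX ΩZ K l (GI.SectorLabel.trivial K nZ mX mZ) ≠ ⊥ ∧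
    P.IsTwoCopies K (P.sector UZ ΩX ΩZ K l (GI.SectorLabel.trivial K nZ mX mZ))
      (P.ficSpace UX) 1 1 1 1 ∧
    -- so is every other sector, up to signs; those of the Ising terms agree in the two copies
    (∀ t, P.sector UZ ΩX ΩZ K l t ≠ ⊥ → ∃ (ε : I → ℤˣ) (η : A → ℤˣ),
      P.IsTwoCopies K (P.sector UZ ΩX ΩZ K l t) (P.ficSpace UX) ε 1 η η) ∧
    -- under the first condition the charges of the two copies are locked in all sectors,
    -- while each copy has both values of the charge in each sector
    (∀ N : Finset (Fin nX), N.Nonempty → ∀ J, P.ChargeRelation UX N J →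
      (∀ ψ ∈ P.bdrySpace K, GI.pauliX (GI.onOdd 0 (∑ k ∈ N, UX k)) ψ =
        GI.pauliX (GI.onOdd (Fin.last (K + 1)) (∑ k ∈ N, UX k)) ψ) ∧
      ∀ t, P.sector UZ ΩX ΩZ K l t ≠ ⊥ → ∀ u : ℤˣ, ∃ ψ ∈ P.sector UZ ΩX ΩZ K l t, ψ ≠ 0 ∧
        GI.pauliX (GI.onOdd 0 (∑ k ∈ N, UX k)) ψ = GI.sgn u • ψ ∧
        GI.pauliX (GI.onOdd (Fin.last (K + 1)) (∑ k ∈ N, UX k)) ψ = GI.sgn u • ψ) ∧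
    -- under the second condition the generalized boundary conditions of the two copies are equal,
    -- they are fixed in each sector, and both values occur among the sectors
    (∀ N : Finset (Fin mZ), N.Nonempty → ∀ S, P.BoundaryRelation ΩZ N S →
      (∀ t, P.sector UZ ΩX ΩZ K l t ≠ ⊥ → ∀ (ε ε' : I → ℤˣ) (η η' : A → ℤˣ),
        P.IsTwoCopies K (P.sector UZ ΩX ΩZ K l t) (P.ficSpace UX) ε ε' η η' →
          ∏ α ∈ S, η α = ∏ k ∈ N, t.dualZ k ∧ ∏ α ∈ S, η' α = ∏ k ∈ N, t.dualZ k) ∧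
      ∀ u : ℤˣ, ∃ t, P.sector UZ ΩX ΩZ K l t ≠ ⊥ ∧ ∏ k ∈ N, t.dualZ k = u) := by
  have hanomalous : P.Anomalous K ↔
      (∃ N : Finset (Fin nX), N.Nonempty ∧ ∃ J, P.ChargeRelation UX N J) ∨
      (∃ N : Finset (Fin mZ), N.Nonempty ∧ ∃ S, P.BoundaryRelation ΩZ N S) := by
    constructor
    · intro h
      by_contra! h'
      -- The only place where locality enters: it converts the failure of the two relations into the
      -- two implications between local triviality of a product and of its dual.
      exact GI.DualPair.not_anomalous (hP.prodOX_mem_span_GX hUX h'.1)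
        (hP.prodDZ_mem_span_ΓZ hΩZ h'.2) h
    · rintro (⟨N, hN, J, h⟩ | ⟨N, hN, S, h⟩)
      exacts [h.anomalous hUX hN, h.anomalous hUZ hΩX hΩZ hN]
  refine ⟨hanomalous, GI.DualPair.isOrthogonalSum_sector hUZ hΩX hΩZ,
    GI.DualPair.sector_trivial_ne_bot hUZ hΩX hΩZ,
    GI.DualPair.isTwoCopies_sector_trivial hUZ hUX hΩX hΩZ,
    GI.DualPair.exists_isTwoCopies_sector hUZ hUX hΩX hΩZ,
    fun N hN J h => ⟨fun ψ hψ => h.pauliX_eq hψ, fun t ht u => ?_⟩,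
    fun N hN S h => ⟨fun t ht ε ε' η η' hW => h.prod_eq ht hW,
      GI.DualPair.exists_sector_ne_bot hUZ hΩX hΩZ hN⟩⟩
  obtain ⟨ψ, hψ, h0, hu⟩ :=
    GI.DualPair.exists_mem_sector_pauliX_eq hUZ hUX hΩX hΩZ hN ht u
  refine ⟨ψ, hψ, h0, hu, ?_⟩
  rw [← h.pauliX_eq ((GI.DualPair.isOrthogonalSum_sector hUZ hΩX hΩZ).2.le
    (Submodule.mem_iSup_of_mem t hψ)), hu]
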